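/- **Theorem.** Let $\mathcal X\subset\mathbb R^d$ be non-empty, let $k$ be a kernel on $\mathcal X$ and suppose that $\kappa\le k(x,x)\le 1$ for all $x\in\mathcal X$, for some $\kappa>0$. Let $f\sim\mathcal{GP}(0,k)$, and let $y_t=f(x_t)+\epsilon_t$ be observed at the query $x_t\in\mathcal X$, where the $\epsilon_t\sim\mathcal N(0,\sigma^2)$, $\sigma^2>0$, are i.i.d. and independent of $f$. Let $$\mu_{t}(x)=\mathbf k_{t}(x)^\top(\mathbf K_{t}+\sigma^2 \mathbf I)^{-1}\mathbf y_{t},\qquad \sigma_{t}^2(x)=k(x,x)-\mathbf k_{t}(x)^\top(\mathbf K_{t}+\sigma^2 \mathbf I)^{-1}\mathbf k_{t}(x)$$ be the posterior mean and variance given $(x_i,y_i)_{i\le t}$, where $\mathbf k_t(x)=(k(x,x_i))_{i\le t}$, $\mathbf K_t=(k(x_i,x_j))_{i,j\le t}$ and $\mathbf y_t=(y_i)_{i\le t}$. With the standard normal distribution function $\Phi$ and density $\phi$, put $\tau(c)=c\Phi(c)+\phi(c)$, $\mathrm{EI}(m,s,w)=s\,\tau((m-w)/s)$ for $s>0$ and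 $\mathrm{EI}(m,0,w)=\max\{m-w,0\}$. Let $\gamma_T$ be the maximum information gain, the supremum over $a_1,\dots,a_T\in\mathcal X$ (repetitions allowed) of the Shannon mutual information of $(f(a_i)+\epsilon_i)_{i\le T}$ and $(f(a_i))_{i\le T}$. Let $\delta\in(0,1)$, and assume one of the following. (i) $\mathcal X$ is finite, and $\beta_t(\delta)=2\log\bigl(|\mathcal X|t^2\pi^2/(6\delta)\bigr)$. (ii) $\mathcal X\subset[0,r]^d$, $r>0$, is compact and convex, almost every sample path of $f$ is differentiable on $\mathcal X$, there are $a\ge1$ and $b>0$ such that $L_j=\sup_{x\in\mathcal X}|\partial f/\partial x_j|$ satisfies $\Pr(L_j>c)\le a\exp(-(c/b)^2)$ for all $c>0$ and $j=1,\dots,d$, and $$\beta_t(\delta)=2\log\bigl(\pi^2t^2/(3\delta)\bigr)+2d\log\Bigl(\bigl\lceil bdrt^2\sqrt{\log(4ad/\delta)}\bigr\rceil+1\Bigr).$$ For all $t\ge 1$ let $x_t\in\arg\max_{x\in\mathcal X}\mathrm{EI}\bigl(\mu_{t-1}(x),\beta_t^{1/2}(\delta)\sigma_{t-1}(x),\max_{z\in\mathcal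 X}\mu_{t-1}(z)\bigr)$, where ties are broken by means of the past data and possibly of randomness independent of $f$ and the noise. Then there is a constant $C$ that depends only on $\sigma^2$ and $\kappa$ such that, with probability at least $1-\delta$, a maximizer $x^*$ of $f$ on $\mathcal X$ exists and the cumulative regret satisfies $$R_T=\sum_{t=1}^T\bigl(f(x^*)-f(x_t)\bigr)\le C\sqrt{\beta_T(\delta)\,\gamma_T\,T\log T}\qquad\text{for all }T\ge2 .$$ In particular, with probability at least $1-\delta$, $R_T=O\bigl(\sqrt{\beta_T(\delta)\gamma_TT\log T}\bigr)$. -/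

import Mathlib

open MeasureTheory ProbabilityTheory
open scoped NNReal ENNReal Matrix

noncomputable section

namespace GPEI

/-! ### Posterior of a Gaussian process and the expected improvement -/

/-- The matrix `K + v I`, where `K i j = k (xs i) (xs j)`. -/
def regGram {d n : ℕ} (k : (Fin d → ℝ) → (Fin d → ℝ) → ℝ) (v : ℝ) (xs : Fin n → Fin d → ℝ) :
    Matrix (Fin n) (Fin n) ℝ :=
  Matrix.of (fun i j => k (xs i) (xs j)) + v • (1 : Matrix (Fin n) (Fin n) ℝ)

/-- The kernel vector `(k z (xs i))_i`. -/
def kernelVec {d n : ℕ} (k : (Fin d → ℝ) → (Fin d → ℝ) → ℝ) (xs : Fin n → Fin d → ℝ)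
    (z : Fin d → ℝ) : Fin n → ℝ :=
  fun i => k z (xs i)

/-- Posterior mean at `z` after observing `ys` at `xs`, with noise variance `v`. -/
def posteriorMean {d n : ℕ} (k : (Fin d → ℝ) → (Fin d → ℝ) → ℝ) (v : ℝ)
    (xs : Fin n → Fin d → ℝ) (ys : Fin n → ℝ) (z : Fin d → ℝ) : ℝ :=
  kernelVec k xs z ⬝ᵥ ((regGram k v xs)⁻¹ *ᵥ ys)

/-- Posterior variance at `z` after observations at `xs`, with noise variance `v`. -/
def posteriorVar {d n : ℕ} (k : (Fin d → ℝ) → (Fin d → ℝ) → ℝ) (v : ℝ)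
    (xs : Fin n → Fin d → ℝ) (z : Fin d → ℝ) : ℝ :=
  k z z - kernelVec k xs z ⬝ᵥ ((regGram k v xs)⁻¹ *ᵥ kernelVec k xs z)

/-- Posterior standard deviation. -/
def posteriorStd {d n : ℕ} (k : (Fin d → ℝ) → (Fin d → ℝ) → ℝ) (v : ℝ)
    (xs : Fin n → Fin d → ℝ) (z : Fin d → ℝ) : ℝ :=
  Real.sqrt (posteriorVar k v xs z)

/-- `τ(c) = c Φ(c) + φ(c)` with the standard Gaussian distribution function and density. -/
def tau (c : ℝ) : ℝ :=
  c * cdf (gaussianReal 0 1) c + gaussianPDFReal 0 1 c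

/-- Expected improvement over the reference value `ref` of a Gaussian with mean `m` and
standard deviation `s`. -/
def expectedImprovement (m s ref : ℝ) : ℝ :=
  if 0 < s then s * tau ((m - ref) / s) else max (m - ref) 0

/-! ### The Bayesian model -/

/-- `f ∼ GP(0, k)` on `X`. Only the values of `f` and `k` on `X` matter. -/
structure IsCenteredGP {d : ℕ} {Ω : Type*} [MeasurableSpace Ω] (P : Measure Ω)
    (X : Set (Fin d → ℝ)) (k : (Fin d → ℝ) → (Fin d → ℝ) → ℝ)
    (f : (Fin d → ℝ) → Ω → ℝ) : Prop where
  measurable : ∀ x ∈ X, Measurable (f x)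
  gaussian : IsGaussianProcess (fun x : X => f x) P
  mean_zero : ∀ x ∈ X, ∫ ω, f x ω ∂P = 0
  cov_eq : ∀ x ∈ X, ∀ z ∈ X, covariance (f x) (f z) P = k x z

/-- The σ-algebra generated by the values of `f` on `X`. -/
@[reducible] def sigmaF {d : ℕ} {Ω : Type*} (X : Set (Fin d → ℝ)) (f : (Fin d → ℝ) → Ω → ℝ) :
    MeasurableSpace Ω :=
  ⨆ x : X, MeasurableSpace.comap (f x) inferInstance

/-- The σ-algebra generated by the noise sequence. -/
@[reducible] def sigmaNoise {Ω : Type*} (ε : ℕ → Ω → ℝ) : MeasurableSpace Ω :=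
  ⨆ t : ℕ, MeasurableSpace.comap (ε t) inferInstance

/-- `f` is a centred Gaussian process, `ε` is a sequence of i.i.d. `N(0, v)` variables that is
independent of `f`, and `𝒢` is a σ-algebra independent of `(f, ε)`: internal randomness that
may be used to break ties (`𝒢 = ⊥` for a deterministic rule). -/
structure IsBayesModel {d : ℕ} {Ω : Type*} (𝒢 : MeasurableSpace Ω) [mΩ : MeasurableSpace Ω]
    (P : Measure Ω) (X : Set (Fin d → ℝ)) (k : (Fin d → ℝ) → (Fin d → ℝ) → ℝ) (v : ℝ≥0)
    (f : (Fin d → ℝ) → Ω → ℝ) (ε : ℕ → Ω → ℝ) : Prop where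
  gp : IsCenteredGP P X k f
  noise_measurable : ∀ t, Measurable (ε t)
  noise_law : ∀ t, P.map (ε t) = gaussianReal 0 v
  noise_indep : iIndepFun ε P
  f_indep_noise : Indep (sigmaF X f) (sigmaNoise ε) P
  internal_le : 𝒢 ≤ mΩ
  internal_indep : Indep 𝒢 (sigmaF X f ⊔ sigmaNoise ε) P

/-- The information available before query number `t` (counting from `0`): the internal
randomness and the data `(x i, y i)`, `i < t`. -/
@[reducible] def history {d : ℕ} {Ω : Type*} (𝒢 : MeasurableSpace Ω) (x : ℕ → Ω → Fin d → ℝ)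
    (y : ℕ → Ω → ℝ) (t : ℕ) : MeasurableSpace Ω :=
  𝒢 ⊔ ⨆ i : Fin t, (MeasurableSpace.comap (x i) inferInstance ⊔
    MeasurableSpace.comap (y i) inferInstance)

/-- Posterior mean at `z` given the first `t` observations of a run. -/
def runMean {d : ℕ} {Ω : Type*} (k : (Fin d → ℝ) → (Fin d → ℝ) → ℝ) (v : ℝ)
    (x : ℕ → Ω → Fin d → ℝ) (y : ℕ → Ω → ℝ) (t : ℕ) (ω : Ω) (z : Fin d → ℝ) : ℝ :=
  posteriorMean k v (fun i : Fin t => x i ω) (fun i : Fin t => y i ω) z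

/-- Posterior standard deviation at `z` given the first `t` observations of a run. -/
def runStd {d : ℕ} {Ω : Type*} (k : (Fin d → ℝ) → (Fin d → ℝ) → ℝ) (v : ℝ)
    (x : ℕ → Ω → Fin d → ℝ) (t : ℕ) (ω : Ω) (z : Fin d → ℝ) : ℝ :=
  posteriorStd k v (fun i : Fin t => x i ω) z

/-- `(x, y)` is a run of expected improvement with the posterior standard deviation rescaled by
`β_t^{1/2}` and the maximum of the posterior mean as reference value. Queries are counted from
`0` here and `β` from `1`: `x t` is the query in iteration `t + 1`. -/
structure IsEIRun {d : ℕ} {Ω : Type*} (𝒢 : MeasurableSpace Ω) [mΩ : MeasurableSpace Ω]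
    (X : Set (Fin d → ℝ)) (k : (Fin d → ℝ) → (Fin d → ℝ) → ℝ) (v : ℝ≥0) (β : ℕ → ℝ)
    (f : (Fin d → ℝ) → Ω → ℝ) (ε : ℕ → Ω → ℝ)
    (x : ℕ → Ω → Fin d → ℝ) (y : ℕ → Ω → ℝ) : Prop where
  mem : ∀ t ω, x t ω ∈ X
  nonanticipating : ∀ t, Measurable[history 𝒢 x y t] (x t)
  obs : ∀ t ω, y t ω = f (x t ω) ω + ε t ω
  obs_measurable : ∀ t, Measurable[mΩ] (y t)
  argmax : ∀ t ω, IsMaxOn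
    (fun z => expectedImprovement (runMean k v x y t ω z)
      (Real.sqrt (β (t + 1)) * runStd k v x t ω z) (⨆ z' : X, runMean k v x y t ω z'))
    X (x t ω)

/-! ### Maximum information gain -/

/-- Shannon mutual information `I(U ; V)` of two random variables. -/
def mutualInfo {Ω S S' : Type*} [MeasurableSpace Ω] [MeasurableSpace S] [MeasurableSpace S']
    (P : Measure Ω) (U : Ω → S) (V : Ω → S') : ℝ≥0∞ :=
  InformationTheory.klDiv (P.map (fun ω => (U ω, V ω))) ((P.map U).prod (P.map V))

/-- Maximum information gain `γ_T`: the largest mutual information between `T` noisy observations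
and the values of `f` at `T` (not necessarily distinct) points of `X`. -/
def maxInfoGain {d : ℕ} {Ω : Type*} [MeasurableSpace Ω] (P : Measure Ω) (X : Set (Fin d → ℝ))
    (f : (Fin d → ℝ) → Ω → ℝ) (ε : ℕ → Ω → ℝ) (T : ℕ) : ℝ≥0∞ :=
  ⨆ a : Fin T → X, mutualInfo P (fun ω (i : Fin T) => f (a i) ω + ε i ω)
    (fun ω (i : Fin T) => f (a i) ω)

/-! ### The two settings -/

/-- `β_t(δ) = 2 log(|X| t² π² / (6 δ))`. -/
def betaFinite {d : ℕ} (X : Set (Fin d → ℝ)) (δ : ℝ) (t : ℕ) : ℝ :=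
  2 * Real.log ((X.ncard : ℝ) * (t : ℝ) ^ 2 * Real.pi ^ 2 / (6 * δ))

/-- `β_t(δ) = 2 log(π² t² / (3 δ)) + 2 d log(⌈b d r t² √(log(4 a d / δ))⌉ + 1)`. -/
def betaContinuous (d : ℕ) (a b r δ : ℝ) (t : ℕ) : ℝ :=
  2 * Real.log (Real.pi ^ 2 * (t : ℝ) ^ 2 / (3 * δ)) +
    2 * (d : ℝ) * Real.log
      ((⌈b * d * r * (t : ℝ) ^ 2 * Real.sqrt (Real.log (4 * a * d / δ))⌉ : ℝ) + 1)

/-- The condition on a continuous domain: `X ⊆ [0, r]^d` is compact and convex, almost every sample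
path is differentiable on `X`, with a gradient `G ω x = (∂f/∂x_j)_j` at `x`, and
`L_j = sup_{x ∈ X} |∂f/∂x_j|` satisfies `P(L_j > c) ≤ a exp(-(c/b)²)`. The derivative is taken
within `X`, so that nothing outside of `X` matters; it is unique if `X` has interior points. -/
structure IsSmoothSetting {d : ℕ} {Ω : Type*} [MeasurableSpace Ω] (P : Measure Ω)
    (X : Set (Fin d → ℝ)) (f : (Fin d → ℝ) → Ω → ℝ) (r a b : ℝ) : Prop where
  r_pos : 0 < r
  one_le_a : 1 ≤ a
  b_pos : 0 < b
  compact : IsCompact X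
  convex : Convex ℝ X
  subset_cube : ∀ x ∈ X, ∀ j, 0 ≤ x j ∧ x j ≤ r
  gradient : ∃ G : Ω → (Fin d → ℝ) → Fin d → ℝ,
    (∀ᵐ ω ∂P, ∀ x ∈ X, HasFDerivWithinAt (fun z => f z ω)
      (∑ j, G ω x j • (ContinuousLinearMap.proj j : (Fin d → ℝ) →L[ℝ] ℝ)) X x) ∧
    ∀ j, ∀ c : ℝ, 0 < c →
      P {ω | ENNReal.ofReal c < ⨆ x ∈ X, ‖G ω x j‖ₑ} ≤
        ENNReal.ofReal (a * Real.exp (-(c / b) ^ 2))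

/-- With probability at least `1 - δ`: a maximizer `x*` of `f` on `X` exists and, for all `T ≥ 2`,
the cumulative regret `R_T = ∑_{t ≤ T} (f(x*) - f(x_t))` is at most `C √(β_T γ_T T log T)`. -/
def RegretBound {d : ℕ} {Ω : Type*} [MeasurableSpace Ω] (P : Measure Ω)
    (X : Set (Fin d → ℝ)) (f : (Fin d → ℝ) → Ω → ℝ) (ε : ℕ → Ω → ℝ)
    (x : ℕ → Ω → Fin d → ℝ) (β : ℕ → ℝ) (δ C : ℝ) : Prop :=
  ∃ E : Set Ω, MeasurableSet E ∧ ENNReal.ofReal (1 - δ) ≤ P E ∧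
    ∀ ω ∈ E, ∃ xstar ∈ X, IsMaxOn (fun z => f z ω) X xstar ∧
      ∀ T : ℕ, 2 ≤ T →
        ∑ t ∈ Finset.range T, (f xstar ω - f (x t ω) ω) ≤
          C * Real.sqrt (β T * (maxInfoGain P X f ε T).toReal * T * Real.log T)

end GPEI

end

/-!
The regret of expected improvement is controlled by confidence bounds, by one inequality for a
single step, and by the information gain.

*Confidence bounds.* For a fixed design, the residual `R = f z - μ(z)` is a Gaussian variable with
the posterior variance which is independent of the data (`IsBayesModel.map_residual`,
`IsBayesModel.indepFun_fixedObs`). Hence, weighted by the likelihood of the data, `f z - μ(z)` is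
Gaussian for every value of the data: for almost every value by disintegration, and for the other
ones by continuity (`IsBayesModel.lintegral_likelihood_eq`). Queries that depend on the past
leave the likelihood unchanged, as translations preserve Lebesgue measure
(`map_recursion_eq_withDensity`); conditionally on the internal randomness and on the data, they
are as good as a fixed design. The bound `|f - μ| ≤ c σ` thus fails with probability at most
`exp(-c²/2)` at any point that is determined by the history
(`IsBayesModel.measure_deviation_le`), without recourse to conditional distributions.

*One step.* Let `μ⁺ = sup μ`, let `S = √β σ` be the rescaled standard deviation, `p` the query and
`q` a point with `f q ≤ μ q + S q`. As `τ(c)` is the expectation of `max(c - Z, 0)`, the gap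
`f q - μ⁺` is at most a multiple of the expected improvement at `q`, hence of that at `p`, which is
`O(S p)`. Conversely, the expected improvement at `p` is at least that of the near-maximizers of
`μ`, which is of the order of a lower bound of `S`, and it decays like a Gaussian in
`(μ⁺ - μ p) / S p`; since `σ ≥ κ v / (v + t)` after `t` observations
(`IsBayesModel.le_posteriorStd`), this gives `μ⁺ - μ p = O(S p √(log t))`. See
`sub_le_of_isMaxOn_expectedImprovement`.

*Information gain.* The innovations of a fixed design are independent Gaussian variables, which
gives the mutual information as a sum of terms `log (1 + σ² / v) / 2`
(`IsBayesModel.mutualInfo_eq`). Along every path of queries, `∑ σ²` is therefore at most a multiple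
of the maximum information gain, and the Cauchy–Schwarz inequality gives the cumulative regret
(`IsBayesModel.sum_regret_le`).

On a finite domain the confidence bounds are required everywhere. On a continuous one they are
required at the queries and on nets of increasing fineness; the Lipschitz bound of the sample path
makes the discretization error at most `1 / t²`, which `√β σ` dominates.
-/

set_option linter.unusedSectionVars false

namespace GPEI

/-! ### Gaussian processes and linear combinations -/

section Span

variable {Ω S T : Type*} [MeasurableSpace Ω] {P : Measure Ω}

/-- A family of finite linear combinations of a Gaussian process is a Gaussian process. -/
lemma isGaussianProcess_of_mem_span {Z : T → Ω → ℝ} (hZ : IsGaussianProcess Z P)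
    {W : S → Ω → ℝ} (hW : ∀ s, W s ∈ Submodule.span ℝ (Set.range Z)) :
    IsGaussianProcess W P := by
  refine hZ.of_isGaussianProcess fun s => ?_
  obtain ⟨c, hc⟩ := Finsupp.mem_span_range_iff_exists_finsupp.1 (hW s)
  refine ⟨c.support, ∑ i : c.support, c i • ContinuousLinearMap.proj i, fun ω => ?_⟩
  rw [← hc]
  simp only [Finsupp.sum, Finset.sum_apply, Pi.smul_apply, smul_eq_mul,
    _root_.sum_apply, _root_.smul_apply,
    ContinuousLinearMap.proj_apply, Finset.restrict]
  exact (Finset.sum_coe_sort c.support fun i => c i * Z i ω).symm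

lemma memLp_two_of_mem_span {Z : T → Ω → ℝ} (hZ : ∀ t, MemLp (Z t) 2 P) {W : Ω → ℝ}
    (hW : W ∈ Submodule.span ℝ (Set.range Z)) : MemLp W 2 P := by
  induction hW using Submodule.span_induction with
  | mem x hx => obtain ⟨t, rfl⟩ := hx; exact hZ t
  | zero => exact MemLp.zero
  | add x y _ _ hx hy => exact hx.add hy
  | smul a x _ hx => exact hx.const_smul a

lemma measurable_of_mem_span {Z : T → Ω → ℝ} (hZ : ∀ t, Measurable (Z t)) {W : Ω → ℝ}
    (hW : W ∈ Submodule.span ℝ (Set.range Z)) : Measurable W := by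
  induction hW using Submodule.span_induction with
  | mem x hx => obtain ⟨t, rfl⟩ := hx; exact hZ t
  | zero => exact measurable_zero
  | add x y _ _ hx hy => exact hx.add hy
  | smul a x _ hx => exact hx.const_smul a

lemma integral_eq_zero_of_mem_span [IsFiniteMeasure P] {Z : T → Ω → ℝ}
    (hZ : ∀ t, MemLp (Z t) 2 P)
    (h0 : ∀ t, ∫ ω, Z t ω ∂P = 0) {W : Ω → ℝ} (hW : W ∈ Submodule.span ℝ (Set.range Z)) :
    ∫ ω, W ω ∂P = 0 := by
  induction hW using Submodule.span_induction with
  | mem x hx => obtain ⟨t, rfl⟩ := hx; exact h0 t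
  | zero => simp
  | add x y hx' hy' hx hy =>
    have h1 := (memLp_two_of_mem_span hZ hx').integrable one_le_two
    have h2 := (memLp_two_of_mem_span hZ hy').integrable one_le_two
    simp only [Pi.add_apply]
    rw [integral_add h1 h2, hx, hy, add_zero]
  | smul a x _ hx =>
    simp only [Pi.smul_apply, smul_eq_mul]
    rw [integral_const_mul, hx, mul_zero]

/-- Independent Gaussian processes are jointly Gaussian. -/
lemma isGaussianProcess_sumElim [IsProbabilityMeasure P] {U : S → Ω → ℝ} {V : T → Ω → ℝ}
    (hU : IsGaussianProcess U P) (hV : IsGaussianProcess V P)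
    (hUV : IndepFun (fun ω s => U s ω) (fun ω t => V t ω) P) :
    IsGaussianProcess (Sum.elim U V) P where
  hasGaussianLaw I := by
    classical
    have hpair : HasGaussianLaw (fun ω => ((fun s : I.toLeft => U s ω),
        (fun t : I.toRight => V t ω))) P := by
      refine IndepFun.hasGaussianLaw (hU.hasGaussianLaw I.toLeft) (hV.hasGaussianLaw I.toRight) ?_
      exact hUV.comp (φ := fun u (s : I.toLeft) => u s) (ψ := fun u (s : I.toRight) => u s)
        (by fun_prop) (by fun_prop)
    let L : ((I.toLeft → ℝ) × (I.toRight → ℝ)) →L[ℝ] (I → ℝ) :=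
      ContinuousLinearMap.pi fun i => match i with
        | ⟨.inl s, hs⟩ => (ContinuousLinearMap.proj ⟨s, Finset.mem_toLeft.2 hs⟩).comp
            (ContinuousLinearMap.fst ℝ _ _)
        | ⟨.inr t, ht⟩ => (ContinuousLinearMap.proj ⟨t, Finset.mem_toRight.2 ht⟩).comp
            (ContinuousLinearMap.snd ℝ _ _)
    have := hpair.map L
    have hL : (fun ω => I.restrict (Sum.elim U V · ω)) = L ∘ fun ω =>
        ((fun s : I.toLeft => U s ω), (fun t : I.toRight => V t ω)) := by
      funext ω i
      rcases i with ⟨i | i, hi⟩ <;> rfl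
    rw [hL]
    exact this

/-- The Cauchy–Schwarz inequality for the covariance. -/
lemma abs_covariance_le_sqrt_mul_sqrt [IsFiniteMeasure P] {U V : Ω → ℝ}
    (hU : MemLp U 2 P) (hV : MemLp V 2 P) :
    |covariance U V P| ≤ √(variance U P) * √(variance V P) := by
  -- The variance of `a U + b V` is nonnegative for all `a`, `b`.
  have key : ∀ x : ℝ, 0 ≤ variance V P * (x * x) + 2 * covariance U V P * x + variance U P := by
    intro x
    have h := variance_nonneg (U + x • V) P
    rw [variance_add hU (hV.const_smul x), variance_smul, covariance_smul_right] at h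
    linarith
  have hd := discrim_le_zero key
  rw [discrim] at hd
  rw [← Real.sqrt_mul (variance_nonneg _ _), ← Real.sqrt_sq_eq_abs]
  exact Real.sqrt_le_sqrt (by nlinarith)

end Span

/-! ### Regression with a fixed design -/

section FixedDesign

variable {d n : ℕ} {Ω : Type*} {𝒢 : MeasurableSpace Ω} [mΩ : MeasurableSpace Ω]
  {P : Measure Ω} [IsProbabilityMeasure P] {X : Set (Fin d → ℝ)}
  {k : (Fin d → ℝ) → (Fin d → ℝ) → ℝ} {v : ℝ≥0} {f : (Fin d → ℝ) → Ω → ℝ} {ε : ℕ → Ω → ℝ}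

/-- The values of `f` on `X` together with the noise variables, as one process. -/
def signalNoise (X : Set (Fin d → ℝ)) (f : (Fin d → ℝ) → Ω → ℝ) (ε : ℕ → Ω → ℝ) :
    X ⊕ ℕ → Ω → ℝ :=
  Sum.elim (fun x : X => f x) ε

lemma comap_pi_eq_iSup {T : Type*} (Z : T → Ω → ℝ) :
    MeasurableSpace.comap (fun ω t => Z t ω) inferInstance =
      ⨆ t, MeasurableSpace.comap (Z t) inferInstance := by
  rw [show (inferInstance : MeasurableSpace (T → ℝ)) = MeasurableSpace.pi from rfl,
    MeasurableSpace.pi, MeasurableSpace.comap_iSup]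
  simp only [MeasurableSpace.comap_comp]
  rfl

lemma IsBayesModel.indepFun (h : IsBayesModel 𝒢 P X k v f ε) :
    IndepFun (fun ω (x : X) => f x ω) (fun ω t => ε t ω) P := by
  rw [IndepFun_iff_Indep]
  have := h.f_indep_noise
  rw [sigmaF, sigmaNoise, ← comap_pi_eq_iSup, ← comap_pi_eq_iSup] at this
  exact this

lemma IsBayesModel.noise_gaussian (h : IsBayesModel 𝒢 P X k v f ε) (t : ℕ) :
    HasGaussianLaw (ε t) P where
  isGaussian_map := by rw [h.noise_law t]; infer_instance

lemma IsBayesModel.signalNoise_gaussian (h : IsBayesModel 𝒢 P X k v f ε) :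
    IsGaussianProcess (signalNoise X f ε) P := by
  refine isGaussianProcess_sumElim h.gp.gaussian ⟨fun I => ?_⟩ h.indepFun
  exact (iIndepFun.precomp (g := ((↑) : I → ℕ)) Subtype.val_injective h.noise_indep).hasGaussianLaw
    fun i => h.noise_gaussian i

lemma IsBayesModel.measurable_signalNoise (h : IsBayesModel 𝒢 P X k v f ε) (s : X ⊕ ℕ) :
    Measurable (signalNoise X f ε s) := by
  rcases s with x | t
  · exact h.gp.measurable x x.2
  · exact h.noise_measurable t

lemma IsBayesModel.memLp_signalNoise (h : IsBayesModel 𝒢 P X k v f ε) (s : X ⊕ ℕ) :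
    MemLp (signalNoise X f ε s) 2 P :=
  (h.signalNoise_gaussian.hasGaussianLaw_eval s).memLp_two

lemma IsBayesModel.integral_noise (h : IsBayesModel 𝒢 P X k v f ε) (t : ℕ) :
    ∫ ω, ε t ω ∂P = 0 := by
  have := integral_map (μ := P) (h.noise_measurable t).aemeasurable
    (f := fun x : ℝ => x) (by fun_prop)
  rw [← this, h.noise_law t, integral_id_gaussianReal]

lemma IsBayesModel.integral_signalNoise (h : IsBayesModel 𝒢 P X k v f ε) (s : X ⊕ ℕ) :
    ∫ ω, signalNoise X f ε s ω ∂P = 0 := by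
  rcases s with x | t
  · exact h.gp.mean_zero x x.2
  · exact h.integral_noise t

lemma IsBayesModel.variance_noise (h : IsBayesModel 𝒢 P X k v f ε) (t : ℕ) :
    variance (ε t) P = v := by
  have := variance_map (μ := P) (X := fun x : ℝ => x) (Y := ε t) (by fun_prop)
    (h.noise_measurable t).aemeasurable
  rw [h.noise_law t] at this
  rw [← variance_fun_id_gaussianReal (μ := 0) (v := v), this]
  rfl

lemma IsBayesModel.covariance_noise (h : IsBayesModel 𝒢 P X k v f ε) (s t : ℕ) :
    covariance (ε s) (ε t) P = if s = t then (v : ℝ) else 0 := by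
  split_ifs with hst
  · subst hst
    rw [covariance_self (h.noise_measurable s).aemeasurable, h.variance_noise]
  · exact (h.noise_indep.indepFun hst).covariance_eq_zero (h.memLp_signalNoise (.inr s))
      (h.memLp_signalNoise (.inr t))

lemma IsBayesModel.covariance_signal_noise (h : IsBayesModel 𝒢 P X k v f ε)
    {z : Fin d → ℝ} (hz : z ∈ X) (t : ℕ) : covariance (f z) (ε t) P = 0 := by
  refine IndepFun.covariance_eq_zero ?_ (h.memLp_signalNoise (.inl ⟨z, hz⟩))
    (h.memLp_signalNoise (.inr t))
  exact h.indepFun.comp (measurable_pi_apply (⟨z, hz⟩ : X)) (measurable_pi_apply t)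

/-- The observation number `i` under a design `ξ` that does not depend on the data. -/
def fixedObs (f : (Fin d → ℝ) → Ω → ℝ) (ε : ℕ → Ω → ℝ) (ξ : Fin n → Fin d → ℝ) (i : Fin n) :
    Ω → ℝ :=
  f (ξ i) + ε i

/-- The weights `k_z (K + v I)⁻¹` of the posterior mean at `z`. -/
noncomputable def postWeights (k : (Fin d → ℝ) → (Fin d → ℝ) → ℝ) (v : ℝ) (ξ : Fin n → Fin d → ℝ)
    (z : Fin d → ℝ) : Fin n → ℝ :=
  kernelVec k ξ z ᵥ* (regGram k v ξ)⁻¹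

lemma posteriorMean_eq_sum (k : (Fin d → ℝ) → (Fin d → ℝ) → ℝ) (v : ℝ) (ξ : Fin n → Fin d → ℝ)
    (y : Fin n → ℝ) (z : Fin d → ℝ) :
    posteriorMean k v ξ y z = ∑ i, postWeights k v ξ z i * y i := by
  rw [posteriorMean, Matrix.dotProduct_mulVec]
  rfl

lemma posteriorVar_eq_sum (k : (Fin d → ℝ) → (Fin d → ℝ) → ℝ) (v : ℝ) (ξ : Fin n → Fin d → ℝ)
    (z : Fin d → ℝ) :
    posteriorVar k v ξ z = k z z - ∑ i, postWeights k v ξ z i * k z (ξ i) := by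
  rw [posteriorVar, Matrix.dotProduct_mulVec]
  rfl

/-- The error `f z - μ(z)` of the posterior mean at `z` under a fixed design. -/
noncomputable def residual (k : (Fin d → ℝ) → (Fin d → ℝ) → ℝ) (v : ℝ) (f : (Fin d → ℝ) → Ω → ℝ)
    (ε : ℕ → Ω → ℝ) (ξ : Fin n → Fin d → ℝ) (z : Fin d → ℝ) : Ω → ℝ :=
  f z - ∑ i, postWeights k v ξ z i • fixedObs f ε ξ i

lemma residual_apply (k : (Fin d → ℝ) → (Fin d → ℝ) → ℝ) (v : ℝ) (f : (Fin d → ℝ) → Ω → ℝ)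
    (ε : ℕ → Ω → ℝ) (ξ : Fin n → Fin d → ℝ) (z : Fin d → ℝ) (ω : Ω) :
    residual k v f ε ξ z ω =
      f z ω - posteriorMean k v ξ (fun i => f (ξ i) ω + ε i ω) z := by
  simp [residual, posteriorMean_eq_sum, fixedObs, mul_add]

lemma signal_mem_span (f : (Fin d → ℝ) → Ω → ℝ) (ε : ℕ → Ω → ℝ) {z : Fin d → ℝ} (hz : z ∈ X) :
    f z ∈ Submodule.span ℝ (Set.range (signalNoise X f ε)) :=
  Submodule.subset_span ⟨.inl ⟨z, hz⟩, rfl⟩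

lemma noise_mem_span (X : Set (Fin d → ℝ)) (f : (Fin d → ℝ) → Ω → ℝ) (ε : ℕ → Ω → ℝ) (t : ℕ) :
    ε t ∈ Submodule.span ℝ (Set.range (signalNoise X f ε)) :=
  Submodule.subset_span ⟨.inr t, rfl⟩

lemma fixedObs_mem_span (f : (Fin d → ℝ) → Ω → ℝ) (ε : ℕ → Ω → ℝ) {ξ : Fin n → Fin d → ℝ}
    (hξ : ∀ i, ξ i ∈ X) (i : Fin n) :
    fixedObs f ε ξ i ∈ Submodule.span ℝ (Set.range (signalNoise X f ε)) :=
  add_mem (signal_mem_span f ε (hξ i)) (noise_mem_span X f ε i)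

lemma residual_mem_span (k : (Fin d → ℝ) → (Fin d → ℝ) → ℝ) (v : ℝ) (f : (Fin d → ℝ) → Ω → ℝ)
    (ε : ℕ → Ω → ℝ) {ξ : Fin n → Fin d → ℝ} (hξ : ∀ i, ξ i ∈ X) {z : Fin d → ℝ} (hz : z ∈ X) :
    residual k v f ε ξ z ∈ Submodule.span ℝ (Set.range (signalNoise X f ε)) :=
  sub_mem (signal_mem_span f ε hz)
    (sum_mem fun i _ => Submodule.smul_mem _ _ (fixedObs_mem_span f ε hξ i))

lemma IsBayesModel.memLp_of_mem_span (h : IsBayesModel 𝒢 P X k v f ε) {W : Ω → ℝ}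
    (hW : W ∈ Submodule.span ℝ (Set.range (signalNoise X f ε))) : MemLp W 2 P :=
  memLp_two_of_mem_span h.memLp_signalNoise hW

lemma IsBayesModel.covariance_fixedObs (h : IsBayesModel 𝒢 P X k v f ε) {ξ : Fin n → Fin d → ℝ}
    (hξ : ∀ i, ξ i ∈ X) (i j : Fin n) :
    covariance (fixedObs f ε ξ i) (fixedObs f ε ξ j) P = regGram k v ξ i j := by
  have h1 := fun i => h.memLp_of_mem_span (signal_mem_span f ε (hξ i))
  have h2 := fun t => h.memLp_of_mem_span (noise_mem_span X f ε t)
  rw [fixedObs, fixedObs, covariance_add_left (h1 i) (h2 i) ((h1 j).add (h2 j)),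
    covariance_add_right (h1 i) (h1 j) (h2 j), covariance_add_right (h2 i) (h1 j) (h2 j),
    h.gp.cov_eq _ (hξ i) _ (hξ j), h.covariance_signal_noise (hξ i), covariance_comm (ε i),
    h.covariance_signal_noise (hξ j), h.covariance_noise]
  simp only [regGram, Matrix.add_apply, Matrix.of_apply, Matrix.smul_apply, Matrix.one_apply,
    smul_eq_mul, Fin.val_inj]
  split_ifs <;> simp

lemma IsBayesModel.covariance_signal_fixedObs (h : IsBayesModel 𝒢 P X k v f ε)
    {ξ : Fin n → Fin d → ℝ} (hξ : ∀ i, ξ i ∈ X) {z : Fin d → ℝ} (hz : z ∈ X) (i : Fin n) :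
    covariance (f z) (fixedObs f ε ξ i) P = kernelVec k ξ z i := by
  have h1 := fun z hz => h.memLp_of_mem_span (signal_mem_span (z := z) f ε hz)
  have h2 := fun t => h.memLp_of_mem_span (noise_mem_span X f ε t)
  rw [fixedObs, covariance_add_right (h1 z hz) (h1 _ (hξ i)) (h2 i),
    h.gp.cov_eq _ hz _ (hξ i), h.covariance_signal_noise hz, add_zero, kernelVec]

/-- The matrix `K + v I` is positive definite, so that its inverse is a genuine one. -/
lemma IsBayesModel.isUnit_det_regGram (h : IsBayesModel 𝒢 P X k v f ε) (hv : 0 < v)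
    {ξ : Fin n → Fin d → ℝ} (hξ : ∀ i, ξ i ∈ X) : IsUnit (regGram k v ξ).det := by
  have hK : (Matrix.of fun i j => k (ξ i) (ξ j)).PosSemidef := by
    refine Matrix.PosSemidef.of_dotProduct_mulVec_nonneg ?_ fun u => ?_
    · ext i j
      simp only [Matrix.conjTranspose_apply, Matrix.of_apply, star_trivial]
      rw [← h.gp.cov_eq _ (hξ i) _ (hξ j), ← h.gp.cov_eq _ (hξ j) _ (hξ i), covariance_comm]
    · have hm := fun i => (h.memLp_of_mem_span (signal_mem_span f ε (hξ i)))
      have := variance_nonneg (∑ i, u i • f (ξ i)) P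
      rw [← covariance_self (memLp_finsetSum' _ fun i _ => (hm i).const_smul (u i)).aemeasurable,
        covariance_sum_left (fun i => (hm i).const_smul (u i))
          (memLp_finsetSum' _ fun i _ => (hm i).const_smul (u i))] at this
      refine this.trans_eq ?_
      simp only [dotProduct, Matrix.mulVec, star_trivial, Matrix.of_apply]
      refine Finset.sum_congr rfl fun i _ => ?_
      rw [covariance_sum_right (fun i => (hm i).const_smul (u i)) ((hm i).const_smul (u i)),
        Finset.mul_sum]
      refine Finset.sum_congr rfl fun j _ => ?_
      rw [covariance_smul_left, covariance_smul_right, h.gp.cov_eq _ (hξ i) _ (hξ j)]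
      ring
  have hpd : (regGram k v ξ).PosDef := by
    refine Matrix.PosDef.posSemidef_add hK ?_
    exact Matrix.PosDef.one.smul (by exact_mod_cast hv)
  exact (Matrix.isUnit_iff_isUnit_det _).1 hpd.isUnit

/-- The residual is uncorrelated with the observations: `w (K + v I) = k_z` for the weights `w`. -/
lemma IsBayesModel.covariance_residual_fixedObs (h : IsBayesModel 𝒢 P X k v f ε) (hv : 0 < v)
    {ξ : Fin n → Fin d → ℝ} (hξ : ∀ i, ξ i ∈ X) {z : Fin d → ℝ} (hz : z ∈ X) (j : Fin n) :
    covariance (residual k v f ε ξ z) (fixedObs f ε ξ j) P = 0 := by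
  have hY := fun i => h.memLp_of_mem_span (fixedObs_mem_span f ε hξ i)
  have hw : postWeights k v ξ z ᵥ* regGram k v ξ = kernelVec k ξ z := by
    rw [postWeights, Matrix.vecMul_vecMul, Matrix.nonsing_inv_mul _ (h.isUnit_det_regGram hv hξ),
      Matrix.vecMul_one]
  rw [residual, covariance_sub_left (h.memLp_of_mem_span (signal_mem_span f ε hz))
    (memLp_finsetSum' _ fun i _ => (hY i).const_smul _) (hY j),
    h.covariance_signal_fixedObs hξ hz,
    covariance_sum_left (fun i => (hY i).const_smul _) (hY j), ← hw]
  simp only [covariance_smul_left, h.covariance_fixedObs hξ, Matrix.vecMul, dotProduct, sub_self]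

lemma IsBayesModel.covariance_residual_signal (h : IsBayesModel 𝒢 P X k v f ε)
    {ξ : Fin n → Fin d → ℝ} (hξ : ∀ i, ξ i ∈ X) {z : Fin d → ℝ} (hz : z ∈ X) :
    covariance (residual k v f ε ξ z) (f z) P = posteriorVar k v ξ z := by
  have hY := fun i => h.memLp_of_mem_span (fixedObs_mem_span f ε hξ i)
  have hf := h.memLp_of_mem_span (signal_mem_span f ε hz)
  rw [residual, covariance_sub_left hf (memLp_finsetSum' _ fun i _ => (hY i).const_smul _) hf,
    covariance_sum_left (fun i => (hY i).const_smul _) hf, h.gp.cov_eq _ hz _ hz,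
    posteriorVar_eq_sum]
  congr 1
  refine Finset.sum_congr rfl fun i _ => ?_
  rw [covariance_smul_left, covariance_comm, h.covariance_signal_fixedObs hξ hz, kernelVec]

/-- The posterior variance is the variance of the residual. -/
lemma IsBayesModel.variance_residual (h : IsBayesModel 𝒢 P X k v f ε) (hv : 0 < v)
    {ξ : Fin n → Fin d → ℝ} (hξ : ∀ i, ξ i ∈ X) {z : Fin d → ℝ} (hz : z ∈ X) :
    variance (residual k v f ε ξ z) P = posteriorVar k v ξ z := by
  have hY := fun i => h.memLp_of_mem_span (fixedObs_mem_span f ε hξ i)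
  have hf := h.memLp_of_mem_span (signal_mem_span f ε hz)
  have hR := h.memLp_of_mem_span (residual_mem_span k v f ε hξ hz)
  rw [← covariance_self hR.aemeasurable, ← h.covariance_residual_signal hξ hz]
  have hsplit : residual k v f ε ξ z =
    f z - ∑ i, postWeights k v ξ z i • fixedObs f ε ξ i := rfl
  calc covariance (residual k v f ε ξ z) (residual k v f ε ξ z) P
      = covariance (residual k v f ε ξ z)
          (f z - ∑ i, postWeights k v ξ z i • fixedObs f ε ξ i) P := by rw [← hsplit]
    _ = covariance (residual k v f ε ξ z) (f z) P := by
        rw [covariance_sub_right hR hf (memLp_finsetSum' _ fun i _ => (hY i).const_smul _),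
          covariance_sum_right (fun i => (hY i).const_smul _) hR, sub_eq_self]
        refine Finset.sum_eq_zero fun i _ => ?_
        rw [covariance_smul_right, h.covariance_residual_fixedObs hv hξ hz, mul_zero]

lemma IsBayesModel.posteriorVar_nonneg (h : IsBayesModel 𝒢 P X k v f ε) (hv : 0 < v)
    {ξ : Fin n → Fin d → ℝ} (hξ : ∀ i, ξ i ∈ X) {z : Fin d → ℝ} (hz : z ∈ X) :
    0 ≤ posteriorVar k v ξ z := by
  rw [← h.variance_residual hv hξ hz]
  exact variance_nonneg _ _

lemma IsBayesModel.posteriorStd_sq (h : IsBayesModel 𝒢 P X k v f ε) (hv : 0 < v)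
    {ξ : Fin n → Fin d → ℝ} (hξ : ∀ i, ξ i ∈ X) {z : Fin d → ℝ} (hz : z ∈ X) :
    posteriorStd k v ξ z ^ 2 = posteriorVar k v ξ z :=
  Real.sq_sqrt (h.posteriorVar_nonneg hv hξ hz)

lemma IsBayesModel.posteriorStd_le_one (h : IsBayesModel 𝒢 P X k v f ε) (hv : 0 < v)
    (hk : ∀ z ∈ X, k z z ≤ 1) {ξ : Fin n → Fin d → ℝ} (hξ : ∀ i, ξ i ∈ X) {z : Fin d → ℝ}
    (hz : z ∈ X) : posteriorStd k v ξ z ≤ 1 := by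
  -- By Cauchy–Schwarz, `σ² = Cov(R, f z) ≤ σ √(k z z) ≤ σ`.
  have hf := h.memLp_of_mem_span (signal_mem_span f ε hz)
  have hcs := (le_abs_self _).trans (abs_covariance_le_sqrt_mul_sqrt
    (h.memLp_of_mem_span (residual_mem_span k v f ε hξ hz)) hf)
  rw [h.covariance_residual_signal hξ hz, h.variance_residual hv hξ hz,
    ← h.posteriorStd_sq hv hξ hz, ← covariance_self hf.aemeasurable, h.gp.cov_eq _ hz _ hz,
    Real.sqrt_sq (show 0 ≤ posteriorStd k v ξ z from Real.sqrt_nonneg _)] at hcs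
  have h1 : √(k z z) ≤ 1 := Real.sqrt_le_one.2 (hk z hz)
  have h0 : 0 ≤ posteriorStd k v ξ z := Real.sqrt_nonneg _
  nlinarith

lemma IsBayesModel.abs_kernel_le_one (h : IsBayesModel 𝒢 P X k v f ε) (hk : ∀ z ∈ X, k z z ≤ 1)
    {a b : Fin d → ℝ} (ha : a ∈ X) (hb : b ∈ X) : |k a b| ≤ 1 := by
  have hma := h.memLp_of_mem_span (signal_mem_span f ε ha)
  have hmb := h.memLp_of_mem_span (signal_mem_span f ε hb)
  have h1 := abs_covariance_le_sqrt_mul_sqrt hma hmb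
  rw [h.gp.cov_eq a ha b hb] at h1
  refine h1.trans ?_
  rw [← covariance_self hma.aemeasurable, ← covariance_self hmb.aemeasurable,
    h.gp.cov_eq a ha a ha, h.gp.cov_eq b hb b hb]
  exact mul_le_one₀ (Real.sqrt_le_one.2 (hk a ha)) (Real.sqrt_nonneg _)
    (Real.sqrt_le_one.2 (hk b hb))

/-- After `n` observations, the posterior standard deviation is at least of order `1 / n`. Each weight
`w i` of the posterior mean is `Cov(R, f (ξ i)) / v`, hence at most `σ / v`, so that
`κ ≤ k z z = σ² + ∑ i, w i * k z (ξ i) ≤ σ + n σ / v`. -/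
lemma IsBayesModel.le_posteriorStd (h : IsBayesModel 𝒢 P X k v f ε) (hv : 0 < v) {κ : ℝ}
    (hk : ∀ z ∈ X, κ ≤ k z z ∧ k z z ≤ 1) {ξ : Fin n → Fin d → ℝ} (hξ : ∀ i, ξ i ∈ X)
    {z : Fin d → ℝ} (hz : z ∈ X) : κ * v / (v + n) ≤ posteriorStd k v ξ z := by
  have hv' : (0 : ℝ) < v := by exact_mod_cast hv
  have hsig := fun z hz => h.memLp_of_mem_span (signal_mem_span (z := z) f ε hz)
  have hnoi := fun t => h.memLp_of_mem_span (noise_mem_span X f ε t)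
  have hR := h.memLp_of_mem_span (residual_mem_span k v f ε hξ hz)
  have hY := fun i => h.memLp_of_mem_span (fixedObs_mem_span f ε hξ i)
  set s := posteriorStd k v ξ z with hs
  have hs0 : 0 ≤ s := Real.sqrt_nonneg _
  have hs1 : s ≤ 1 := h.posteriorStd_le_one hv (fun z hz => (hk z hz).2) hξ hz
  -- `Cov(R, ε i) = - v w i`, whereas `Cov(R, f (ξ i) + ε i) = 0`.
  have hcov : ∀ i, covariance (residual k v f ε ξ z) (f (ξ i)) P = v * postWeights k v ξ z i := by
    intro i
    have h0 := h.covariance_residual_fixedObs hv hξ hz i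
    have h1 : covariance (residual k v f ε ξ z) (ε i) P = - (v * postWeights k v ξ z i) := by
      rw [residual, covariance_sub_left (hsig z hz)
        (memLp_finsetSum' _ fun i _ => (hY i).const_smul _) (hnoi i),
        covariance_sum_left (fun i => (hY i).const_smul _) (hnoi i),
        h.covariance_signal_noise hz, zero_sub, neg_inj, Finset.sum_eq_single i]
      · rw [covariance_smul_left, fixedObs, covariance_add_left (hsig _ (hξ i)) (hnoi i) (hnoi i),
          h.covariance_signal_noise (hξ i), h.covariance_noise]
        simp [mul_comm]
      · intro j _ hj
        rw [covariance_smul_left, fixedObs, covariance_add_left (hsig _ (hξ j)) (hnoi j) (hnoi i),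
          h.covariance_signal_noise (hξ j), h.covariance_noise, if_neg (by simpa [Fin.val_inj])]
        simp
      · simp
    rw [fixedObs, covariance_add_right hR (hsig _ (hξ i)) (hnoi i), h1] at h0
    linarith
  have hw : ∀ i, |postWeights k v ξ z i| ≤ s / v := by
    intro i
    have hcs := abs_covariance_le_sqrt_mul_sqrt hR (hsig _ (hξ i))
    rw [hcov, h.variance_residual hv hξ hz, ← covariance_self (hsig _ (hξ i)).aemeasurable,
      h.gp.cov_eq _ (hξ i) _ (hξ i), abs_mul, abs_of_pos hv'] at hcs
    have h1 : √(k (ξ i) (ξ i)) ≤ 1 := Real.sqrt_le_one.2 (hk _ (hξ i)).2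
    rw [le_div_iff₀' hv']
    exact hcs.trans (mul_le_of_le_one_right hs0 h1)
  have hkz := fun i => h.abs_kernel_le_one (fun z hz => (hk z hz).2) hz (hξ i)
  have hsum : ∑ i, postWeights k v ξ z i * k z (ξ i) ≤ n * (s / v) := by
    calc ∑ i, postWeights k v ξ z i * k z (ξ i) ≤ ∑ _i : Fin n, s / v := by
          refine Finset.sum_le_sum fun i _ => (le_abs_self _).trans ?_
          rw [abs_mul]
          exact (mul_le_of_le_one_right (abs_nonneg _) (hkz i)).trans (hw i)
      _ = n * (s / v) := by simp
  have hvar := h.posteriorStd_sq hv hξ hz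
  rw [posteriorVar_eq_sum, ← hs] at hvar
  have hfin : κ ≤ s + n * (s / v) := by nlinarith [(hk z hz).1]
  rw [div_le_iff₀ (by positivity)]
  calc κ * v ≤ (s + n * (s / v)) * v := by gcongr
    _ = s * (v + n) := by field_simp

/-- The residual is a centred Gaussian variable whose variance is the posterior variance. -/
lemma IsBayesModel.map_residual (h : IsBayesModel 𝒢 P X k v f ε) (hv : 0 < v)
    {ξ : Fin n → Fin d → ℝ} (hξ : ∀ i, ξ i ∈ X) {z : Fin d → ℝ} (hz : z ∈ X) :
    P.map (residual k v f ε ξ z) = gaussianReal 0 (posteriorVar k v ξ z).toNNReal := by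
  have hg : IsGaussianProcess (fun _ : Unit => residual k v f ε ξ z) P :=
    isGaussianProcess_of_mem_span h.signalNoise_gaussian fun _ => residual_mem_span k v f ε hξ hz
  rw [(hg.hasGaussianLaw_eval ()).map_eq_gaussianReal, h.variance_residual hv hξ hz]
  congr 1
  exact integral_eq_zero_of_mem_span h.memLp_signalNoise h.integral_signalNoise
    (residual_mem_span k v f ε hξ hz)

/-- A linear combination of signal and noise that is uncorrelated with the observations is
independent of them. -/
lemma IsBayesModel.indepFun_fixedObs (h : IsBayesModel 𝒢 P X k v f ε)
    {ξ : Fin n → Fin d → ℝ} (hξ : ∀ i, ξ i ∈ X) {W : Ω → ℝ}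
    (hW : W ∈ Submodule.span ℝ (Set.range (signalNoise X f ε)))
    (h0 : ∀ i, covariance W (fixedObs f ε ξ i) P = 0) :
    IndepFun W (fun ω i => fixedObs f ε ξ i ω) P := by
  have hg : IsGaussianProcess (Sum.elim (fun _ : Unit => W) (fixedObs f ε ξ)) P := by
    refine isGaussianProcess_of_mem_span h.signalNoise_gaussian fun s => ?_
    rcases s with s | i
    · exact hW
    · exact fixedObs_mem_span f ε hξ i
  have := hg.indepFun_of_covariance_eq_zero
    (fun _ => (h.memLp_of_mem_span hW).aemeasurable)
    (fun i => (h.memLp_of_mem_span (fixedObs_mem_span f ε hξ i)).aemeasurable) fun _ i => h0 i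
  exact this.comp (measurable_pi_apply ()) measurable_id

end FixedDesign

/-! ### Densities of recursively generated data -/

section Density

variable {Ω 𝒲 : Type*} [MeasurableSpace Ω] [MeasurableSpace 𝒲] {P : Measure Ω}

lemma measurePreserving_snoc (n : ℕ) :
    MeasurePreserving (fun q : (Fin n → ℝ) × ℝ => (Fin.snoc q.1 q.2 : Fin (n + 1) → ℝ))
      (volume.prod volume) volume := by
  have h := (volume_preserving_piFinSuccAbove (fun _ : Fin (n + 1) => ℝ) (Fin.last n)).symm
  have h2 : MeasurePreserving (Prod.swap : (Fin n → ℝ) × ℝ → ℝ × (Fin n → ℝ))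
      (volume.prod volume) (volume.prod volume) := Measure.measurePreserving_swap
  have heq : (fun q : (Fin n → ℝ) × ℝ => (Fin.snoc q.1 q.2 : Fin (n + 1) → ℝ)) =
      (MeasurableEquiv.piFinSuccAbove (fun _ : Fin (n + 1) => ℝ) (Fin.last n)).symm ∘ Prod.swap := by
    funext q
    simp [MeasurableEquiv.piFinSuccAbove_symm_apply, Fin.insertNthEquiv, Fin.insertNth_last']
  rw [heq]
  exact h.comp h2

lemma measurable_snoc (n : ℕ) :
    Measurable (fun q : (Fin n → ℝ) × ℝ => (Fin.snoc q.1 q.2 : Fin (n + 1) → ℝ)) :=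
  (measurePreserving_snoc n).measurable

lemma measurable_init (n : ℕ) :
    Measurable (fun y : Fin (n + 1) → ℝ => (Fin.init y : Fin n → ℝ)) :=
  measurable_pi_lambda _ fun i => measurable_pi_apply i.castSucc

/-- Appending the observation `Z + s(U, W)` to the data `U` multiplies the density by that of `Z`
at `y - s(u, w)`: translations preserve Lebesgue measure. -/
lemma map_snoc_eq_withDensity [IsProbabilityMeasure P] {n : ℕ} {U : Ω → Fin n → ℝ} {W : Ω → 𝒲}
    {Z : Ω → ℝ} (hU : Measurable U) (hW : Measurable W) (hZ : Measurable Z)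
    {lam : Measure 𝒲} [SFinite lam] {p : (Fin n → ℝ) × 𝒲 → ℝ≥0∞} (hp : Measurable p)
    (hUW : P.map (fun ω => (U ω, W ω)) = (volume.prod lam).withDensity p)
    {q : ℝ → ℝ≥0∞} (hq : Measurable q) (hZq : P.map Z = volume.withDensity q)
    (hind : IndepFun (fun ω => (U ω, W ω)) Z P)
    {s : (Fin n → ℝ) × 𝒲 → ℝ} (hs : Measurable s) :
    P.map (fun ω => ((Fin.snoc (U ω) (Z ω + s (U ω, W ω)) : Fin (n + 1) → ℝ), W ω)) =
      (volume.prod lam).withDensity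
        (fun r => p (Fin.init r.1, r.2) * q (r.1 (Fin.last n) - s (Fin.init r.1, r.2))) := by
  have hinit := measurable_init n
  have hsnoc := measurable_snoc n
  have hlast : Measurable (fun y : Fin (n + 1) → ℝ => y (Fin.last n)) := measurable_pi_apply _
  have hdens : Measurable (fun r : (Fin (n + 1) → ℝ) × 𝒲 =>
      p (Fin.init r.1, r.2) * q (r.1 (Fin.last n) - s (Fin.init r.1, r.2))) := by fun_prop
  have hlaw : P.map (fun ω => ((U ω, W ω), Z ω)) =
      ((volume.prod lam).withDensity p).prod (volume.withDensity q) := by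
    rw [← hUW, ← hZq]
    exact (indepFun_iff_map_prod_eq_prod_map_map (hU.prodMk hW).aemeasurable
      hZ.aemeasurable).1 hind
  have : SFinite (volume.withDensity q) := by rw [← hZq]; infer_instance
  refine Measure.ext_of_lintegral _ fun Ψ hΨ => ?_
  have hT : Measurable (fun a : ((Fin n → ℝ) × 𝒲) × ℝ =>
      ((Fin.snoc a.1.1 (a.2 + s a.1) : Fin (n + 1) → ℝ), a.1.2)) := by fun_prop
  have hΨT : Measurable (fun a : ((Fin n → ℝ) × 𝒲) × ℝ =>
      Ψ ((Fin.snoc a.1.1 (a.2 + s a.1) : Fin (n + 1) → ℝ), a.1.2)) := hΨ.comp hT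
  calc ∫⁻ r, Ψ r ∂(P.map fun ω => ((Fin.snoc (U ω) (Z ω + s (U ω, W ω)) : Fin (n + 1) → ℝ), W ω))
      = ∫⁻ a, Ψ ((Fin.snoc a.1.1 (a.2 + s a.1) : Fin (n + 1) → ℝ), a.1.2)
          ∂(P.map (fun ω => ((U ω, W ω), Z ω))) := by
        rw [lintegral_map hΨT (by fun_prop), lintegral_map hΨ (by fun_prop)]
    _ = ∫⁻ b, p b * (∫⁻ z, q z * Ψ ((Fin.snoc b.1 (z + s b) : Fin (n + 1) → ℝ), b.2))
          ∂(volume.prod lam) := by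
        rw [hlaw, lintegral_prod _ hΨT.aemeasurable,
          lintegral_withDensity_eq_lintegral_mul _ hp hΨT.lintegral_prod_right']
        refine lintegral_congr fun b => ?_
        rw [Pi.mul_apply]
        congr 1
        have : Measurable fun z => Ψ ((Fin.snoc b.1 (z + s b) : Fin (n + 1) → ℝ), b.2) := by
          fun_prop
        rw [lintegral_withDensity_eq_lintegral_mul _ hq this]
        rfl
    _ = ∫⁻ b, p b * (∫⁻ z, q (z - s b) * Ψ ((Fin.snoc b.1 z : Fin (n + 1) → ℝ), b.2))
          ∂(volume.prod lam) := by
        refine lintegral_congr fun b => ?_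
        rw [← lintegral_add_right_eq_self
          (fun z => q (z - s b) * Ψ ((Fin.snoc b.1 z : Fin (n + 1) → ℝ), b.2)) (s b)]
        simp only [add_sub_cancel_right]
    _ = ∫⁻ b, (∫⁻ z, p b * (q (z - s b) * Ψ ((Fin.snoc b.1 z : Fin (n + 1) → ℝ), b.2)))
          ∂(volume.prod lam) := by
        refine lintegral_congr fun b => ?_
        rw [lintegral_const_mul _ (by fun_prop)]
    _ = ∫⁻ w, (∫⁻ u, ∫⁻ z, p (u, w) *
          (q (z - s (u, w)) * Ψ ((Fin.snoc u z : Fin (n + 1) → ℝ), w))) ∂lam := by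
        rw [lintegral_prod_symm']
        exact Measurable.lintegral_prod_right'
          (f := fun a : ((Fin n → ℝ) × 𝒲) × ℝ => p a.1 * (q (a.2 - s a.1) *
            Ψ ((Fin.snoc a.1.1 a.2 : Fin (n + 1) → ℝ), a.1.2))) (by fun_prop)
    _ = ∫⁻ w, (∫⁻ y : Fin (n + 1) → ℝ,
          p (Fin.init y, w) * q (y (Fin.last n) - s (Fin.init y, w)) * Ψ (y, w)) ∂lam := by
        refine lintegral_congr fun w => ?_
        rw [← (measurePreserving_snoc n).lintegral_comp (by fun_prop), lintegral_prod _ (by fun_prop)]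
        refine lintegral_congr fun u => lintegral_congr fun z => ?_
        simp only [Fin.init_snoc, Fin.snoc_last, mul_assoc]
    _ = _ := by
        rw [lintegral_withDensity_eq_lintegral_mul _ hdens hΨ, lintegral_prod_symm']
        · rfl
        · exact hdens.mul hΨ

lemma indepFun_prodMk_of_indepFun [IsProbabilityMeasure P] {α β γ : Type*} [MeasurableSpace α]
    [MeasurableSpace β] [MeasurableSpace γ] {A : Ω → α} {B : Ω → β} {D : Ω → γ}
    (hA : Measurable A) (hB : Measurable B) (hD : Measurable D)
    (h1 : IndepFun A (fun ω => (B ω, D ω)) P) (h2 : IndepFun B D P) :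
    IndepFun (fun ω => (A ω, B ω)) D P := by
  have := Measure.isProbabilityMeasure_map (μ := P) hA.aemeasurable
  have := Measure.isProbabilityMeasure_map (μ := P) hB.aemeasurable
  have := Measure.isProbabilityMeasure_map (μ := P) hD.aemeasurable
  have hAB : IndepFun A B P := h1.comp measurable_id measurable_fst
  rw [indepFun_iff_map_prod_eq_prod_map_map (by fun_prop) (by fun_prop)] at h1 h2 hAB ⊢
  rw [hAB, ← MeasurableEquiv.prodAssoc.map_measurableEquiv_injective.eq_iff,
    Measure.prodAssoc_prod, ← h2, ← h1, Measure.map_map (by fun_prop) (by fun_prop)]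
  rfl

/-- The data generated by the noise `e` and the parameter `w` through the recursion
`y t = e t + s t (y 0, …, y (t - 1); w)`. -/
noncomputable def recData (s : (t : ℕ) → (Fin t → ℝ) × 𝒲 → ℝ) : (t : ℕ) → (Fin t → ℝ) × 𝒲 → Fin t → ℝ
  | 0, _ => Fin.elim0
  | t + 1, a => Fin.snoc (recData s t (Fin.init a.1, a.2))
      (a.1 (Fin.last t) + s t (recData s t (Fin.init a.1, a.2), a.2))

lemma measurable_recData {s : (t : ℕ) → (Fin t → ℝ) × 𝒲 → ℝ} (hs : ∀ t, Measurable (s t)) (t : ℕ) :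
    Measurable (recData s t) := by
  induction t with
  | zero => exact measurable_const
  | succ t ih =>
    have h1 := measurable_snoc t
    have h2 := measurable_init t
    have h3 := hs t
    have h4 : Measurable (fun y : Fin (t + 1) → ℝ => y (Fin.last t)) := measurable_pi_apply _
    change Measurable fun a : (Fin (t + 1) → ℝ) × 𝒲 =>
      (Fin.snoc (recData s t (Fin.init a.1, a.2))
        (a.1 (Fin.last t) + s t (recData s t (Fin.init a.1, a.2), a.2)) : Fin (t + 1) → ℝ)
    fun_prop

/-- The joint density, at `(y, w)`, of the data generated by a recursion, where the noise variable
number `t` has density `q t`. -/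
noncomputable def recDensity (q : ℕ → ℝ → ℝ≥0∞) (s : (t : ℕ) → (Fin t → ℝ) × 𝒲 → ℝ) (t : ℕ)
    (a : (Fin t → ℝ) × 𝒲) : ℝ≥0∞ :=
  ∏ i : Fin t, q i (a.1 i - s i (fun j : Fin i => a.1 (j.castLE i.2.le), a.2))

lemma recDensity_succ (q : ℕ → ℝ → ℝ≥0∞) (s : (t : ℕ) → (Fin t → ℝ) × 𝒲 → ℝ) (t : ℕ)
    (a : (Fin (t + 1) → ℝ) × 𝒲) :
    recDensity q s (t + 1) a = recDensity q s t (Fin.init a.1, a.2) *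
      q t (a.1 (Fin.last t) - s t (Fin.init a.1, a.2)) := by
  rw [recDensity, Fin.prod_univ_castSucc]
  rfl

lemma measurable_recDensity {q : ℕ → ℝ → ℝ≥0∞} (hq : ∀ t, Measurable (q t))
    {s : (t : ℕ) → (Fin t → ℝ) × 𝒲 → ℝ} (hs : ∀ t, Measurable (s t)) (t : ℕ) :
    Measurable (recDensity q s t) := by
  unfold recDensity
  refine Finset.measurable_prod _ fun i _ => (hq i).comp ?_
  exact ((measurable_pi_apply i).comp measurable_fst).sub ((hs i).comp
    ((measurable_pi_lambda _ fun j => (measurable_pi_apply _).comp measurable_fst).prodMk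
      measurable_snd))

/-- Joint law of the parameter `W` and of the first `t` observations when
`y t = e t + s t (y 0, …, y (t - 1); W)` with independent noise variables `e t` of density `q t`
that are independent of `W`. -/
theorem map_recursion_eq_withDensity [IsProbabilityMeasure P] {W : Ω → 𝒲} (hW : Measurable W)
    {e : ℕ → Ω → ℝ} (he : ∀ t, Measurable (e t)) (he_indep : iIndepFun e P)
    (hWe : IndepFun W (fun ω t => e t ω) P)
    {q : ℕ → ℝ → ℝ≥0∞} (hq : ∀ t, Measurable (q t)) (hlaw : ∀ t, P.map (e t) = volume.withDensity (q t))
    {s : (t : ℕ) → (Fin t → ℝ) × 𝒲 → ℝ} (hs : ∀ t, Measurable (s t))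
    {y : ℕ → Ω → ℝ} (hy : ∀ t, Measurable (y t))
    (hrec : ∀ t, ∀ᵐ ω ∂P, y t ω = e t ω + s t (fun i : Fin t => y i ω, W ω)) (t : ℕ) :
    P.map (fun ω => ((fun i : Fin t => y i ω), W ω)) =
      (volume.prod (P.map W)).withDensity (recDensity q s t) := by
  have hrecData : ∀ t, ∀ᵐ ω ∂P, (fun i : Fin t => y i ω) =
      recData s t (fun i : Fin t => e i ω, W ω) := by
    intro t
    induction t with
    | zero => exact .of_forall fun ω => Subsingleton.elim _ _
    | succ t ih =>
      filter_upwards [ih, hrec t] with ω h1 h2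
      have h3 : (Fin.init fun i : Fin (t + 1) => e i ω) = fun i : Fin t => e i ω := rfl
      have h4 : (fun i : Fin (t + 1) => y i ω) =
          Fin.snoc (fun i : Fin t => y i ω) (y t ω) := by
        rw [← Fin.snoc_init_self (fun i : Fin (t + 1) => y i ω)]
        rfl
      rw [h4, recData, h3, ← h1, h2]
      rfl
  have hUm : ∀ t, Measurable (fun ω (i : Fin t) => y i ω) := fun t => by fun_prop
  have hindep : ∀ t, IndepFun (fun ω => ((fun i : Fin t => y i ω), W ω)) (e t) P := by
    intro t
    have h1 : IndepFun (fun ω (i : Fin t) => e i ω) (e t) P := by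
      have := he_indep.indepFun_finset (Finset.range t) {t} (by simp) he
      exact this.comp (φ := fun u (i : Fin t) => u ⟨i, Finset.mem_range.2 i.2⟩) (by fun_prop)
        (measurable_pi_apply (⟨t, by simp⟩ : ({t} : Finset ℕ)))
    have h2 : IndepFun W (fun ω => ((fun i : Fin t => e i ω), e t ω)) P :=
      hWe.comp (φ := id) (ψ := fun u : ℕ → ℝ => ((fun i : Fin t => u i), u t)) measurable_id
        (by fun_prop)
    have h3 := indepFun_prodMk_of_indepFun hW (by fun_prop) (he t) h2 h1
    have hm := measurable_recData hs t
    have h4 := h3.comp (φ := fun a => (recData s t (a.2, a.1), a.1)) (ψ := id) (by fun_prop)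
      measurable_id
    refine h4.congr ?_ .rfl
    filter_upwards [hrecData t] with ω hω
    simp only [Function.comp_apply, hω]
  have : SFinite (P.map W) := inferInstance
  induction t with
  | zero =>
    have h0 : recDensity q s 0 = 1 := by ext a; simp [recDensity]
    rw [h0, withDensity_one]
    have h1 : (volume : Measure (Fin 0 → ℝ)) = Measure.dirac Fin.elim0 := by
      rw [volume_pi, Measure.pi_of_empty _ Fin.elim0]
    rw [h1, Measure.dirac_prod, Measure.map_map (by fun_prop) hW]
    congr 1
    ext1 ω
    exact Prod.ext (Subsingleton.elim _ _) rfl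
  | succ t ih =>
    have h1 := map_snoc_eq_withDensity (hUm t) hW (he t) (measurable_recDensity hq hs t) ih (hq t)
      (hlaw t) (hindep t) (hs t)
    have h2 : recDensity q s (t + 1) = fun r => recDensity q s t (Fin.init r.1, r.2) *
        q t (r.1 (Fin.last t) - s t (Fin.init r.1, r.2)) := by
      funext a; exact recDensity_succ q s t a
    rw [h2, ← h1]
    refine Measure.map_congr ?_
    filter_upwards [hrec t] with ω hω
    rw [← hω]
    refine Prod.ext ?_ rfl
    change (fun i : Fin (t + 1) => y i ω) = _
    rw [← Fin.snoc_init_self (fun i : Fin (t + 1) => y i ω)]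
    rfl

end Density

/-! ### Mutual information -/

section KL

/-- Relative entropy of two probability measures given by positive densities. -/
lemma klDiv_withDensity_withDensity {α : Type*} [MeasurableSpace α] {ρ : Measure α} [SFinite ρ]
    {L p : α → ℝ≥0∞} (hL : Measurable L) (hp : Measurable p) (hL0 : ∀ x, L x ≠ 0)
    (hLt : ∀ x, L x ≠ ∞) (hp0 : ∀ x, p x ≠ 0) (hpt : ∀ x, p x ≠ ∞)
    [IsProbabilityMeasure (ρ.withDensity L)] [IsProbabilityMeasure (ρ.withDensity p)]
    (hint : Integrable (fun x => Real.log (L x).toReal - Real.log (p x).toReal)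
      (ρ.withDensity L)) :
    InformationTheory.klDiv (ρ.withDensity L) (ρ.withDensity p) =
      ENNReal.ofReal (∫ x, (Real.log (L x).toReal - Real.log (p x).toReal) ∂(ρ.withDensity L)) := by
  have heq : ρ.withDensity L = (ρ.withDensity p).withDensity (L / p) := by
    rw [← withDensity_mul _ hp (hL.div hp)]
    congr 1
    funext x
    exact (ENNReal.mul_div_cancel (hp0 x) (hpt x)).symm
  have hac : ρ.withDensity L ≪ ρ.withDensity p := by
    rw [heq]; exact withDensity_absolutelyContinuous _ _
  have hllr : llr (ρ.withDensity L) (ρ.withDensity p) =ᵐ[ρ.withDensity L]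
      fun x => Real.log (L x).toReal - Real.log (p x).toReal := by
    have h := Measure.rnDeriv_withDensity (ρ.withDensity p) (hL.div hp)
    rw [← heq] at h
    filter_upwards [hac.ae_le h] with x hx
    rw [llr, hx, Pi.div_apply, ENNReal.toReal_div, Real.log_div]
    · exact ENNReal.toReal_ne_zero.2 ⟨hL0 x, hLt x⟩
    · exact ENNReal.toReal_ne_zero.2 ⟨hp0 x, hpt x⟩
  rw [InformationTheory.klDiv_of_ac_of_integrable hac ((integrable_congr hllr).2 hint),
    integral_congr_ae hllr]
  simp

/-- Minus the differential entropy of a centred Gaussian variable. -/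
lemma integral_log_gaussianPDFReal {Ω : Type*} [MeasurableSpace Ω] {P : Measure Ω}
    {Z : Ω → ℝ} (hZ : Measurable Z) {w : ℝ≥0} (hw : w ≠ 0) (hlaw : P.map Z = gaussianReal 0 w) :
    Integrable (fun ω => Real.log (gaussianPDFReal 0 w (Z ω))) P ∧
      ∫ ω, Real.log (gaussianPDFReal 0 w (Z ω)) ∂P =
        - (Real.log (2 * Real.pi * w) / 2) - 1 / 2 := by
  have hw' : (0 : ℝ) < w := by exact_mod_cast pos_iff_ne_zero.2 hw
  have : IsProbabilityMeasure P := by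
    have h : IsProbabilityMeasure (P.map Z) := by rw [hlaw]; infer_instance
    exact (Measure.isProbabilityMeasure_map_iff hZ.aemeasurable).1 h
  have hlp : MemLp Z 2 P := by
    have := memLp_id_gaussianReal (μ := 0) (v := w) 2
    rw [← hlaw] at this
    exact this.comp_of_map hZ.aemeasurable
  have hlog : ∀ x, Real.log (gaussianPDFReal 0 w x) =
      - (Real.log (2 * Real.pi * w) / 2) - x ^ 2 * (1 / (2 * w)) := by
    intro x
    rw [gaussianPDFReal, Real.log_mul (by positivity) (Real.exp_pos _).ne', Real.log_inv,
      Real.log_sqrt (by positivity), Real.log_exp]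
    simp only [sub_zero]
    ring
  have hsq : ∫ ω, Z ω ^ 2 ∂P = w := by
    have h1 : ∫ ω, Z ω ^ 2 ∂P = ∫ x, x ^ 2 ∂(gaussianReal 0 w) := by
      rw [← hlaw, integral_map hZ.aemeasurable (by fun_prop)]
    have h2 := variance_fun_id_gaussianReal (μ := 0) (v := w)
    rw [variance_of_integral_eq_zero (by fun_prop) integral_id_gaussianReal] at h2
    rw [h1, h2]
  simp only [hlog]
  refine ⟨(integrable_const _).sub (hlp.integrable_sq.mul_const _), ?_⟩
  rw [integral_sub (integrable_const _) (hlp.integrable_sq.mul_const _), integral_mul_const, hsq]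
  simp only [integral_const, probReal_univ, one_smul, sub_right_inj]
  field_simp

end KL

section Info

variable {d : ℕ} {Ω : Type*} {𝒢 : MeasurableSpace Ω} [mΩ : MeasurableSpace Ω]
  {P : Measure Ω} [IsProbabilityMeasure P] {X : Set (Fin d → ℝ)}
  {k : (Fin d → ℝ) → (Fin d → ℝ) → ℝ} {v : ℝ≥0} {f : (Fin d → ℝ) → Ω → ℝ} {ε : ℕ → Ω → ℝ}

/-- The posterior variance at the query `ξ t` after the queries `ξ 0, …, ξ (t - 1)`. -/
noncomputable def seqVar (k : (Fin d → ℝ) → (Fin d → ℝ) → ℝ) (v : ℝ) (ξ : ℕ → Fin d → ℝ) (t : ℕ) :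
    ℝ :=
  posteriorVar k v (fun i : Fin t => ξ i) (ξ t)

/-- The innovation `y t - μ(ξ t)`, where `μ` is the posterior mean given the observations before
`t`. -/
noncomputable def innovation (k : (Fin d → ℝ) → (Fin d → ℝ) → ℝ) (v : ℝ)
    (f : (Fin d → ℝ) → Ω → ℝ) (ε : ℕ → Ω → ℝ) (ξ : ℕ → Fin d → ℝ) (t : ℕ) : Ω → ℝ :=
  residual k v f ε (fun i : Fin t => ξ i) (ξ t) + ε t

lemma innovation_mem_span {ξ : ℕ → Fin d → ℝ} (hξ : ∀ i, ξ i ∈ X) (t : ℕ) :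
    innovation k v f ε ξ t ∈ Submodule.span ℝ (Set.range (signalNoise X f ε)) :=
  add_mem (residual_mem_span k v f ε (fun i => hξ i) (hξ t)) (noise_mem_span X f ε t)

lemma IsBayesModel.covariance_fixedObs_noise (h : IsBayesModel 𝒢 P X k v f ε)
    {ξ : ℕ → Fin d → ℝ} (hξ : ∀ i, ξ i ∈ X) {t : ℕ} (j : Fin t) :
    covariance (fixedObs f ε (fun i : Fin t => ξ i) j) (ε t) P = 0 := by
  have hnoi := fun t => h.memLp_of_mem_span (noise_mem_span X f ε t)
  rw [fixedObs, covariance_add_left (h.memLp_of_mem_span (signal_mem_span f ε (hξ j))) (hnoi _)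
    (hnoi _), h.covariance_signal_noise (hξ j), h.covariance_noise, if_neg j.2.ne, add_zero]

lemma IsBayesModel.covariance_residual_noise (h : IsBayesModel 𝒢 P X k v f ε)
    {ξ : ℕ → Fin d → ℝ} (hξ : ∀ i, ξ i ∈ X) (t : ℕ) :
    covariance (residual k v f ε (fun i : Fin t => ξ i) (ξ t)) (ε t) P = 0 := by
  have hnoi := fun t => h.memLp_of_mem_span (noise_mem_span X f ε t)
  have hY := fun i => h.memLp_of_mem_span
    (fixedObs_mem_span f ε (ξ := fun i : Fin t => ξ i) (fun i => hξ i) i)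
  rw [residual, covariance_sub_left (h.memLp_of_mem_span (signal_mem_span f ε (hξ t)))
    (memLp_finsetSum' _ fun i _ => (hY i).const_smul _) (hnoi t),
    covariance_sum_left (fun i => (hY i).const_smul _) (hnoi t), h.covariance_signal_noise (hξ t)]
  simp [covariance_smul_left, h.covariance_fixedObs_noise hξ]

lemma IsBayesModel.covariance_innovation_obs (h : IsBayesModel 𝒢 P X k v f ε) (hv : 0 < v)
    {ξ : ℕ → Fin d → ℝ} (hξ : ∀ i, ξ i ∈ X) {t : ℕ} (j : Fin t) :
    covariance (innovation k v f ε ξ t) (fixedObs f ε (fun i : Fin t => ξ i) j) P = 0 := by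
  have hY := h.memLp_of_mem_span
    (fixedObs_mem_span f ε (ξ := fun i : Fin t => ξ i) (fun i => hξ i) j)
  rw [innovation, covariance_add_left
    (h.memLp_of_mem_span (residual_mem_span k v f ε (fun i => hξ i) (hξ t)))
    (h.memLp_of_mem_span (noise_mem_span X f ε t)) hY,
    h.covariance_residual_fixedObs hv (fun i => hξ i) (hξ t), covariance_comm,
    h.covariance_fixedObs_noise hξ, add_zero]

lemma IsBayesModel.covariance_innovation (h : IsBayesModel 𝒢 P X k v f ε) (hv : 0 < v)
    {ξ : ℕ → Fin d → ℝ} (hξ : ∀ i, ξ i ∈ X) {s t : ℕ} (hst : s < t) :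
    covariance (innovation k v f ε ξ t) (innovation k v f ε ξ s) P = 0 := by
  have hsplit : innovation k v f ε ξ s = (f (ξ s) + ε s) -
      ∑ i : Fin s, postWeights k v (fun i : Fin s => ξ i) (ξ s) i • (f (ξ i) + ε i) := by
    rw [innovation, residual]
    simp only [fixedObs]
    abel
  have hY : ∀ i, MemLp (f (ξ i) + ε i) 2 P := fun i => h.memLp_of_mem_span
    (add_mem (signal_mem_span f ε (hξ i)) (noise_mem_span X f ε i))
  have hI := h.memLp_of_mem_span (innovation_mem_span (k := k) (v := v) hξ t)
  have h0 : ∀ j < t, covariance (innovation k v f ε ξ t) (f (ξ j) + ε j) P = 0 := fun j hj =>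
    h.covariance_innovation_obs hv hξ ⟨j, hj⟩
  rw [hsplit, covariance_sub_right hI (hY s) (memLp_finsetSum' _ fun (i : Fin s) _ => (hY i).const_smul _),
    covariance_sum_right (fun i : Fin s => (hY i).const_smul _) hI, h0 s hst, zero_sub, neg_eq_zero]
  refine Finset.sum_eq_zero fun i _ => ?_
  rw [covariance_smul_right, h0 i (i.2.trans hst), mul_zero]

lemma IsBayesModel.map_innovation (h : IsBayesModel 𝒢 P X k v f ε) (hv : 0 < v)
    {ξ : ℕ → Fin d → ℝ} (hξ : ∀ i, ξ i ∈ X) (t : ℕ) :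
    P.map (innovation k v f ε ξ t) = gaussianReal 0 ((seqVar k v ξ t).toNNReal + v) := by
  have hg : IsGaussianProcess (fun _ : Unit => innovation k v f ε ξ t) P :=
    isGaussianProcess_of_mem_span h.signalNoise_gaussian fun _ => innovation_mem_span hξ t
  have hvar : variance (innovation k v f ε ξ t) P = seqVar k v ξ t + v := by
    rw [innovation, variance_add (h.memLp_of_mem_span
      (residual_mem_span k v f ε (fun i => hξ i) (hξ t)))
      (h.memLp_of_mem_span (noise_mem_span X f ε t)), h.covariance_residual_noise hξ,
      h.variance_residual hv (fun i => hξ i) (hξ t), h.variance_noise, seqVar]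
    ring
  have hnn : 0 ≤ seqVar k v ξ t := h.posteriorVar_nonneg hv (fun i => hξ i) (hξ t)
  have hnum : (seqVar k v ξ t + v).toNNReal = (seqVar k v ξ t).toNNReal + v := by
    rw [Real.toNNReal_add hnn v.coe_nonneg]
    simp
  have hmean : ∫ ω, innovation k v f ε ξ t ω ∂P = 0 :=
    integral_eq_zero_of_mem_span h.memLp_signalNoise h.integral_signalNoise
      (innovation_mem_span hξ t)
  rw [(hg.hasGaussianLaw_eval ()).map_eq_gaussianReal, hvar, hmean, hnum]

/-- The innovations are independent: they are jointly Gaussian and uncorrelated. -/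
lemma IsBayesModel.iIndepFun_innovation (h : IsBayesModel 𝒢 P X k v f ε) (hv : 0 < v)
    {ξ : ℕ → Fin d → ℝ} (hξ : ∀ i, ξ i ∈ X) : iIndepFun (innovation k v f ε ξ) P := by
  have hg : IsGaussianProcess (fun (p : (_ : ℕ) × Unit) ω => innovation k v f ε ξ p.1 ω) P :=
    isGaussianProcess_of_mem_span h.signalNoise_gaussian fun p => innovation_mem_span hξ p.1
  have := hg.iIndepFun_of_covariance_eq_zero (X := fun t (_ : Unit) => innovation k v f ε ξ t)
    (fun t _ => (h.memLp_of_mem_span (innovation_mem_span hξ t)).aemeasurable) ?_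
  · exact this.comp (fun _ u => u ()) fun _ => measurable_pi_apply ()
  · intro s t hst _ _
    rcases hst.lt_or_gt with h1 | h1
    · rw [covariance_comm]; exact h.covariance_innovation hv hξ h1
    · exact h.covariance_innovation hv hξ h1

/-- The mutual information between `T` noisy observations and the signal. Both the density of the
observations given the signal and their marginal density are products of Gaussian densities, the
latter by means of the innovations. -/
theorem IsBayesModel.mutualInfo_eq (h : IsBayesModel 𝒢 P X k v f ε) (hv : 0 < v)
    {ξ : ℕ → Fin d → ℝ} (hξ : ∀ i, ξ i ∈ X) (T : ℕ) :
    mutualInfo P (fun ω (i : Fin T) => f (ξ i) ω + ε i ω) (fun ω (i : Fin T) => f (ξ i) ω) =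
      ENNReal.ofReal (∑ i : Fin T, Real.log (1 + seqVar k v ξ i / v) / 2) := by
  have hv' : (0 : ℝ) < v := by exact_mod_cast hv
  have hv0 : v ≠ 0 := hv.ne'
  set w : ℕ → ℝ≥0 := fun t => (seqVar k v ξ t).toNNReal + v with hw
  have hw0 : ∀ t, w t ≠ 0 := fun t => (add_pos_of_nonneg_of_pos (zero_le) hv).ne'
  have hfm : ∀ i, Measurable (f (ξ i)) := fun i => h.gp.measurable _ (hξ i)
  have hem := h.noise_measurable
  have hIm : ∀ t, Measurable (innovation k v f ε ξ t) := fun t =>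
    measurable_of_mem_span h.measurable_signalNoise (innovation_mem_span hξ t)
  set y : ℕ → Ω → ℝ := fun i ω => f (ξ i) ω + ε i ω with hy
  have hym : ∀ t, Measurable (y t) := fun t => (hfm t).add (hem t)
  set F : Ω → Fin T → ℝ := fun ω i => f (ξ i) ω with hF
  have hFm : Measurable F := by fun_prop
  -- The joint law of observations and signal. The recursion needs a mean for every index, so the
  -- signal is continued by zero.
  let s₁ : (t : ℕ) → (Fin t → ℝ) × (Fin T → ℝ) → ℝ := fun t a => if ht : t < T then a.2 ⟨t, ht⟩ else 0
  have hs₁ : ∀ t, Measurable (s₁ t) := by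
    intro t
    by_cases ht : t < T
    · simp only [s₁, ht, dite_true]; fun_prop
    · simp only [s₁, ht, dite_false]; fun_prop
  let y₁ : ℕ → Ω → ℝ := fun t ω => ε t ω + s₁ t (fun _ => 0, F ω)
  have hs₁y : ∀ t (u u' : Fin t → ℝ) w, s₁ t (u, w) = s₁ t (u', w) := fun _ _ _ _ => rfl
  have hFε : IndepFun F (fun ω t => ε t ω) P :=
    h.indepFun.comp (φ := fun u (i : Fin T) => u ⟨ξ i, hξ i⟩) (ψ := id)
      (measurable_pi_lambda _ fun i => measurable_pi_apply _) measurable_id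
  have hjoint := map_recursion_eq_withDensity (P := P) (W := F) hFm hem h.noise_indep
    hFε
    (fun _ => measurable_gaussianPDF 0 v)
    (fun t => by rw [h.noise_law t, gaussianReal_of_var_ne_zero _ hv0]) hs₁
    (y := y₁) (fun t => (hem t).add ((hs₁ t).comp (by fun_prop)))
    (fun t => .of_forall fun ω => by rw [hs₁y t _ (fun _ => 0)]) T
  have hy₁ : (fun ω => ((fun i : Fin T => y₁ i ω), F ω)) = fun ω => ((fun i : Fin T => y i ω), F ω) := by
    funext ω
    refine Prod.ext (funext fun i => ?_) rfl
    simp only [y₁, s₁, i.2, dite_true, y, F]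
    exact add_comm _ _
  rw [hy₁] at hjoint
  -- The marginal law of the observations: a recursion driven by the innovations.
  let s₂ : (t : ℕ) → (Fin t → ℝ) × Unit → ℝ := fun t a =>
    posteriorMean k v (fun i : Fin t => ξ i) a.1 (ξ t)
  have hs₂ : ∀ t, Measurable (s₂ t) := by
    intro t
    simp only [s₂, posteriorMean_eq_sum]
    fun_prop
  have hmarg := map_recursion_eq_withDensity (P := P) (W := fun _ => ()) measurable_const hIm
    (h.iIndepFun_innovation hv hξ) (indepFun_const_left _ _)
    (fun t => measurable_gaussianPDF 0 (w t))
    (fun t => by rw [h.map_innovation hv hξ t, gaussianReal_of_var_ne_zero _ (hw0 t)]) hs₂ hym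
    (fun t => .of_forall fun ω => by
      simp only [innovation, Pi.add_apply, residual_apply, s₂, y]; ring) T
  have hLm := measurable_recDensity (fun _ => measurable_gaussianPDF 0 v) hs₁ T
  have hp2m := measurable_recDensity (fun t => measurable_gaussianPDF 0 (w t)) hs₂ T
  set L := recDensity (fun _ => gaussianPDF 0 v) s₁ T with hL
  set p : (Fin T → ℝ) → ℝ≥0∞ := fun u =>
    recDensity (fun t => gaussianPDF 0 (w t)) s₂ T (u, ()) with hp
  have hpm : Measurable p := hp2m.comp (by fun_prop)
  have hmargY : P.map (fun ω (i : Fin T) => y i ω) = volume.withDensity p := by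
    have h1 : P.map (fun ω (i : Fin T) => y i ω) =
        (P.map fun ω => ((fun i : Fin T => y i ω), ())).map Prod.fst := by
      rw [Measure.map_map measurable_fst (by fun_prop)]
      rfl
    have h2 : P.map (fun _ : Ω => ()) = Measure.dirac () := by
      rw [Measure.map_const, measure_univ, one_smul]
    rw [h1, hmarg, h2]
    refine Measure.ext_of_lintegral _ fun Ψ hΨ => ?_
    rw [lintegral_map hΨ measurable_fst,
      lintegral_withDensity_eq_lintegral_mul _ hp2m (by fun_prop),
      lintegral_withDensity_eq_lintegral_mul _ hpm hΨ, lintegral_prod _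
        (hp2m.mul (by fun_prop)).aemeasurable]
    refine lintegral_congr fun u => ?_
    rw [lintegral_dirac]
    rfl
  have hYm : Measurable (fun ω (i : Fin T) => y i ω) := by fun_prop
  have hprod : (P.map (fun ω (i : Fin T) => y i ω)).prod (P.map F) =
      (volume.prod (P.map F)).withDensity (fun a => p a.1) := by
    rw [hmargY, prod_withDensity_left hpm]
  have := Measure.isProbabilityMeasure_map (μ := P) hFm.aemeasurable
  have := Measure.isProbabilityMeasure_map (μ := P) hYm.aemeasurable
  have hP1 : IsProbabilityMeasure ((volume.prod (P.map F)).withDensity L) := by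
    rw [← hjoint]; exact Measure.isProbabilityMeasure_map (hYm.prodMk hFm).aemeasurable
  have hP2 : IsProbabilityMeasure ((volume.prod (P.map F)).withDensity (fun a => p a.1)) := by
    rw [← hprod]; infer_instance
  -- The log-densities along the data.
  have hlogL : ∀ ω, Real.log (L ((fun i : Fin T => y i ω), F ω)).toReal =
      ∑ i : Fin T, Real.log (gaussianPDFReal 0 v (ε i ω)) := by
    intro ω
    rw [hL, recDensity, ENNReal.toReal_prod, Real.log_prod]
    · refine Finset.sum_congr rfl fun i _ => ?_
      rw [toReal_gaussianPDF]
      simp only [s₁, i.2, dite_true, y, F, add_sub_cancel_left]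
    · intro i _
      rw [toReal_gaussianPDF]
      exact (gaussianPDFReal_pos _ _ _ hv0).ne'
  have hlogp : ∀ ω, Real.log (p (fun i : Fin T => y i ω)).toReal =
      ∑ i : Fin T, Real.log (gaussianPDFReal 0 (w i) (innovation k v f ε ξ i ω)) := by
    intro ω
    simp only [hp]
    rw [recDensity, ENNReal.toReal_prod, Real.log_prod]
    · refine Finset.sum_congr rfl fun i _ => ?_
      rw [toReal_gaussianPDF]
      congr 2
      simp only [s₂, y, innovation, Pi.add_apply, residual_apply, Fin.val_castLE]
      ring
    · intro i _
      rw [toReal_gaussianPDF]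
      exact (gaussianPDFReal_pos _ _ _ (hw0 i)).ne'
  have hi1 := fun i : Fin T => integral_log_gaussianPDFReal (hem i) hv0 (h.noise_law i)
  have hi2 := fun i : Fin T => integral_log_gaussianPDFReal (hIm i) (hw0 i) (h.map_innovation hv hξ i)
  have hLp : ∀ a, L a ≠ 0 ∧ L a ≠ ∞ := fun a =>
    ⟨Finset.prod_ne_zero_iff.2 fun i _ => (gaussianPDF_pos 0 hv0 _).ne',
      (ENNReal.prod_lt_top fun i _ => gaussianPDF_lt_top).ne⟩
  have hpp : ∀ a, p a ≠ 0 ∧ p a ≠ ∞ := fun a =>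
    ⟨Finset.prod_ne_zero_iff.2 fun i _ => (gaussianPDF_pos 0 (hw0 _) _).ne',
      (ENNReal.prod_lt_top fun i _ => gaussianPDF_lt_top).ne⟩
  have hmeas : Measurable (fun a : (Fin T → ℝ) × (Fin T → ℝ) =>
      Real.log (L a).toReal - Real.log (p a.1).toReal) := by fun_prop
  have hint : Integrable (fun a : (Fin T → ℝ) × (Fin T → ℝ) =>
      Real.log (L a).toReal - Real.log (p a.1).toReal) ((volume.prod (P.map F)).withDensity L) := by
    rw [← hjoint, integrable_map_measure hmeas.aestronglyMeasurable (by fun_prop)]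
    simp only [Function.comp_def, hlogL, hlogp]
    exact (integrable_finsetSum _ fun i _ => (hi1 i).1).sub
      (integrable_finsetSum _ fun i _ => (hi2 i).1)
  rw [mutualInfo]
  change InformationTheory.klDiv (P.map fun ω => ((fun i : Fin T => y i ω), F ω))
    ((P.map fun ω (i : Fin T) => y i ω).prod (P.map F)) = _
  rw [hprod, hjoint, klDiv_withDensity_withDensity hLm (by fun_prop) (fun a => (hLp a).1)
    (fun a => (hLp a).2) (fun a => (hpp _).1) (fun a => (hpp _).2) hint, ← hjoint,
    integral_map (by fun_prop) hmeas.aestronglyMeasurable]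
  congr 1
  simp only [hlogL, hlogp]
  rw [integral_sub (integrable_finsetSum _ fun i _ => (hi1 i).1)
    (integrable_finsetSum _ fun i _ => (hi2 i).1), integral_finsetSum _ fun i _ => (hi1 i).1,
    integral_finsetSum _ fun i _ => (hi2 i).1, ← Finset.sum_sub_distrib]
  refine Finset.sum_congr rfl fun i _ => ?_
  rw [(hi1 i).2, (hi2 i).2]
  have hnn : 0 ≤ seqVar k v ξ i := h.posteriorVar_nonneg hv (fun i => hξ i) (hξ i)
  have hwi : ((w i : ℝ≥0) : ℝ) = v * (1 + seqVar k v ξ i / v) := by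
    simp only [hw, NNReal.coe_add, Real.coe_toNNReal _ hnn]
    field_simp
    ring
  have h2pi : Real.log (2 * Real.pi * (v * (1 + seqVar k v ξ i / v))) =
      Real.log (2 * Real.pi * v) + Real.log (1 + seqVar k v ξ i / v) := by
    rw [← mul_assoc, Real.log_mul (by positivity) (by positivity)]
  rw [hwi, h2pi]
  ring

/-- The maximum information gain bounds the information gain along any sequence of queries; in
particular, it is finite. -/
theorem IsBayesModel.sum_log_le_maxInfoGain (h : IsBayesModel 𝒢 P X k v f ε) (hv : 0 < v)
    (hk : ∀ z ∈ X, k z z ≤ 1) {ξ : ℕ → Fin d → ℝ} (hξ : ∀ i, ξ i ∈ X) (T : ℕ) :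
    ∑ i : Fin T, Real.log (1 + seqVar k v ξ i / v) / 2 ≤ (maxInfoGain P X f ε T).toReal := by
  have hv' : (0 : ℝ) < v := by exact_mod_cast hv
  have hnn : ∀ ξ : ℕ → Fin d → ℝ, (∀ i, ξ i ∈ X) → ∀ i, 0 ≤ seqVar k v ξ i := fun ξ hξ i =>
    h.posteriorVar_nonneg hv (fun i => hξ i) (hξ i)
  have hfin : maxInfoGain P X f ε T ≤ ENNReal.ofReal (∑ _i : Fin T, Real.log (1 + 1 / v) / 2) := by
    refine iSup_le fun a => ?_
    let ξ' : ℕ → Fin d → ℝ := fun i => if hi : i < T then a ⟨i, hi⟩ else ξ i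
    have hξ' : ∀ i, ξ' i ∈ X := by
      intro i
      by_cases hi : i < T
      · simp only [ξ', hi, dite_true]; exact (a ⟨i, hi⟩).2
      · simp only [ξ', hi, dite_false]; exact hξ i
    have ha : ∀ i : Fin T, ((a i : X) : Fin d → ℝ) = ξ' i := fun i => by simp [ξ']
    simp only [ha]
    rw [h.mutualInfo_eq hv hξ' T]
    refine ENNReal.ofReal_le_ofReal (Finset.sum_le_sum fun i _ => ?_)
    have h1 : seqVar k v ξ' i ≤ 1 := by
      have h2 := h.posteriorStd_le_one hv hk (ξ := fun j : Fin i => ξ' j) (fun j => hξ' j) (hξ' i)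
      have h3 := h.posteriorStd_sq hv (ξ := fun j : Fin i => ξ' j) (fun j => hξ' j) (hξ' i)
      have h4 : 0 ≤ posteriorStd k v (fun j : Fin i => ξ' j) (ξ' i) := Real.sqrt_nonneg _
      rw [seqVar, ← h3]
      exact pow_le_one₀ h4 h2
    have h0 := hnn ξ' hξ' i
    gcongr
  rw [← ENNReal.ofReal_le_iff_le_toReal (ne_top_of_le_ne_top ENNReal.ofReal_ne_top hfin),
    ← h.mutualInfo_eq hv hξ T]
  exact le_iSup (fun a : Fin T → X => mutualInfo P (fun ω (i : Fin T) => f (a i) ω + ε i ω)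
    (fun ω (i : Fin T) => f (a i) ω)) fun i => ⟨ξ i, hξ i⟩

end Info

/-! ### Gaussian tails -/

/-- `(x + c)² ≥ x² + c²` for `x, c ≥ 0`, so the mass beyond `c` is at most `exp(-c²/2)` times the mass
of a half line. -/
lemma gaussianReal_Ioi_le {c : ℝ} (hc : 0 ≤ c) :
    gaussianReal 0 1 (Set.Ioi c) ≤
      ENNReal.ofReal (Real.exp (-c ^ 2 / 2)) * gaussianReal 0 1 (Set.Ioi 0) := by
  have hshift : gaussianReal 0 1 (Set.Ioi c) =
      ∫⁻ x, (Set.Ioi (0 : ℝ)).indicator (fun x => gaussianPDF 0 1 (x + c)) x := by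
    rw [gaussianReal_apply _ one_ne_zero, ← lintegral_indicator measurableSet_Ioi,
      ← lintegral_add_right_eq_self _ c]
    refine lintegral_congr fun x => ?_
    simp [Set.indicator_apply]
  rw [hshift, lintegral_indicator measurableSet_Ioi, gaussianReal_apply _ one_ne_zero,
    ← lintegral_const_mul _ (measurable_gaussianPDF 0 1)]
  refine setLIntegral_mono (by fun_prop) fun x hx => ?_
  rw [gaussianPDF, gaussianPDF, ← ENNReal.ofReal_mul (Real.exp_pos _).le]
  refine ENNReal.ofReal_le_ofReal ?_
  rw [gaussianPDFReal, gaussianPDFReal, mul_left_comm, ← Real.exp_add]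
  gcongr
  simp only [sub_zero, NNReal.coe_one, mul_one]
  have : 0 ≤ x * c := mul_nonneg (le_of_lt hx) hc
  nlinarith

lemma gaussianReal_neg_Iio (c : ℝ) :
    gaussianReal 0 1 (Set.Iio (-c)) = gaussianReal 0 1 (Set.Ioi c) := by
  have h := gaussianReal_map_neg (μ := 0) (v := 1)
  rw [neg_zero] at h
  conv_lhs => rw [← h]
  rw [Measure.map_apply measurable_neg measurableSet_Iio]
  congr 1
  ext x
  simp

/-- The two-sided tail bound without a prefactor, `P(|Z| > c) ≤ exp(-c²/2)`. -/
lemma gaussianReal_abs_gt_le {c : ℝ} (hc : 0 ≤ c) :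
    gaussianReal 0 1 {x | c < |x|} ≤ ENNReal.ofReal (Real.exp (-c ^ 2 / 2)) := by
  have hsub : {x : ℝ | c < |x|} ⊆ Set.Iio (-c) ∪ Set.Ioi c := by
    intro x hx
    have hx' : c < |x| := hx
    rcases lt_abs.1 hx' with h | h
    · exact Or.inr h
    · exact Or.inl (show x < -c by linarith)
  have hhalf : gaussianReal 0 1 (Set.Ioi (0 : ℝ)) + gaussianReal 0 1 (Set.Ioi (0 : ℝ)) ≤ 1 := by
    conv_lhs => enter [1]; rw [← gaussianReal_neg_Iio 0, neg_zero]
    have hd : Disjoint (Set.Iio (0 : ℝ)) (Set.Ioi 0) :=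
      Set.disjoint_left.2 fun x (h1 : x < 0) (h2 : 0 < x) => lt_asymm h1 h2
    rw [← measure_union hd measurableSet_Ioi]
    exact prob_le_one
  calc gaussianReal 0 1 {x | c < |x|}
      ≤ gaussianReal 0 1 (Set.Iio (-c)) + gaussianReal 0 1 (Set.Ioi c) :=
        (measure_mono hsub).trans (measure_union_le _ _)
    _ = gaussianReal 0 1 (Set.Ioi c) + gaussianReal 0 1 (Set.Ioi c) := by
        rw [gaussianReal_neg_Iio]
    _ ≤ ENNReal.ofReal (Real.exp (-c ^ 2 / 2)) *
          (gaussianReal 0 1 (Set.Ioi 0) + gaussianReal 0 1 (Set.Ioi 0)) := by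
        rw [mul_add]
        exact add_le_add (gaussianReal_Ioi_le hc) (gaussianReal_Ioi_le hc)
    _ ≤ ENNReal.ofReal (Real.exp (-c ^ 2 / 2)) := mul_le_of_le_one_right' hhalf

lemma gaussianReal_abs_gt_mul_sqrt_le {c V : ℝ} (hc : 0 ≤ c) (hV : 0 ≤ V) :
    gaussianReal 0 V.toNNReal {x | c * √V < |x|} ≤ ENNReal.ofReal (Real.exp (-c ^ 2 / 2)) := by
  have h := gaussianReal_map_const_mul (μ := 0) (v := 1) (√V)
  have h2 : (NNReal.mk (√V ^ 2) (sq_nonneg _) * 1 : ℝ≥0) = V.toNNReal := by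
    ext
    simp [Real.sq_sqrt hV, hV]
  rw [mul_zero, h2] at h
  rw [← h, Measure.map_apply (by fun_prop) (measurableSet_lt (by fun_prop) (by fun_prop))]
  refine (measure_mono fun x hx => ?_).trans (gaussianReal_abs_gt_le hc)
  simp only [Set.mem_preimage, Set.mem_ofPred_eq, abs_mul, abs_of_nonneg (Real.sqrt_nonneg V)] at hx ⊢
  rw [mul_comm] at hx
  exact lt_of_mul_lt_mul_left hx (Real.sqrt_nonneg V)

/-! ### The posterior at a fixed design, for every value of the data -/

section Bayes

variable {d n : ℕ} {Ω : Type*} {𝒢 : MeasurableSpace Ω} [mΩ : MeasurableSpace Ω]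
  {P : Measure Ω} [IsProbabilityMeasure P] {X : Set (Fin d → ℝ)}
  {k : (Fin d → ℝ) → (Fin d → ℝ) → ℝ} {v : ℝ≥0} {f : (Fin d → ℝ) → Ω → ℝ} {ε : ℕ → Ω → ℝ}

/-- Integration against the law of recursively generated data and their parameter. -/
lemma lintegral_recursion {𝒲 : Type*} [MeasurableSpace 𝒲] {W : Ω → 𝒲} (hW : Measurable W)
    {e : ℕ → Ω → ℝ} (he : ∀ t, Measurable (e t)) (he_indep : iIndepFun e P)
    (hWe : IndepFun W (fun ω t => e t ω) P)
    {q : ℕ → ℝ → ℝ≥0∞} (hq : ∀ t, Measurable (q t)) (hlaw : ∀ t, P.map (e t) = volume.withDensity (q t))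
    {s : (t : ℕ) → (Fin t → ℝ) × 𝒲 → ℝ} (hs : ∀ t, Measurable (s t))
    {y : ℕ → Ω → ℝ} (hy : ∀ t, Measurable (y t))
    (hrec : ∀ t, ∀ᵐ ω ∂P, y t ω = e t ω + s t (fun i : Fin t => y i ω, W ω)) (t : ℕ)
    {Ψ : (Fin t → ℝ) × 𝒲 → ℝ≥0∞} (hΨ : Measurable Ψ) :
    ∫⁻ ω, Ψ (fun i : Fin t => y i ω, W ω) ∂P =
      ∫⁻ u, ∫⁻ ω, recDensity q s t (u, W ω) * Ψ (u, W ω) ∂P := by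
  have hd := measurable_recDensity hq hs t
  rw [← lintegral_map (f := Ψ) (g := fun ω => ((fun i : Fin t => y i ω), W ω)) hΨ (by fun_prop),
    map_recursion_eq_withDensity hW he he_indep hWe hq hlaw hs hy hrec t,
    lintegral_withDensity_eq_lintegral_mul _ hd hΨ,
    lintegral_prod _ (hd.mul hΨ).aemeasurable]
  refine lintegral_congr fun u => ?_
  rw [lintegral_map (by fun_prop) hW]
  rfl

lemma gaussianPDFReal_le (v : ℝ≥0) (x : ℝ) : gaussianPDFReal 0 v x ≤ (√(2 * Real.pi * v))⁻¹ := by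
  rw [gaussianPDFReal]
  refine mul_le_of_le_one_right (by positivity) (Real.exp_le_one_iff.2 ?_)
  rw [neg_div]
  exact neg_nonpos.2 (by positivity)

lemma continuous_gaussianPDFReal (v : ℝ≥0) : Continuous (gaussianPDFReal 0 v) := by
  rw [gaussianPDFReal_def]
  fun_prop

/-- Continuity in `u` of a Gaussian likelihood integrated against a bounded continuous function. -/
lemma continuous_lintegral_likelihood {F : Ω → Fin n → ℝ} (hF : Measurable F) {H : Ω → ℝ}
    (hH : Measurable H) {m : (Fin n → ℝ) → ℝ} (hm : Continuous m)
    (g : BoundedContinuousFunction ℝ ℝ≥0) :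
    Continuous fun u : Fin n → ℝ =>
      ∫⁻ ω, (∏ i, gaussianPDF 0 v (u i - F ω i)) * g (H ω - m u) ∂P := by
  have heq : ∀ u ω, (∏ i, gaussianPDF 0 v (u i - F ω i)) * (g (H ω - m u) : ℝ≥0∞) =
      ENNReal.ofReal ((∏ i, gaussianPDFReal 0 v (u i - F ω i)) * g (H ω - m u)) := by
    intro u ω
    rw [ENNReal.ofReal_mul (Finset.prod_nonneg fun i _ => gaussianPDFReal_nonneg _ _ _),
      ENNReal.ofReal_prod_of_nonneg (fun i _ => gaussianPDFReal_nonneg _ _ _),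
      ENNReal.ofReal_coe_nnreal]
    rfl
  simp only [heq]
  have hc := continuous_gaussianPDFReal v
  have hg := g.continuous
  rw [continuous_iff_continuousAt]
  intro u
  refine tendsto_lintegral_filter_of_dominated_convergence
    (fun _ => ENNReal.ofReal ((∏ _i : Fin n, (√(2 * Real.pi * v))⁻¹) * nndist g 0)) ?_ ?_ ?_ ?_
  · refine .of_forall fun u' => ?_
    have : Measurable (gaussianPDFReal 0 v) := measurable_gaussianPDFReal 0 v
    have := hg.measurable
    fun_prop
  · refine .of_forall fun u' => .of_forall fun ω => ENNReal.ofReal_le_ofReal ?_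
    gcongr
    · exact fun i _ => gaussianPDFReal_nonneg _ _ _
    · exact gaussianPDFReal_le _ _
    · exact BoundedContinuousFunction.NNReal.upper_bound g _
  · simp
  · refine .of_forall fun ω => ?_
    exact (ENNReal.continuous_ofReal.comp (by fun_prop)).tendsto u

/-- Bayes' rule for a fixed design, at every value `u` of the data: weighted by the likelihood of
`u`, the variable `f z - μ(z)` has the law `N(0, σ²(z))`. Almost every `u` is covered by the
independence of residual and data, and the other ones by continuity. -/
lemma IsBayesModel.lintegral_likelihood_eq (h : IsBayesModel 𝒢 P X k v f ε) (hv : 0 < v)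
    {ξ : Fin n → Fin d → ℝ} (hξ : ∀ i, ξ i ∈ X) {z : Fin d → ℝ} (hz : z ∈ X) (u : Fin n → ℝ)
    (g : BoundedContinuousFunction ℝ ℝ≥0) :
    ∫⁻ ω, (∏ i, gaussianPDF 0 v (u i - f (ξ i) ω)) * g (f z ω - posteriorMean k v ξ u z) ∂P =
      (∫⁻ ω, g (residual k v f ε ξ z ω) ∂P) * ∫⁻ ω, ∏ i, gaussianPDF 0 v (u i - f (ξ i) ω) ∂P := by
  have hv0 : v ≠ 0 := hv.ne'
  have hfm : ∀ i, Measurable (f (ξ i)) := fun i => h.gp.measurable _ (hξ i)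
  have hfz := h.gp.measurable _ hz
  have hem := h.noise_measurable
  have hgm := g.continuous.measurable
  have hmean : Continuous fun u : Fin n → ℝ => posteriorMean k v ξ u z := by
    simp only [posteriorMean_eq_sum]; fun_prop
  have hmeanm := hmean.measurable
  have hpdf := measurable_gaussianPDF 0 v
  have hRm : Measurable (residual k v f ε ξ z) :=
    measurable_of_mem_span h.measurable_signalNoise (residual_mem_span k v f ε hξ hz)
  -- The observations as a recursion with the parameter `W = (f (ξ i))_i, f z`.
  let W : Ω → (Fin n → ℝ) × ℝ := fun ω => (fun i => f (ξ i) ω, f z ω)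
  have hWm : Measurable W := by fun_prop
  have hWε : IndepFun W (fun ω t => ε t ω) P :=
    h.indepFun.comp (φ := fun p => ((fun i => p ⟨ξ i, hξ i⟩), p ⟨z, hz⟩)) (ψ := id)
      ((measurable_pi_lambda _ fun i => measurable_pi_apply _).prodMk (measurable_pi_apply _))
      measurable_id
  let s : (t : ℕ) → (Fin t → ℝ) × ((Fin n → ℝ) × ℝ) → ℝ := fun t a =>
    if ht : t < n then a.2.1 ⟨t, ht⟩ else 0
  have hs : ∀ t, Measurable (s t) := by
    intro t
    by_cases ht : t < n
    · simp only [s, ht, dite_true]; fun_prop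
    · simp only [s, ht, dite_false]; fun_prop
  let y : ℕ → Ω → ℝ := fun t ω => ε t ω + s t (fun _ => 0, W ω)
  have hym : ∀ t, Measurable (y t) := fun t => (hem t).add ((hs t).comp (by fun_prop))
  have hyobs : ∀ ω, (fun i : Fin n => y i ω) = fun i => fixedObs f ε ξ i ω := by
    intro ω
    funext i
    simp only [y, s, i.2, dite_true, W, fixedObs, Pi.add_apply]
    exact add_comm _ _
  have hL : ∀ u ω, recDensity (fun _ => gaussianPDF 0 v) s n (u, W ω) =
      ∏ i, gaussianPDF 0 v (u i - f (ξ i) ω) := by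
    intro u ω
    rw [recDensity]
    refine Finset.prod_congr rfl fun i _ => ?_
    simp only [s, i.2, dite_true, W]
  have hrec : ∀ {Ψ : (Fin n → ℝ) × ((Fin n → ℝ) × ℝ) → ℝ≥0∞}, Measurable Ψ →
      ∫⁻ ω, Ψ (fun i => fixedObs f ε ξ i ω, W ω) ∂P =
        ∫⁻ u, ∫⁻ ω, (∏ i, gaussianPDF 0 v (u i - f (ξ i) ω)) * Ψ (u, W ω) ∂P := by
    intro Ψ hΨ
    have := lintegral_recursion (P := P) hWm hem h.noise_indep hWε
      (fun _ => measurable_gaussianPDF 0 v)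
      (fun t => by rw [h.noise_law t, gaussianReal_of_var_ne_zero _ hv0]) hs hym
      (fun t => .of_forall fun ω => rfl) n hΨ
    simpa only [hyobs, hL] using this
  have hindep := h.indepFun_fixedObs hξ (residual_mem_span k v f ε hξ hz)
    (h.covariance_residual_fixedObs hv hξ hz)
  have hfobs : ∀ i, Measurable (fixedObs f ε ξ i) := fun i => (hfm i).add (hem i)
  have hone : ∀ u, ∫⁻ ω, ∏ i, gaussianPDF 0 v (u i - f (ξ i) ω) ∂P =
      ∫⁻ ω, (∏ i, gaussianPDF 0 v (u i - f (ξ i) ω)) *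
        (BoundedContinuousFunction.const ℝ (1 : ℝ≥0)) (f z ω - posteriorMean k v ξ u z) ∂P := by
    intro u; simp
  have hRfin : ∫⁻ ω, g (residual k v f ε ξ z ω) ∂P ≠ ∞ := by
    refine ne_top_of_le_ne_top (b := (nndist g 0 : ℝ≥0∞)) ENNReal.coe_ne_top ?_
    calc ∫⁻ ω, g (residual k v f ε ξ z ω) ∂P ≤ ∫⁻ _, (nndist g 0 : ℝ≥0∞) ∂P :=
          lintegral_mono fun ω => ENNReal.coe_le_coe.2
            (BoundedContinuousFunction.NNReal.upper_bound g _)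
      _ = _ := by simp
  have hcontA : Continuous fun u : Fin n → ℝ => ∫⁻ ω, (∏ i, gaussianPDF 0 v (u i - f (ξ i) ω)) *
      g (f z ω - posteriorMean k v ξ u z) ∂P :=
    continuous_lintegral_likelihood (F := fun ω i => f (ξ i) ω) (by fun_prop) hfz hmean g
  have hcontB : Continuous fun u : Fin n → ℝ => (∫⁻ ω, g (residual k v f ε ξ z ω) ∂P) *
      ∫⁻ ω, ∏ i, gaussianPDF 0 v (u i - f (ξ i) ω) ∂P := by
    refine ENNReal.continuous_const_mul hRfin |>.comp ?_
    simp only [hone]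
    exact continuous_lintegral_likelihood (F := fun ω i => f (ξ i) ω) (by fun_prop) hfz hmean _
  refine congrFun ((Continuous.ae_eq_iff_eq volume hcontA hcontB).1 ?_) u
  refine ae_eq_of_forall_setLIntegral_eq_of_sigmaFinite hcontA.measurable hcontB.measurable
    fun S hS _ => ?_
  have hind : Measurable (S.indicator fun _ => (1 : ℝ≥0∞)) := measurable_one.indicator hS
  rw [← lintegral_indicator hS, ← lintegral_indicator hS]
  have hleft := hrec (Ψ := fun a => S.indicator (fun _ => 1) a.1 *
    (g (a.2.2 - posteriorMean k v ξ a.1 z) : ℝ≥0∞)) (by fun_prop)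
  have hright := hrec (Ψ := fun a => S.indicator (fun _ => 1) a.1) (by fun_prop)
  have hres : ∀ ω, f z ω - posteriorMean k v ξ (fun i => fixedObs f ε ξ i ω) z =
      residual k v f ε ξ z ω := fun ω => (residual_apply k v f ε ξ z ω).symm
  have hprod : ∫⁻ ω, S.indicator (fun _ => 1) (fun i => fixedObs f ε ξ i ω) *
        (g (residual k v f ε ξ z ω) : ℝ≥0∞) ∂P =
      (∫⁻ ω, S.indicator (fun _ => 1) (fun i => fixedObs f ε ξ i ω) ∂P) *
        ∫⁻ ω, g (residual k v f ε ξ z ω) ∂P :=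
    lintegral_mul_eq_lintegral_mul_lintegral_of_indepFun''
      (hind.comp (by fun_prop)).aemeasurable
      (by fun_prop) (hindep.symm.comp (φ := S.indicator fun _ => (1 : ℝ≥0∞))
        (ψ := fun x => (g x : ℝ≥0∞)) hind (by fun_prop))
  simp only [W, hres] at hleft
  calc ∫⁻ u, S.indicator (fun u => ∫⁻ ω, (∏ i, gaussianPDF 0 v (u i - f (ξ i) ω)) *
          g (f z ω - posteriorMean k v ξ u z) ∂P) u
      = ∫⁻ u, ∫⁻ ω, (∏ i, gaussianPDF 0 v (u i - f (ξ i) ω)) *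
          (S.indicator (fun _ => 1) u * (g (f z ω - posteriorMean k v ξ u z) : ℝ≥0∞)) ∂P := by
        refine lintegral_congr fun u => ?_
        by_cases hu : u ∈ S <;> simp [hu]
    _ = (∫⁻ ω, g (residual k v f ε ξ z ω) ∂P) * ∫⁻ u, ∫⁻ ω,
          (∏ i, gaussianPDF 0 v (u i - f (ξ i) ω)) * S.indicator (fun _ => 1) u ∂P := by
        rw [← hleft, hprod, hright, mul_comm]
    _ = _ := by
        rw [← lintegral_const_mul' _ _ hRfin]
        refine lintegral_congr fun u => ?_
        by_cases hu : u ∈ S <;> simp [hu]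

/-- Posterior tail bound for a fixed design, at every value `u` of the data. -/
lemma IsBayesModel.lintegral_likelihood_tail_le (h : IsBayesModel 𝒢 P X k v f ε) (hv : 0 < v)
    {ξ : Fin n → Fin d → ℝ} (hξ : ∀ i, ξ i ∈ X) {z : Fin d → ℝ} (hz : z ∈ X) (u : Fin n → ℝ)
    {c : ℝ} (hc : 0 ≤ c) :
    ∫⁻ ω, (∏ i, gaussianPDF 0 v (u i - f (ξ i) ω)) *
        {x : ℝ | c * posteriorStd k v ξ z < |x|}.indicator (fun _ => 1)
          (f z ω - posteriorMean k v ξ u z) ∂P ≤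
      ENNReal.ofReal (Real.exp (-c ^ 2 / 2)) *
        ∫⁻ ω, ∏ i, gaussianPDF 0 v (u i - f (ξ i) ω) ∂P := by
  have hfm : ∀ i, Measurable (f (ξ i)) := fun i => h.gp.measurable _ (hξ i)
  have hfz := h.gp.measurable _ hz
  have hpdf := measurable_gaussianPDF 0 v
  have hRm : Measurable (residual k v f ε ξ z) :=
    measurable_of_mem_span h.measurable_signalNoise (residual_mem_span k v f ε hξ hz)
  set L : Ω → ℝ≥0∞ := fun ω => ∏ i, gaussianPDF 0 v (u i - f (ξ i) ω) with hL
  have hLm : Measurable L := by fun_prop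
  have hLfin : ∫⁻ ω, L ω ∂P ≠ ∞ := by
    refine ne_top_of_le_ne_top (b := ∏ _i : Fin n, ENNReal.ofReal (√(2 * Real.pi * v))⁻¹)
      (ENNReal.prod_lt_top fun i _ => ENNReal.ofReal_lt_top).ne ?_
    calc ∫⁻ ω, L ω ∂P ≤ ∫⁻ _, ∏ _i : Fin n, ENNReal.ofReal (√(2 * Real.pi * v))⁻¹ ∂P :=
          lintegral_mono fun ω => Finset.prod_le_prod' fun i _ =>
            ENNReal.ofReal_le_ofReal (gaussianPDFReal_le _ _)
      _ = _ := by simp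
  have hHm : Measurable fun ω => f z ω - posteriorMean k v ξ u z := by fun_prop
  have hfinite : IsFiniteMeasure ((P.withDensity L).map fun ω => f z ω - posteriorMean k v ξ u z) := by
    have := isFiniteMeasure_withDensity hLfin
    infer_instance
  have hlaw : (P.withDensity L).map (fun ω => f z ω - posteriorMean k v ξ u z) =
      (∫⁻ ω, L ω ∂P) • gaussianReal 0 (posteriorVar k v ξ z).toNNReal := by
    refine ext_of_forall_lintegral_eq_of_IsFiniteMeasure fun g => ?_
    have hgm := g.continuous.measurable
    rw [lintegral_map (by fun_prop) hHm, lintegral_withDensity_eq_lintegral_mul _ hLm (by fun_prop),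
      lintegral_smul_measure, ← h.map_residual hv hξ hz, lintegral_map (by fun_prop) hRm,
      smul_eq_mul, mul_comm (∫⁻ ω, L ω ∂P)]
    exact h.lintegral_likelihood_eq hv hξ hz u g
  have hS : MeasurableSet {x : ℝ | c * posteriorStd k v ξ z < |x|} :=
    measurableSet_lt (by fun_prop) (by fun_prop)
  have hind : Measurable ({x : ℝ | c * posteriorStd k v ξ z < |x|}.indicator
    fun _ => (1 : ℝ≥0∞)) := measurable_one.indicator hS
  calc ∫⁻ ω, L ω * {x : ℝ | c * posteriorStd k v ξ z < |x|}.indicator (fun _ => 1)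
          (f z ω - posteriorMean k v ξ u z) ∂P
      = ((P.withDensity L).map (fun ω => f z ω - posteriorMean k v ξ u z))
          {x : ℝ | c * posteriorStd k v ξ z < |x|} := by
        rw [← lintegral_indicator_one hS, lintegral_map (measurable_one.indicator hS) hHm]
        exact (lintegral_withDensity_eq_lintegral_mul _ hLm (hind.comp hHm)).symm
    _ = (∫⁻ ω, L ω ∂P) * gaussianReal 0 (posteriorVar k v ξ z).toNNReal
          {x : ℝ | c * posteriorStd k v ξ z < |x|} := by
        rw [hlaw]; rfl
    _ ≤ (∫⁻ ω, L ω ∂P) * ENNReal.ofReal (Real.exp (-c ^ 2 / 2)) := by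
        gcongr
        exact gaussianReal_abs_gt_mul_sqrt_le hc (h.posteriorVar_nonneg hv hξ hz)
    _ = _ := mul_comm _ _

end Bayes

/-! ### Measurability of the posterior -/

section Measurability

variable {α : Type*} [MeasurableSpace α] {d n : ℕ}

lemma measurable_det {A : α → Matrix (Fin n) (Fin n) ℝ}
    (hA : ∀ i j, Measurable fun a => A a i j) : Measurable fun a => (A a).det := by
  simp only [Matrix.det_apply]
  fun_prop

lemma measurable_matrix_inv_apply {A : α → Matrix (Fin n) (Fin n) ℝ}
    (hA : ∀ i j, Measurable fun a => A a i j) (i j : Fin n) : Measurable fun a => (A a)⁻¹ i j := by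
  simp only [Matrix.inv_def, Ring.inverse_eq_inv', Matrix.smul_apply, smul_eq_mul,
    Matrix.adjugate_apply]
  refine (measurable_det hA).inv.mul (measurable_det fun i' j' => ?_)
  simp only [Matrix.updateRow_apply]
  split_ifs
  · exact measurable_const
  · exact hA i' j'

variable {k : (Fin d → ℝ) → (Fin d → ℝ) → ℝ} {v : ℝ} {ξ : α → Fin n → Fin d → ℝ}
  {z : α → Fin d → ℝ}

lemma measurable_regGram_inv_apply (h1 : ∀ i j, Measurable fun a => k (ξ a i) (ξ a j))
    (i j : Fin n) : Measurable fun a => (regGram k v (ξ a))⁻¹ i j := by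
  refine measurable_matrix_inv_apply (fun i j => ?_) i j
  simp only [regGram, Matrix.add_apply, Matrix.of_apply]
  exact (h1 i j).add_const _

lemma measurable_posteriorMean (h1 : ∀ i j, Measurable fun a => k (ξ a i) (ξ a j))
    (h2 : ∀ i, Measurable fun a => k (z a) (ξ a i)) {u : α → Fin n → ℝ} (hu : Measurable u) :
    Measurable fun a => posteriorMean k v (ξ a) (u a) (z a) := by
  have hinv := fun i j => measurable_regGram_inv_apply (v := v) h1 i j
  simp only [posteriorMean, dotProduct, Matrix.mulVec, kernelVec]
  exact Finset.measurable_sum _ fun i _ => (h2 i).mul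
    (Finset.measurable_sum _ fun j _ => (hinv i j).mul ((measurable_pi_apply j).comp hu))

lemma measurable_posteriorStd (h1 : ∀ i j, Measurable fun a => k (ξ a i) (ξ a j))
    (h2 : ∀ i, Measurable fun a => k (z a) (ξ a i)) (h3 : Measurable fun a => k (z a) (z a)) :
    Measurable fun a => posteriorStd k v (ξ a) (z a) := by
  have hinv := fun i j => measurable_regGram_inv_apply (v := v) h1 i j
  simp only [posteriorStd, posteriorVar, dotProduct, Matrix.mulVec, kernelVec]
  exact (h3.sub (Finset.measurable_sum _ fun i _ => (h2 i).mul
    (Finset.measurable_sum _ fun j _ => (hinv i j).mul (h2 j)))).sqrt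

end Measurability

/-! ### Evaluation of continuous paths at random points -/

section Eval

variable {d : ℕ}

/-- The value at `x` of a continuous function with values `p m` at the points `e m` of a dense
sequence: the limit of its values at the points of the sequence that are nearest to `x`. -/
noncomputable def evalPath (e : ℕ → Fin d → ℝ) (a : (ℕ → ℝ) × (Fin d → ℝ)) : ℝ :=
  Filter.limsup (fun N => a.1 (SimpleFunc.nearestPtInd e N a.2)) Filter.atTop

lemma measurable_evalPath (e : ℕ → Fin d → ℝ) : Measurable (evalPath e) := by
  refine Measurable.limsup fun N => ?_
  have h1 : Measurable fun b : (ℕ → ℝ) × ℕ => b.1 b.2 :=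
    measurable_from_prod_countable_left fun m => measurable_pi_apply m
  exact h1.comp (measurable_fst.prodMk ((SimpleFunc.nearestPtInd e N).measurable.comp measurable_snd))

lemma evalPath_eq {X : Set (Fin d → ℝ)} {e : ℕ → Fin d → ℝ} (he : ∀ m, e m ∈ X)
    (hdense : ∀ x ∈ X, x ∈ closure (Set.range e)) {φ : (Fin d → ℝ) → ℝ} (hφ : ContinuousOn φ X)
    {x : Fin d → ℝ} (hx : x ∈ X) : evalPath e (fun m => φ (e m), x) = φ x := by
  have h1 := SimpleFunc.tendsto_nearestPt (hdense x hx)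
  have h2 : Filter.Tendsto (fun N => φ (SimpleFunc.nearestPt e N x)) Filter.atTop (nhds (φ x)) :=
    (hφ x hx).tendsto.comp (tendsto_nhdsWithin_iff.2 ⟨h1, .of_forall fun N => he _⟩)
  exact h2.limsup_eq

variable {Ω : Type*} {𝒢 : MeasurableSpace Ω} [mΩ : MeasurableSpace Ω] {P : Measure Ω}
  [IsProbabilityMeasure P] {X : Set (Fin d → ℝ)} {k : (Fin d → ℝ) → (Fin d → ℝ) → ℝ} {v : ℝ≥0}
  {f : (Fin d → ℝ) → Ω → ℝ} {ε : ℕ → Ω → ℝ}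

/-- Almost surely continuous paths can be evaluated at random points in a measurable way, through
countably many of their values. -/
lemma IsBayesModel.exists_measurable_eval (h : IsBayesModel 𝒢 P X k v f ε)
    (hne : X.Nonempty) (hcont : ∀ᵐ ω ∂P, ContinuousOn (fun z => f z ω) X) :
    ∃ (p : Ω → ℕ → ℝ) (ev : (ℕ → ℝ) × (Fin d → ℝ) → ℝ), Measurable p ∧
      MeasurableSpace.comap p inferInstance ≤ sigmaF X f ∧ Measurable ev ∧
      ∀ᵐ ω ∂P, ∀ z ∈ X, ev (p ω, z) = f z ω := by
  have := hne.to_subtype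
  let e : ℕ → Fin d → ℝ := fun m => (TopologicalSpace.denseSeq X m : X)
  have heX : ∀ m, e m ∈ X := fun m => (TopologicalSpace.denseSeq X m).2
  have hdense : ∀ x ∈ X, x ∈ closure (Set.range e) := by
    intro x hx
    have h1 := TopologicalSpace.denseRange_denseSeq X ⟨x, hx⟩
    have h2 := image_closure_subset_closure_image continuous_subtype_val
      (Set.mem_image_of_mem Subtype.val h1)
    rw [← Set.range_comp] at h2
    exact h2
  refine ⟨fun ω m => f (e m) ω, evalPath e, measurable_pi_lambda _ fun m => h.gp.measurable _ (heX m),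
    ?_, measurable_evalPath e, ?_⟩
  · rw [comap_pi_eq_iSup]
    exact iSup_le fun m => le_iSup (fun x : X => MeasurableSpace.comap (f x) inferInstance)
      ⟨e m, heX m⟩
  · filter_upwards [hcont] with ω hω z hz
    exact evalPath_eq heX hdense hω hz

/-- The kernel of a Gaussian process with almost surely continuous paths is measurable. -/
lemma IsBayesModel.exists_measurable_kernel (h : IsBayesModel 𝒢 P X k v f ε)
    {p : Ω → ℕ → ℝ} {ev : (ℕ → ℝ) × (Fin d → ℝ) → ℝ} (hp : Measurable p) (hevm : Measurable ev)
    (hev : ∀ᵐ ω ∂P, ∀ z ∈ X, ev (p ω, z) = f z ω) :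
    ∃ k' : (Fin d → ℝ) × (Fin d → ℝ) → ℝ, Measurable k' ∧
      ∀ a ∈ X, ∀ b ∈ X, k a b = k' (a, b) := by
  refine ⟨fun a => ∫ ω, ev (p ω, a.1) * ev (p ω, a.2) ∂P, ?_, fun a ha b hb => ?_⟩
  · have h1 : Measurable fun q : ((Fin d → ℝ) × (Fin d → ℝ)) × Ω =>
        ev (p q.2, q.1.1) * ev (p q.2, q.1.2) :=
      (hevm.comp ((hp.comp measurable_snd).prodMk measurable_fst.fst)).mul
        (hevm.comp ((hp.comp measurable_snd).prodMk measurable_fst.snd))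
    exact (StronglyMeasurable.integral_prod_right' (ν := P) h1.stronglyMeasurable).measurable
  · have hma := h.memLp_of_mem_span (signal_mem_span f ε ha)
    have hmb := h.memLp_of_mem_span (signal_mem_span f ε hb)
    rw [← h.gp.cov_eq a ha b hb, covariance_eq_sub hma hmb, h.gp.mean_zero a ha, zero_mul, sub_zero]
    refine integral_congr_ae ?_
    filter_upwards [hev] with ω hω
    rw [Pi.mul_apply, hω a ha, hω b hb]

end Eval

/-! ### The posterior under adaptive queries -/

section Adaptive

variable {d : ℕ} {Ω Γ : Type*} [mΓ : MeasurableSpace Γ] [mΩ : MeasurableSpace Ω]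
  {P : Measure Ω} [IsProbabilityMeasure P] {X : Set (Fin d → ℝ)}
  {k : (Fin d → ℝ) → (Fin d → ℝ) → ℝ} {v : ℝ≥0} {f : (Fin d → ℝ) → Ω → ℝ} {ε : ℕ → Ω → ℝ}

/-- The history is generated by the internal randomness and the observations alone: the queries are
functions of these. -/
lemma history_le_comap {g : Ω → Γ} {x : ℕ → Ω → Fin d → ℝ} {y : ℕ → Ω → ℝ}
    (hx : ∀ t, Measurable[history (mΓ.comap g) x y t] (x t)) (t : ℕ) :
    history (mΓ.comap g) x y t ≤
      MeasurableSpace.comap (fun ω => (g ω, fun i : Fin t => y i ω)) inferInstance := by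
  induction t using Nat.strong_induction_on with
  | _ t ih =>
    refine sup_le ?_ (iSup_le fun i => sup_le ?_ ?_)
    · exact Measurable.comap_le (m₁ := MeasurableSpace.comap _ _)
        (measurable_fst.comp (comap_measurable (fun ω => (g ω, fun i : Fin t => y i ω))))
    · refine ((hx i).comap_le.trans (ih i i.2)).trans ?_
      refine Measurable.comap_le (m₁ := MeasurableSpace.comap _ _) ?_
      have h1 : Measurable fun a : Γ × (Fin t → ℝ) => (a.1, fun j : Fin i => a.2 (j.castLE i.2.le)) := by
        fun_prop
      exact h1.comp (comap_measurable (fun ω => (g ω, fun i : Fin t => y i ω)))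
    · have h1 : Measurable fun a : Γ × (Fin t → ℝ) => a.2 i := by fun_prop
      exact Measurable.comap_le (m₁ := MeasurableSpace.comap _ _)
        (h1.comp (comap_measurable (fun ω => (g ω, fun i : Fin t => y i ω))))

/-- A point of `X` that is determined by the history is a measurable function of the internal
randomness and the observations. -/
lemma exists_measurable_factor {g : Ω → Γ} {x : ℕ → Ω → Fin d → ℝ} {y : ℕ → Ω → ℝ}
    (hx : ∀ t, Measurable[history (mΓ.comap g) x y t] (x t)) (hX : MeasurableSet X)
    {t : ℕ} {ζ : Ω → Fin d → ℝ} (hζ : Measurable[history (mΓ.comap g) x y t] ζ)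
    (hζX : ∀ ω, ζ ω ∈ X) {x₀ : Fin d → ℝ} (hx₀ : x₀ ∈ X) :
    ∃ Ξ : Γ × (Fin t → ℝ) → Fin d → ℝ, Measurable Ξ ∧ (∀ a, Ξ a ∈ X) ∧
      ∀ ω, ζ ω = Ξ (g ω, fun i : Fin t => y i ω) := by
  classical
  obtain ⟨Ξ, hΞ, heq⟩ := Measurable.exists_eq_measurable_comp
    (f := fun ω => (g ω, fun i : Fin t => y i ω)) (hζ.mono (history_le_comap hx t) le_rfl)
  refine ⟨fun a => if Ξ a ∈ X then Ξ a else x₀, hΞ.ite (hΞ hX) measurable_const, fun a => ?_,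
    fun ω => ?_⟩
  · by_cases ha : Ξ a ∈ X
    · simp only [ha, if_true]
    · simp only [ha, if_false]; exact hx₀
  · have h1 : ζ ω = Ξ (g ω, fun i : Fin t => y i ω) := congrFun heq ω
    have h2 : Ξ (g ω, fun i : Fin t => y i ω) ∈ X := h1 ▸ hζX ω
    simp only [h2, if_true]
    exact h1

/-- Under adaptive queries, the deviation of `f` from its posterior mean at a point that is
determined by the history has the Gaussian tail given by the posterior standard deviation: given
the internal randomness and the data, the density of the data is the likelihood of a fixed
design, so that Bayes' rule for a fixed design applies. -/
theorem IsBayesModel.measure_deviation_le {g : Ω → Γ}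
    (h : IsBayesModel (mΓ.comap g) P X k v f ε) (hv : 0 < v) (hX : MeasurableSet X)
    (hcont : ∀ᵐ ω ∂P, ContinuousOn (fun z => f z ω) X)
    {x : ℕ → Ω → Fin d → ℝ} {y : ℕ → Ω → ℝ} (hxX : ∀ t ω, x t ω ∈ X)
    (hx : ∀ t, Measurable[history (mΓ.comap g) x y t] (x t))
    (hobs : ∀ t ω, y t ω = f (x t ω) ω + ε t ω) (hy : ∀ t, Measurable (y t))
    {t : ℕ} {ζ : Ω → Fin d → ℝ} (hζ : Measurable[history (mΓ.comap g) x y t] ζ)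
    (hζX : ∀ ω, ζ ω ∈ X) {c : ℝ} (hc : 0 ≤ c) :
    P {ω | c * runStd k v x t ω (ζ ω) < |f (ζ ω) ω - runMean k v x y t ω (ζ ω)|} ≤
      ENNReal.ofReal (Real.exp (-c ^ 2 / 2)) := by
  classical
  have hΩ : Nonempty Ω := by
    by_contra hne
    rw [not_nonempty_iff] at hne
    have := measure_univ (μ := P)
    rw [Set.univ_eq_empty_iff.2 hne, measure_empty] at this
    exact zero_ne_one this
  obtain ⟨ω₀⟩ := hΩ
  have hx₀ : x 0 ω₀ ∈ X := hxX 0 ω₀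
  set x₀ := x 0 ω₀
  obtain ⟨p, ev, hpm, hpF, hevm, hev⟩ := h.exists_measurable_eval ⟨x₀, hx₀⟩ hcont
  obtain ⟨k', hk'm, hk'⟩ := h.exists_measurable_kernel hpm hevm hev
  -- The queries as functions of internal randomness and observations.
  have hfac := fun t => exists_measurable_factor hx hX (hx t) (hxX t) hx₀
  choose Ξ hΞm hΞX hΞ using hfac
  obtain ⟨Z, hZm, hZX, hZ⟩ := exists_measurable_factor hx hX hζ hζX hx₀
  have hgm : Measurable g := measurable_iff_comap_le.2 h.internal_le
  let W : Ω → Γ × (ℕ → ℝ) := fun ω => (g ω, p ω)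
  have hWm : Measurable W := hgm.prodMk hpm
  have hεm : Measurable fun ω t => ε t ω := measurable_pi_lambda _ h.noise_measurable
  have hεF : MeasurableSpace.comap (fun ω t => ε t ω) inferInstance = sigmaNoise ε :=
    comap_pi_eq_iSup ε
  have hpε : IndepFun p (fun ω t => ε t ω) P := by
    rw [IndepFun_iff_Indep, hεF]
    exact indep_of_indep_of_le_left h.f_indep_noise hpF
  have hgpε : IndepFun g (fun ω => (p ω, fun t => ε t ω)) P := by
    rw [IndepFun_iff_Indep]
    refine indep_of_indep_of_le_right h.internal_indep ?_
    exact (Measurable.prodMk (m := sigmaF X f ⊔ sigmaNoise ε) (f := p) (g := fun ω t => ε t ω)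
      (measurable_iff_comap_le.2 (hpF.trans le_sup_left))
      (measurable_iff_comap_le.2 (hεF.le.trans le_sup_right))).comap_le
  have hWε : IndepFun W (fun ω t => ε t ω) P := indepFun_prodMk_of_indepFun hgm hpm hεm hgpε hpε
  have hgp : IndepFun g p P := hgpε.comp measurable_id measurable_fst
  let s : (t : ℕ) → (Fin t → ℝ) × (Γ × (ℕ → ℝ)) → ℝ := fun t a =>
    ev (a.2.2, Ξ t (a.2.1, a.1))
  have hs : ∀ t, Measurable (s t) := fun t => by
    have := hΞm t
    fun_prop
  have hrec : ∀ t, ∀ᵐ ω ∂P, y t ω = ε t ω + s t (fun i : Fin t => y i ω, W ω) := by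
    intro t
    filter_upwards [hev] with ω hω
    rw [hobs, hΞ t ω, ← hω _ (hΞX t _), add_comm]
  have hv0 : v ≠ 0 := hv.ne'
  have hlint := fun {Ψ : (Fin t → ℝ) × (Γ × (ℕ → ℝ)) → ℝ≥0∞} (hΨ : Measurable Ψ) =>
    lintegral_recursion (P := P) hWm h.noise_measurable h.noise_indep hWε
      (fun _ => measurable_gaussianPDF 0 v)
      (fun t => by rw [h.noise_law t, gaussianReal_of_var_ne_zero _ hv0]) hs hy hrec t hΨ
  have hLm := measurable_recDensity (fun _ => measurable_gaussianPDF 0 v) hs t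
  set L := recDensity (fun _ => gaussianPDF 0 v) s t with hL
  -- The exceptional event as a set of data and parameters.
  let ξ : Γ × (Fin t → ℝ) → Fin t → Fin d → ℝ := fun a i =>
    Ξ i (a.1, fun j : Fin i => a.2 (j.castLE i.2.le))
  have hξm : ∀ i, Measurable fun a => ξ a i := fun i => by
    have := hΞm i
    fun_prop
  have hξX : ∀ a i, ξ a i ∈ X := fun a i => hΞX _ _
  have hk1 : ∀ i j, Measurable fun a => k (ξ a i) (ξ a j) := fun i j => by
    have := hξm i
    have := hξm j
    simp only [hk' _ (hξX _ _) _ (hξX _ _)]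
    fun_prop
  have hk2 : ∀ i, Measurable fun a => k (Z a) (ξ a i) := fun i => by
    have := hξm i
    simp only [hk' _ (hZX _) _ (hξX _ _)]
    fun_prop
  have hk3 : Measurable fun a => k (Z a) (Z a) := by
    simp only [hk' _ (hZX _) _ (hZX _)]
    fun_prop
  have hstdm : Measurable fun a => posteriorStd k v (ξ a) (Z a) := measurable_posteriorStd hk1 hk2 hk3
  have hmeanm : Measurable fun a => posteriorMean k v (ξ a) a.2 (Z a) :=
    measurable_posteriorMean hk1 hk2 measurable_snd
  let B : Set ((Fin t → ℝ) × (Γ × (ℕ → ℝ))) := {b |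
    c * posteriorStd k v (ξ (b.2.1, b.1)) (Z (b.2.1, b.1)) <
      |ev (b.2.2, Z (b.2.1, b.1)) -
        posteriorMean k v (ξ (b.2.1, b.1)) b.1 (Z (b.2.1, b.1))|}
  have hB : MeasurableSet B := by
    have h1 : Measurable fun b : (Fin t → ℝ) × (Γ × (ℕ → ℝ)) =>
        posteriorStd k v (ξ (b.2.1, b.1)) (Z (b.2.1, b.1)) :=
      hstdm.comp (measurable_snd.fst.prodMk measurable_fst)
    have h2 : Measurable fun b : (Fin t → ℝ) × (Γ × (ℕ → ℝ)) =>
        posteriorMean k v (ξ (b.2.1, b.1)) b.1 (Z (b.2.1, b.1)) :=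
      hmeanm.comp (measurable_snd.fst.prodMk measurable_fst)
    exact measurableSet_lt (by fun_prop) (by fun_prop)
  have hevent : ∀ᵐ ω ∂P,
      c * runStd k v x t ω (ζ ω) < |f (ζ ω) ω - runMean k v x y t ω (ζ ω)| →
        (fun i : Fin t => y i ω, W ω) ∈ B := by
    filter_upwards [hev] with ω hω hlt
    have hξω : (fun i : Fin t => x i ω) = ξ (g ω, fun i : Fin t => y i ω) :=
      funext fun i => hΞ i ω
    change c * posteriorStd k v (ξ (g ω, fun i : Fin t => y i ω)) (Z (g ω, fun i : Fin t => y i ω)) <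
      |ev (p ω, Z (g ω, fun i : Fin t => y i ω)) -
        posteriorMean k v (ξ (g ω, fun i : Fin t => y i ω)) (fun i : Fin t => y i ω)
          (Z (g ω, fun i : Fin t => y i ω))|
    rw [hω _ (hZX _), ← hξω, ← hZ ω]
    exact hlt
  -- For given internal randomness and data, the design is fixed.
  have hfix : ∀ (γ : Γ) (u : Fin t → ℝ),
      ∫⁻ ω, L (u, (γ, p ω)) * B.indicator (fun _ => (1 : ℝ≥0∞)) (u, (γ, p ω)) ∂P ≤
        ENNReal.ofReal (Real.exp (-c ^ 2 / 2)) * ∫⁻ ω, L (u, (γ, p ω)) ∂P := by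
    intro γ u
    have hLae : ∀ᵐ ω ∂P, L (u, (γ, p ω)) = ∏ i, gaussianPDF 0 v (u i - f (ξ (γ, u) i) ω) := by
      filter_upwards [hev] with ω hω
      rw [hL, recDensity]
      refine Finset.prod_congr rfl fun i _ => ?_
      congr 2
      exact hω _ (hξX (γ, u) i)
    have hBae : ∀ᵐ ω ∂P, B.indicator (fun _ => (1 : ℝ≥0∞)) (u, (γ, p ω)) =
        {x : ℝ | c * posteriorStd k v (ξ (γ, u)) (Z (γ, u)) < |x|}.indicator (fun _ => 1)
          (f (Z (γ, u)) ω - posteriorMean k v (ξ (γ, u)) u (Z (γ, u))) := by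
      filter_upwards [hev] with ω hω
      rw [← hω _ (hZX (γ, u))]
      rfl
    have h1 : ∫⁻ ω, L (u, (γ, p ω)) * B.indicator (fun _ => (1 : ℝ≥0∞)) (u, (γ, p ω)) ∂P =
        ∫⁻ ω, (∏ i, gaussianPDF 0 v (u i - f (ξ (γ, u) i) ω)) *
          {x : ℝ | c * posteriorStd k v (ξ (γ, u)) (Z (γ, u)) < |x|}.indicator (fun _ => 1)
            (f (Z (γ, u)) ω - posteriorMean k v (ξ (γ, u)) u (Z (γ, u))) ∂P := by
      refine lintegral_congr_ae ?_
      filter_upwards [hLae, hBae] with ω h1 h2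
      rw [h1, h2]
    rw [h1, lintegral_congr_ae hLae]
    exact h.lintegral_likelihood_tail_le hv (hξX (γ, u)) (hZX (γ, u)) u hc
  have hsplit : ∀ {Φ : Γ × (ℕ → ℝ) → ℝ≥0∞}, Measurable Φ →
      ∫⁻ ω, Φ (W ω) ∂P = ∫⁻ γ, ∫⁻ ω, Φ (γ, p ω) ∂P ∂(P.map g) := by
    intro Φ hΦ
    rw [← lintegral_map hΦ hWm, (indepFun_iff_map_prod_eq_prod_map_map hgm.aemeasurable
      hpm.aemeasurable).1 hgp, lintegral_prod _ hΦ.aemeasurable]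
    refine lintegral_congr fun γ => ?_
    rw [lintegral_map (by fun_prop) hpm]
  have hind : Measurable (B.indicator (fun _ => (1 : ℝ≥0∞))) := measurable_one.indicator hB
  have htotal : ∫⁻ u, ∫⁻ ω, L (u, W ω) ∂P = 1 := by
    have h1 := hlint (Ψ := fun _ => 1) measurable_const
    simp only [mul_one, lintegral_const, measure_univ] at h1
    exact h1.symm
  calc P {ω | c * runStd k v x t ω (ζ ω) < |f (ζ ω) ω - runMean k v x y t ω (ζ ω)|}
      ≤ P {ω | (fun i : Fin t => y i ω, W ω) ∈ B} := measure_mono_ae hevent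
    _ = ∫⁻ ω, B.indicator (fun _ => (1 : ℝ≥0∞)) (fun i : Fin t => y i ω, W ω) ∂P := by
        have hm : MeasurableSet {ω | (fun i : Fin t => y i ω, W ω) ∈ B} :=
          (Measurable.prodMk (f := fun ω (i : Fin t) => y i ω)
            (measurable_pi_lambda _ fun i => hy i) hWm) hB
        rw [← lintegral_indicator_one hm]
        rfl
    _ = ∫⁻ u, ∫⁻ γ, ∫⁻ ω, L (u, (γ, p ω)) * B.indicator (fun _ => (1 : ℝ≥0∞)) (u, (γ, p ω)) ∂P ∂(P.map g) := by
        rw [hlint hind]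
        refine lintegral_congr fun u => ?_
        exact hsplit (Φ := fun w => L (u, w) * B.indicator (fun _ => (1 : ℝ≥0∞)) (u, w)) (by fun_prop)
    _ ≤ ∫⁻ u, ∫⁻ γ, ENNReal.ofReal (Real.exp (-c ^ 2 / 2)) *
          ∫⁻ ω, L (u, (γ, p ω)) ∂P ∂(P.map g) :=
        lintegral_mono fun u => lintegral_mono fun γ => hfix γ u
    _ = ENNReal.ofReal (Real.exp (-c ^ 2 / 2)) * ∫⁻ u, ∫⁻ ω, L (u, W ω) ∂P := by
        rw [← lintegral_const_mul' _ _ ENNReal.ofReal_ne_top]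
        refine lintegral_congr fun u => ?_
        rw [lintegral_const_mul' _ _ ENNReal.ofReal_ne_top,
          hsplit (Φ := fun w => L (u, w)) (by fun_prop)]
    _ = _ := by rw [htotal, mul_one]

end Adaptive

/-! ### The function `τ` -/

lemma integrable_id_gaussianReal : Integrable (fun x : ℝ => x) (gaussianReal 0 1) :=
  (memLp_id_gaussianReal 1).integrable le_rfl

lemma hasDerivAt_neg_gaussianPDFReal (x : ℝ) :
    HasDerivAt (fun x => -gaussianPDFReal 0 1 x) (gaussianPDFReal 0 1 x * x) x := by
  have h1 : HasDerivAt (fun x : ℝ => -(x ^ 2) / 2) (-x) x := by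
    refine ((hasDerivAt_pow 2 x).neg.div_const 2).congr_deriv ?_
    norm_num
    ring
  have heq : (fun x => -gaussianPDFReal 0 1 x) =
      fun x : ℝ => -((√(2 * Real.pi))⁻¹ * Real.exp (-(x ^ 2) / 2)) := by
    funext x
    simp [gaussianPDFReal]
  rw [heq]
  refine (h1.exp.const_mul (√(2 * Real.pi))⁻¹).neg.congr_deriv ?_
  simp [gaussianPDFReal]
  ring

lemma tendsto_neg_gaussianPDFReal_atBot :
    Filter.Tendsto (fun x => -gaussianPDFReal 0 1 x) Filter.atBot (nhds 0) := by
  have h1 : Filter.Tendsto (fun x : ℝ => x ^ 2 / 2) Filter.atBot Filter.atTop :=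
    (Filter.tendsto_pow_atTop two_ne_zero).comp Filter.tendsto_neg_atBot_atTop |>.congr (by simp)
      |>.atTop_div_const two_pos
  have h2 := ((Real.tendsto_exp_neg_atTop_nhds_zero.comp h1).const_mul (√(2 * Real.pi))⁻¹).neg
  rw [mul_zero, neg_zero] at h2
  refine h2.congr fun x => ?_
  simp [gaussianPDFReal, neg_div]

lemma setIntegral_Iic_id_gaussianReal (c : ℝ) :
    ∫ x in Set.Iic c, x ∂(gaussianReal 0 1) = -gaussianPDFReal 0 1 c := by
  have hint : Integrable fun x => gaussianPDFReal 0 1 x * x := by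
    have h := integrable_id_gaussianReal
    rw [gaussianReal_of_var_ne_zero _ one_ne_zero, integrable_withDensity_iff_integrable_smul₀'
      (by fun_prop)
      (.of_forall fun _ => gaussianPDF_lt_top)] at h
    simpa [toReal_gaussianPDF] using h
  have h1 := integral_Iic_of_hasDerivAt_of_tendsto' (a := c) (m := 0)
    (fun x _ => hasDerivAt_neg_gaussianPDFReal x) hint.integrableOn tendsto_neg_gaussianPDFReal_atBot
  rw [sub_zero] at h1
  rw [← h1, ← integral_indicator measurableSet_Iic, integral_gaussianReal_eq_integral_smul one_ne_zero,
    ← integral_indicator measurableSet_Iic]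
  refine integral_congr_ae (.of_forall fun x => ?_)
  by_cases hx : x ∈ Set.Iic c <;> simp [hx]

/-- `τ(c)` is the expected improvement `E max(c - Z, 0)` of a standard Gaussian variable `Z`. -/
lemma tau_eq_integral (c : ℝ) : tau c = ∫ x, max (c - x) 0 ∂(gaussianReal 0 1) := by
  have h1 : ∀ x : ℝ, max (c - x) 0 = (Set.Iic c).indicator (fun x => c - x) x := by
    intro x
    by_cases hx : x ≤ c
    · rw [Set.indicator_of_mem (show x ∈ Set.Iic c from hx), max_eq_left (sub_nonneg.2 hx)]
    · rw [Set.indicator_of_notMem (show x ∉ Set.Iic c from hx), max_eq_right (by linarith)]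
  simp only [h1]
  rw [integral_indicator measurableSet_Iic, integral_sub (integrable_const c).integrableOn
    integrable_id_gaussianReal.integrableOn, setIntegral_Iic_id_gaussianReal, setIntegral_const,
    tau, cdf_eq_real, smul_eq_mul]
  ring

lemma integrable_max_sub (c : ℝ) : Integrable (fun x : ℝ => max (c - x) 0) (gaussianReal 0 1) :=
  ((integrable_const c).sub integrable_id_gaussianReal).sup (integrable_zero _ _ _)

lemma tau_mono : Monotone tau := by
  intro a b hab
  rw [tau_eq_integral, tau_eq_integral]
  refine integral_mono (integrable_max_sub a) (integrable_max_sub b) fun x => ?_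
  exact max_le_max (by linarith) le_rfl

/-- With monotonicity, this says that `τ` is `1`-Lipschitz. -/
lemma tau_sub_le (c : ℝ) {η : ℝ} (hη : 0 ≤ η) : tau c - η ≤ tau (c - η) := by
  rw [tau_eq_integral, tau_eq_integral, sub_le_iff_le_add]
  have h1 : ∫ x, (max (c - η - x) 0 + η) ∂(gaussianReal 0 1) =
      ∫ x, max (c - η - x) 0 ∂(gaussianReal 0 1) + η := by
    rw [integral_add (integrable_max_sub _) (integrable_const _)]
    simp
  rw [← h1]
  refine integral_mono (integrable_max_sub c) ((integrable_max_sub _).add (integrable_const _))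
    fun x => max_le ?_ ?_
  · linarith [le_max_left (c - η - x) 0]
  · linarith [le_max_right (c - η - x) 0]

lemma tau_pos (c : ℝ) : 0 < tau c := by
  have h1 : 0 < (gaussianReal 0 1).real (Set.Iic (c - 1)) := by
    rw [measureReal_def, ENNReal.toReal_pos_iff]
    refine ⟨pos_iff_ne_zero.2 fun h0 => ?_, measure_lt_top _ _⟩
    have := gaussianReal_absolutelyContinuous' 0 one_ne_zero h0
    simp at this
  refine h1.trans_le ?_
  rw [tau_eq_integral, ← integral_indicator_one measurableSet_Iic]
  refine integral_mono ((integrable_const (1 : ℝ)).indicator measurableSet_Iic)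
    (integrable_max_sub c) fun x => ?_
  by_cases hx : x ∈ Set.Iic (c - 1)
  · have hx' : x ≤ c - 1 := hx
    simp only [Set.indicator_of_mem hx]
    exact le_max_of_le_left (by simp only [Pi.one_apply]; linarith)
  · simp only [Set.indicator_of_notMem hx]
    exact le_max_right _ _

lemma tau_zero : tau 0 = gaussianPDFReal 0 1 0 := by simp [tau]

lemma tau_neg_le {u : ℝ} (hu : 0 ≤ u) : tau (-u) ≤ tau 0 * Real.exp (-u ^ 2 / 2) := by
  have h1 : 0 ≤ u * cdf (gaussianReal 0 1) (-u) := mul_nonneg hu (cdf_nonneg _ _)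
  have h2 : gaussianPDFReal 0 1 (-u) = gaussianPDFReal 0 1 0 * Real.exp (-u ^ 2 / 2) := by
    simp [gaussianPDFReal]
  rw [tau_zero, ← h2, tau]
  linarith

/-! ### One step of expected improvement -/

section Step

variable {E : Type*} {X : Set E} {m s : E → ℝ} {B s₀ F : ℝ} {p q : E}

/-- One step of expected improvement, with rescaled standard deviations `B * s` and reference
`μ⁺ = sup m`. The point `q` stands for the maximizer of `f`, whose value `F` is below its upper
confidence bound. First, `F - μ⁺` is at most a multiple of the expected improvement at `q`,
hence of the one at the query `p`, which is `O(B s(p))`. Secondly, the expected improvement at `p`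
is at least that of near-maximizers of `m`, of order `B s₀`, while it is exponentially small in the
square of `(μ⁺ - m p) / (B s(p))`. -/
lemma sub_le_of_isMaxOn_expectedImprovement (hB : 0 < B) (hs₀ : 0 < s₀)
    (hs : ∀ z ∈ X, s₀ ≤ s z ∧ s z ≤ 1) (hm : BddAbove (Set.range fun z : X => m z))
    (hp : p ∈ X) (hq : q ∈ X)
    (hmax : IsMaxOn (fun z => expectedImprovement (m z) (B * s z) (⨆ z' : X, m z')) X p)
    (hF : F ≤ m q + B * s q) :
    F - m p ≤ B * s p * (tau 0 / tau (-1) + √(2 * Real.log (1 / s₀))) := by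
  set μ := ⨆ z' : X, m z' with hμ
  have hle : ∀ z ∈ X, m z ≤ μ := fun z hz => le_ciSup hm ⟨z, hz⟩
  have hspos : ∀ z ∈ X, 0 < B * s z := fun z hz => mul_pos hB (hs₀.trans_le (hs z hz).1)
  have hEI : ∀ z ∈ X, expectedImprovement (m z) (B * s z) μ =
      B * s z * tau ((m z - μ) / (B * s z)) := fun z hz => by
    rw [expectedImprovement, if_pos (hspos z hz)]
  have hmax' : ∀ z ∈ X, B * s z * tau ((m z - μ) / (B * s z)) ≤
      B * s p * tau ((m p - μ) / (B * s p)) := fun z hz => by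
    rw [← hEI z hz, ← hEI p hp]; exact hmax hz
  have hSp := hspos p hp
  have hSq := hspos q hq
  have h0 := tau_pos 0
  have h1 := tau_pos (-1)
  -- The gap between `F` and the reference.
  have hgap1 : F - μ ≤ B * s p * (tau 0 / tau (-1)) := by
    have hup : B * s p * tau ((m p - μ) / (B * s p)) ≤ B * s p * tau 0 :=
      mul_le_mul_of_nonneg_left (tau_mono (div_nonpos_of_nonpos_of_nonneg
        (sub_nonpos.2 (hle p hp)) hSp.le)) hSp.le
    rcases le_or_gt F μ with hFμ | hFμ
    · exact (sub_nonpos.2 hFμ).trans (by positivity)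
    · have hlow : B * s q * tau (-1) ≤ B * s q * tau ((m q - μ) / (B * s q)) := by
        refine mul_le_mul_of_nonneg_left (tau_mono ?_) hSq.le
        rw [le_div_iff₀ hSq]
        linarith
      have h2 : F - μ ≤ B * s q := by linarith [hle q hq]
      rw [← mul_div_assoc, le_div_iff₀ h1]
      calc (F - μ) * tau (-1) ≤ B * s q * tau (-1) := by gcongr
        _ ≤ _ := hlow.trans ((hmax' q hq).trans hup)
  -- The gap between the reference and the posterior mean at the query.
  have hgap2 : μ - m p ≤ B * s p * √(2 * Real.log (1 / s₀)) := by
    set u := (μ - m p) / (B * s p) with hu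
    have hu0 : 0 ≤ u := div_nonneg (sub_nonneg.2 (hle p hp)) hSp.le
    have hlow : B * s₀ * tau 0 ≤ B * s p * tau (-u) := by
      refine le_of_forall_pos_le_add fun η hη => ?_
      have : Nonempty X := ⟨⟨p, hp⟩⟩
      obtain ⟨⟨z, hz⟩, hzη⟩ := exists_lt_of_lt_ciSup (show μ - η < ⨆ z' : X, m z' by linarith)
      have h2 := tau_sub_le 0 (η := (μ - m z) / (B * s z))
        (div_nonneg (sub_nonneg.2 (hle z hz)) (hspos z hz).le)
      have h3 := mul_le_mul_of_nonneg_left h2 (hspos z hz).le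
      rw [mul_sub, mul_div_cancel₀ _ (hspos z hz).ne', zero_sub, ← neg_div, neg_sub] at h3
      have h4 := hmax' z hz
      have h5 : (m p - μ) / (B * s p) = -u := by rw [hu, ← neg_div, neg_sub]
      rw [h5] at h4
      have h6 : B * s₀ * tau 0 ≤ B * s z * tau 0 := by
        have := (hs z hz).1
        gcongr
      simp only at hzη
      linarith
    have h2 : B * s₀ * tau 0 ≤ B * s p * (tau 0 * Real.exp (-u ^ 2 / 2)) :=
      hlow.trans (mul_le_mul_of_nonneg_left (tau_neg_le hu0) hSp.le)
    have h3 : s₀ ≤ Real.exp (-u ^ 2 / 2) := by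
      have h4 : B * tau 0 * s₀ ≤ B * tau 0 * Real.exp (-u ^ 2 / 2) := by
        calc B * tau 0 * s₀ = B * s₀ * tau 0 := by ring
          _ ≤ B * s p * (tau 0 * Real.exp (-u ^ 2 / 2)) := h2
          _ ≤ B * 1 * (tau 0 * Real.exp (-u ^ 2 / 2)) := by
              have := (hs p hp).2
              gcongr
          _ = _ := by ring
      exact le_of_mul_le_mul_left h4 (by positivity)
    have h4 : u ^ 2 ≤ 2 * Real.log (1 / s₀) := by
      have := (Real.log_le_iff_le_exp hs₀).2 h3
      rw [one_div, Real.log_inv]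
      linarith
    have h5 : u ≤ √(2 * Real.log (1 / s₀)) := Real.le_sqrt_of_sq_le h4
    calc μ - m p = B * s p * u := by rw [hu, mul_div_cancel₀ _ hSp.ne']
      _ ≤ _ := mul_le_mul_of_nonneg_left h5 hSp.le
  rw [mul_add]
  linarith

end Step

/-! ### Boundedness of the posterior mean -/

section Bounded

variable {d n : ℕ} {Ω : Type*} {𝒢 : MeasurableSpace Ω} [mΩ : MeasurableSpace Ω]
  {P : Measure Ω} [IsProbabilityMeasure P] {X : Set (Fin d → ℝ)}
  {k : (Fin d → ℝ) → (Fin d → ℝ) → ℝ} {v : ℝ≥0} {f : (Fin d → ℝ) → Ω → ℝ} {ε : ℕ → Ω → ℝ}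

/-- The reference value of the expected improvement is a genuine supremum. -/
lemma IsBayesModel.bddAbove_posteriorMean (h : IsBayesModel 𝒢 P X k v f ε)
    (hk : ∀ z ∈ X, k z z ≤ 1) {ξ : Fin n → Fin d → ℝ} (hξ : ∀ i, ξ i ∈ X) (u : Fin n → ℝ) :
    BddAbove (Set.range fun z : X => posteriorMean k v ξ u z) := by
  refine ⟨∑ i, |((regGram k v ξ)⁻¹ *ᵥ u) i|, ?_⟩
  rintro _ ⟨z, rfl⟩
  change ∑ i, kernelVec k ξ z i * ((regGram k v ξ)⁻¹ *ᵥ u) i ≤ _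
  refine Finset.sum_le_sum fun i _ => ?_
  calc kernelVec k ξ z i * ((regGram k v ξ)⁻¹ *ᵥ u) i
      ≤ |kernelVec k ξ z i| * |((regGram k v ξ)⁻¹ *ᵥ u) i| := by
        rw [← abs_mul]; exact le_abs_self _
    _ ≤ 1 * |((regGram k v ξ)⁻¹ *ᵥ u) i| := by
        gcongr
        exact h.abs_kernel_le_one hk z.2 (hξ i)
    _ = _ := one_mul _

end Bounded

/-! ### From one-step regrets to cumulative regret -/

/-- By concavity of the logarithm, `u ≤ log (1 + u / v) / log (1 + 1 / v)` on `[0, 1]`. -/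
lemma mul_log_le_log_one_add {u v : ℝ} (hv : 0 < v) (hu0 : 0 ≤ u) (hu1 : u ≤ 1) :
    u * Real.log (1 + 1 / v) ≤ Real.log (1 + u / v) := by
  have h1 : 0 < 1 / v := by positivity
  have h2 := rpow_one_add_le_one_add_mul_self (s := 1 / v) (by linarith) hu0 hu1
  rw [← Real.log_rpow (by positivity)]
  refine Real.log_le_log (by positivity) (h2.trans_eq ?_)
  ring

/-- The constant of the regret bound, when the one-step regret is at most
`√β σ (K + √(2 log (1 / s)))` with the lower bound `s = κ v / (v + t)` of the posterior standard
deviation `σ` after `t` observations. -/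
noncomputable def regretConst (v κ K : ℝ) : ℝ :=
  (K / √(Real.log 2) + √(2 * (|Real.log ((v + 1) / (κ * v))| / Real.log 2 + 1))) *
    √(2 / Real.log (1 + 1 / v))

lemma log_two_pos : 0 < Real.log 2 := Real.log_pos one_lt_two

lemma regretConst_pos {v κ K : ℝ} (hv : 0 < v) (hK : 0 < K) : 0 < regretConst v κ K := by
  have h1 : 0 < Real.log (1 + 1 / v) := Real.log_pos (by linarith [show 0 < 1 / v by positivity])
  have h2 := log_two_pos
  rw [regretConst]
  positivity

/-- The logarithmic factor, uniformly over the steps before `T`. -/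
lemma add_sqrt_log_le {v κ K : ℝ} (hv : 0 < v) (hκ : 0 < κ) (hK : 0 ≤ K) {t T : ℕ} (ht : t < T)
    (hT : 2 ≤ T) :
    K + √(2 * Real.log (1 / (κ * v / (v + t)))) ≤
      (K / √(Real.log 2) + √(2 * (|Real.log ((v + 1) / (κ * v))| / Real.log 2 + 1))) *
        √(Real.log T) := by
  have h2 := log_two_pos
  have hT' : (2 : ℝ) ≤ T := by exact_mod_cast hT
  have hlog : Real.log 2 ≤ Real.log T := Real.log_le_log two_pos hT'
  have htT : (t : ℝ) + 1 ≤ T := by exact_mod_cast ht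
  have hA : 0 < (v + 1) / (κ * v) := by positivity
  rw [add_mul]
  refine add_le_add ?_ ?_
  · rw [div_mul_eq_mul_div, le_div_iff₀ (Real.sqrt_pos.2 h2)]
    exact mul_le_mul_of_nonneg_left (Real.sqrt_le_sqrt hlog) hK
  · rw [← Real.sqrt_mul (by positivity)]
    refine Real.sqrt_le_sqrt ?_
    have h1 : 1 / (κ * v / (v + t)) ≤ (v + 1) / (κ * v) * T := by
      rw [one_div_div, div_mul_eq_mul_div]
      gcongr
      have : (0 : ℝ) ≤ t := t.cast_nonneg
      nlinarith
    have h3 : Real.log (1 / (κ * v / (v + t))) ≤ Real.log ((v + 1) / (κ * v)) + Real.log T := by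
      rw [← Real.log_mul hA.ne' (by positivity)]
      exact Real.log_le_log (by positivity) h1
    have h4 : |Real.log ((v + 1) / (κ * v))| ≤
        |Real.log ((v + 1) / (κ * v))| / Real.log 2 * Real.log T := by
      rw [div_mul_eq_mul_div, le_div_iff₀ h2]
      exact mul_le_mul_of_nonneg_left hlog (abs_nonneg _)
    have h5 := le_abs_self (Real.log ((v + 1) / (κ * v)))
    linarith

section Path

variable {d : ℕ} {Ω : Type*} {𝒢 : MeasurableSpace Ω} [mΩ : MeasurableSpace Ω]
  {P : Measure Ω} [IsProbabilityMeasure P] {X : Set (Fin d → ℝ)}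
  {k : (Fin d → ℝ) → (Fin d → ℝ) → ℝ} {v : ℝ≥0} {f : (Fin d → ℝ) → Ω → ℝ} {ε : ℕ → Ω → ℝ}
  {κ : ℝ}

/-- The posterior variances along any sequence of queries are summable at the scale of the maximum
information gain. -/
lemma IsBayesModel.sum_posteriorStd_sq_le (h : IsBayesModel 𝒢 P X k v f ε) (hv : 0 < v)
    (hk : ∀ z ∈ X, k z z ≤ 1) {ξ : ℕ → Fin d → ℝ} (hξ : ∀ i, ξ i ∈ X) (T : ℕ) :
    ∑ t ∈ Finset.range T, posteriorStd k v (fun i : Fin t => ξ i) (ξ t) ^ 2 ≤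
      2 / Real.log (1 + 1 / (v : ℝ)) * (maxInfoGain P X f ε T).toReal := by
  have hv' : (0 : ℝ) < v := hv
  have hlog : 0 < Real.log (1 + 1 / (v : ℝ)) :=
    Real.log_pos (by linarith [show 0 < 1 / (v : ℝ) by positivity])
  have h1 := h.sum_log_le_maxInfoGain hv hk hξ T
  rw [Fin.sum_univ_eq_sum_range (fun t => Real.log (1 + seqVar k v ξ t / v) / 2) T] at h1
  rw [div_mul_eq_mul_div, le_div_iff₀ hlog, Finset.sum_mul]
  calc ∑ t ∈ Finset.range T, posteriorStd k v (fun i : Fin t => ξ i) (ξ t) ^ 2 *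
        Real.log (1 + 1 / (v : ℝ))
      ≤ ∑ t ∈ Finset.range T, 2 * (Real.log (1 + seqVar k v ξ t / v) / 2) := by
        refine Finset.sum_le_sum fun t _ => ?_
        have h2 := h.posteriorStd_le_one hv hk (ξ := fun i : Fin t => ξ i) (fun i => hξ i) (hξ t)
        have h3 : 0 ≤ posteriorStd k v (fun i : Fin t => ξ i) (ξ t) := Real.sqrt_nonneg _
        rw [seqVar, ← h.posteriorStd_sq hv (fun i => hξ i) (hξ t), mul_div_cancel₀ _ two_ne_zero]
        exact mul_log_le_log_one_add hv' (sq_nonneg _) (pow_le_one₀ h3 h2)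
    _ ≤ _ := by
        rw [← Finset.mul_sum]
        exact mul_le_mul_of_nonneg_left h1 two_pos.le

/-- Cumulative regret from one-step regrets, by the Cauchy–Schwarz inequality and the bound for the
sum of the posterior variances. -/
lemma IsBayesModel.sum_regret_le (h : IsBayesModel 𝒢 P X k v f ε) (hv : 0 < v) (hκ : 0 < κ)
    (hk : ∀ z ∈ X, k z z ≤ 1) {ξ : ℕ → Fin d → ℝ} (hξ : ∀ i, ξ i ∈ X) {β r : ℕ → ℝ} {K : ℝ}
    (hK : 0 ≤ K) (hβ0 : ∀ t, 1 ≤ t → 0 ≤ β t) (hβ : ∀ s t, 1 ≤ s → s ≤ t → β s ≤ β t)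
    (hr : ∀ t, r t ≤ √(β (t + 1)) * posteriorStd k v (fun i : Fin t => ξ i) (ξ t) *
      (K + √(2 * Real.log (1 / (κ * v / (v + t)))))) {T : ℕ} (hT : 2 ≤ T) :
    ∑ t ∈ Finset.range T, r t ≤
      regretConst v κ K * √(β T * (maxInfoGain P X f ε T).toReal * T * Real.log T) := by
  have hv' : (0 : ℝ) < v := hv
  set σ : ℕ → ℝ := fun t => posteriorStd k v (fun i : Fin t => ξ i) (ξ t) with hσ
  have hσ0 : ∀ t, 0 ≤ σ t := fun t => Real.sqrt_nonneg _
  set D := K / √(Real.log 2) + √(2 * (|Real.log ((v + 1) / (κ * v))| / Real.log 2 + 1)) with hD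
  have hD0 : 0 ≤ D := by
    have := log_two_pos
    positivity
  have hlogv : 0 < Real.log (1 + 1 / (v : ℝ)) :=
    Real.log_pos (by linarith [show 0 < 1 / (v : ℝ) by positivity])
  have hlogT : 0 ≤ Real.log T := Real.log_natCast_nonneg T
  have hβT := hβ0 T (by omega)
  set γ := (maxInfoGain P X f ε T).toReal with hγ
  have hγ0 : 0 ≤ γ := ENNReal.toReal_nonneg
  have hcs : ∑ t ∈ Finset.range T, σ t ≤ √(T * (2 / Real.log (1 + 1 / (v : ℝ)) * γ)) := by
    refine Real.le_sqrt_of_sq_le ?_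
    have h1 := sq_sum_le_card_mul_sum_sq (s := Finset.range T) (f := σ)
    rw [Finset.card_range] at h1
    exact h1.trans (mul_le_mul_of_nonneg_left (h.sum_posteriorStd_sq_le hv hk hξ T) T.cast_nonneg)
  calc ∑ t ∈ Finset.range T, r t
      ≤ ∑ t ∈ Finset.range T, √(β T) * (D * √(Real.log T)) * σ t := by
        refine Finset.sum_le_sum fun t ht => (hr t).trans ?_
        have htT := Finset.mem_range.1 ht
        rw [mul_right_comm]
        refine mul_le_mul_of_nonneg_right ?_ (hσ0 t)
        refine mul_le_mul (Real.sqrt_le_sqrt (hβ _ _ (by omega) htT))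
          (add_sqrt_log_le hv' hκ hK htT hT) (by positivity) (Real.sqrt_nonneg _)
    _ = √(β T) * (D * √(Real.log T)) * ∑ t ∈ Finset.range T, σ t := by rw [Finset.mul_sum]
    _ ≤ √(β T) * (D * √(Real.log T)) * √(T * (2 / Real.log (1 + 1 / (v : ℝ)) * γ)) := by
        gcongr
    _ = D * √(2 / Real.log (1 + 1 / (v : ℝ))) * √(β T * γ * T * Real.log T) := by
        have h1 : √(β T * γ * T * Real.log T) = √(β T) * √γ * √T * √(Real.log T) := by
          rw [Real.sqrt_mul (by positivity), Real.sqrt_mul (by positivity), Real.sqrt_mul hβT]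
        rw [h1, Real.sqrt_mul T.cast_nonneg, Real.sqrt_mul (by positivity)]
        ring

/-- Regret of one step, up to the confidence bounds at the query `x t` and at a point `q`. -/
lemma IsBayesModel.instant_regret_le (h : IsBayesModel 𝒢 P X k v f ε) (hv : 0 < v) (hκ : 0 < κ)
    (hk : ∀ z ∈ X, κ ≤ k z z ∧ k z z ≤ 1) {β : ℕ → ℝ} {x : ℕ → Ω → Fin d → ℝ} {y : ℕ → Ω → ℝ}
    (hrun : IsEIRun 𝒢 X k v β f ε x y) {t : ℕ} (hβ : 0 < β (t + 1)) {ω : Ω} {q : Fin d → ℝ}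
    (hq : q ∈ X)
    (hcq : |f q ω - runMean k v x y t ω q| ≤ √(β (t + 1)) * runStd k v x t ω q)
    (hcx : |f (x t ω) ω - runMean k v x y t ω (x t ω)| ≤
      √(β (t + 1)) * runStd k v x t ω (x t ω)) :
    f q ω - f (x t ω) ω ≤ √(β (t + 1)) * runStd k v x t ω (x t ω) *
      (1 + tau 0 / tau (-1) + √(2 * Real.log (1 / (κ * v / (v + t))))) := by
  have hv' : (0 : ℝ) < v := hv
  have hξ : ∀ i : Fin t, x i ω ∈ X := fun i => hrun.mem i ω
  have h1 := sub_le_of_isMaxOn_expectedImprovement (m := runMean k v x y t ω)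
    (s := runStd k v x t ω) (s₀ := κ * v / (v + t)) (F := f q ω) (Real.sqrt_pos.2 hβ)
    (by positivity)
    (fun z hz => ⟨h.le_posteriorStd hv hk hξ hz, h.posteriorStd_le_one hv (fun z hz => (hk z hz).2)
      hξ hz⟩)
    (h.bddAbove_posteriorMean (fun z hz => (hk z hz).2) hξ _) (hrun.mem t ω) hq (hrun.argmax t ω)
    (by linarith [le_abs_self (f q ω - runMean k v x y t ω q)])
  have h2 := neg_abs_le (f (x t ω) ω - runMean k v x y t ω (x t ω))
  linarith

/-- Failure probability of the confidence bound at a point determined by the history. -/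
lemma IsEIRun.measure_deviation_le (h : IsBayesModel 𝒢 P X k v f ε) (hv : 0 < v)
    (hX : MeasurableSet X) (hcont : ∀ᵐ ω ∂P, ContinuousOn (fun z => f z ω) X) {β : ℕ → ℝ}
    {x : ℕ → Ω → Fin d → ℝ} {y : ℕ → Ω → ℝ}
    (hrun : IsEIRun 𝒢 X k v β f ε x y) {t : ℕ} (hβ : 0 ≤ β (t + 1)) {ζ : Ω → Fin d → ℝ}
    (hζ : Measurable[history 𝒢 x y t] ζ) (hζX : ∀ ω, ζ ω ∈ X) :
    P {ω | √(β (t + 1)) * runStd k v x t ω (ζ ω) < |f (ζ ω) ω - runMean k v x y t ω (ζ ω)|} ≤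
      ENNReal.ofReal (Real.exp (-β (t + 1) / 2)) := by
  -- The internal randomness is that of the identity map into `(Ω, 𝒢)`.
  have hid : 𝒢 = MeasurableSpace.comap (id : Ω → Ω) 𝒢 := MeasurableSpace.comap_id.symm
  have hx := hrun.nonanticipating
  rw [hid] at h hζ
  have hx' : ∀ t, Measurable[history (MeasurableSpace.comap (id : Ω → Ω) 𝒢) x y t] (x t) := by
    rw [← hid]; exact hx
  have h1 := @IsBayesModel.measure_deviation_le d Ω Ω 𝒢 mΩ P _ X k v f ε id h hv hX hcont x y
    hrun.mem hx' hrun.obs hrun.obs_measurable t ζ hζ hζX (√(β (t + 1))) (Real.sqrt_nonneg _)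
  rwa [Real.sq_sqrt hβ] at h1

/-- It suffices to bound the outer measure of an exceptional set. -/
lemma regretBound_of_measure_le {x : ℕ → Ω → Fin d → ℝ} {β : ℕ → ℝ} {δ C : ℝ} (hδ : 0 ≤ δ)
    {Bad : Set Ω} (hBad : P Bad ≤ ENNReal.ofReal δ)
    (hgood : ∀ ω ∉ Bad, ∃ xstar ∈ X, IsMaxOn (fun z => f z ω) X xstar ∧
      ∀ T : ℕ, 2 ≤ T → ∑ t ∈ Finset.range T, (f xstar ω - f (x t ω) ω) ≤
        C * √(β T * (maxInfoGain P X f ε T).toReal * T * Real.log T)) :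
    RegretBound P X f ε x β δ C := by
  refine ⟨(toMeasurable P Bad)ᶜ, (measurableSet_toMeasurable P Bad).compl, ?_, fun ω hω =>
    hgood ω fun hb => hω (subset_toMeasurable P Bad hb)⟩
  rw [prob_compl_eq_one_sub (measurableSet_toMeasurable P Bad), measure_toMeasurable,
    ENNReal.ofReal_sub _ hδ, ENNReal.ofReal_one]
  exact tsub_le_tsub_left hBad 1

end Path

/-- Distribution of the failure probability `c` over the steps, by `∑ 1 / t² = π² / 6`. -/
lemma tsum_ofReal_div_sq {c : ℝ} (hc : 0 ≤ c) :
    ∑' t : ℕ, ENNReal.ofReal (c * (6 / (Real.pi ^ 2 * (t + 1 : ℝ) ^ 2))) = ENNReal.ofReal c := by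
  have h1 := (hasSum_nat_add_iff' 1).2 hasSum_zeta_two
  simp only [Finset.range_one, Finset.sum_singleton, Nat.cast_zero, ne_eq, OfNat.ofNat_ne_zero,
    not_false_eq_true, zero_pow, div_zero, sub_zero, Nat.cast_add, Nat.cast_one] at h1
  have h2 := h1.mul_left (c * (6 / Real.pi ^ 2))
  have h3 : c * (6 / Real.pi ^ 2) * (Real.pi ^ 2 / 6) = c := by
    have := Real.pi_pos
    field_simp
  rw [h3] at h2
  have h4 : (fun t : ℕ => c * (6 / (Real.pi ^ 2 * (t + 1 : ℝ) ^ 2))) =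
      fun t : ℕ => c * (6 / Real.pi ^ 2) * (1 / (t + 1 : ℝ) ^ 2) := by
    funext t
    have := Real.pi_pos
    field_simp
  rw [← h4] at h2
  rw [← ENNReal.ofReal_tsum_of_nonneg (fun t => by positivity) h2.summable, h2.tsum_eq]

section Settings

variable {d : ℕ} {Ω : Type*} {𝒢 : MeasurableSpace Ω} [mΩ : MeasurableSpace Ω]
  {P : Measure Ω} [IsProbabilityMeasure P] {X : Set (Fin d → ℝ)}
  {k : (Fin d → ℝ) → (Fin d → ℝ) → ℝ} {v : ℝ≥0} {f : (Fin d → ℝ) → Ω → ℝ} {ε : ℕ → Ω → ℝ}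
  {κ δ : ℝ} {x : ℕ → Ω → Fin d → ℝ} {y : ℕ → Ω → ℝ}

/-! ### Finite domains -/

lemma one_lt_pi_sq_div_six : 1 < Real.pi ^ 2 / 6 := by
  nlinarith [Real.pi_gt_three]

lemma betaFinite_pos (hfin : X.Finite) (hne : X.Nonempty) (hδ0 : 0 < δ) (hδ1 : δ < 1) {t : ℕ}
    (ht : 1 ≤ t) : 0 < betaFinite X δ t := by
  have hc : (1 : ℝ) ≤ X.ncard := by exact_mod_cast (Set.ncard_pos hfin).2 hne
  have ht' : (1 : ℝ) ≤ t := by exact_mod_cast ht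
  have h1 : 1 < Real.pi ^ 2 := by nlinarith [Real.pi_gt_three]
  refine mul_pos two_pos (Real.log_pos ?_)
  rw [lt_div_iff₀ (by positivity)]
  have h2 : (1 : ℝ) ≤ X.ncard * (t : ℝ) ^ 2 := one_le_mul_of_one_le_of_one_le hc (one_le_pow₀ ht')
  have h3 := one_lt_pi_sq_div_six
  nlinarith [mul_le_mul_of_nonneg_right h2 (sq_nonneg Real.pi)]

lemma betaFinite_le (hfin : X.Finite) (hne : X.Nonempty) (hδ0 : 0 < δ) {s t : ℕ} (hs : 1 ≤ s)
    (hst : s ≤ t) : betaFinite X δ s ≤ betaFinite X δ t := by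
  have hc : (1 : ℝ) ≤ X.ncard := by exact_mod_cast (Set.ncard_pos hfin).2 hne
  have hs' : (1 : ℝ) ≤ s := by exact_mod_cast hs
  have hst' : (s : ℝ) ≤ t := by exact_mod_cast hst
  have := Real.pi_pos
  rw [betaFinite, betaFinite]
  gcongr

lemma exp_neg_betaFinite (hfin : X.Finite) (hne : X.Nonempty) (hδ0 : 0 < δ) {t : ℕ} (ht : 1 ≤ t) :
    X.ncard * Real.exp (-betaFinite X δ t / 2) = δ * (6 / (Real.pi ^ 2 * (t : ℝ) ^ 2)) := by
  have hc : (0 : ℝ) < X.ncard := by exact_mod_cast (Set.ncard_pos hfin).2 hne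
  have ht' : (0 : ℝ) < t := by exact_mod_cast ht
  have := Real.pi_pos
  rw [betaFinite, ← mul_neg, mul_div_cancel_left₀ _ two_ne_zero, ← Real.log_inv,
    Real.exp_log (by positivity)]
  field_simp

/-- Regret bound on a finite domain: a union bound over all points and times. -/
theorem regretBound_finite (hv : 0 < v) (hκ : 0 < κ) (hne : X.Nonempty) (hδ0 : 0 < δ) (hδ1 : δ < 1)
    (hk : ∀ z ∈ X, κ ≤ k z z ∧ k z z ≤ 1) (h : IsBayesModel 𝒢 P X k v f ε) (hfin : X.Finite)
    (hrun : IsEIRun 𝒢 X k v (betaFinite X δ) f ε x y) {K : ℝ} (hK : 1 + tau 0 / tau (-1) ≤ K) :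
    RegretBound P X f ε x (betaFinite X δ) δ (regretConst v κ K) := by
  have hβ := fun {t : ℕ} (ht : 1 ≤ t) => betaFinite_pos hfin hne hδ0 hδ1 ht
  let Fail : ℕ → (Fin d → ℝ) → Set Ω := fun t z =>
    {ω | √(betaFinite X δ (t + 1)) * runStd k v x t ω z < |f z ω - runMean k v x y t ω z|}
  have hBad : P (⋃ t, ⋃ z ∈ hfin.toFinset, Fail t z) ≤ ENNReal.ofReal δ := by
    refine (measure_iUnion_le _).trans ?_
    rw [← tsum_ofReal_div_sq hδ0.le]
    refine ENNReal.tsum_le_tsum fun t => ?_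
    have h1 : ∀ z ∈ hfin.toFinset,
        P (Fail t z) ≤ ENNReal.ofReal (Real.exp (-betaFinite X δ (t + 1) / 2)) := fun z hz =>
      IsEIRun.measure_deviation_le h hv hfin.measurableSet
        (.of_forall fun ω => hfin.continuousOn _) hrun (hβ (by omega)).le
        (ζ := fun _ => z) measurable_const fun _ => hfin.mem_toFinset.1 hz
    refine (measure_biUnion_finset_le _ _).trans ((Finset.sum_le_sum h1).trans_eq ?_)
    rw [Finset.sum_const, nsmul_eq_mul, ← Set.ncard_eq_toFinset_card X hfin,
      ← ENNReal.ofReal_natCast, ← ENNReal.ofReal_mul (Nat.cast_nonneg _),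
      exp_neg_betaFinite hfin hne hδ0 (by omega)]
    push_cast
    rfl
  refine regretBound_of_measure_le hδ0.le hBad fun ω hω => ?_
  have hconf : ∀ t, ∀ z ∈ X, |f z ω - runMean k v x y t ω z| ≤
      √(betaFinite X δ (t + 1)) * runStd k v x t ω z := by
    intro t z hz
    by_contra hlt
    exact hω (Set.mem_iUnion.2 ⟨t, Set.mem_iUnion₂.2 ⟨z, hfin.mem_toFinset.2 hz, not_le.1 hlt⟩⟩)
  obtain ⟨q, hq, hmax⟩ := Set.exists_max_image X (fun z => f z ω) hfin hne
  refine ⟨q, hq, fun z hz => hmax z hz, fun T hT => ?_⟩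
  have hK0 : 0 ≤ K := by
    have := tau_pos 0
    have := tau_pos (-1)
    exact le_trans (by positivity) hK
  refine h.sum_regret_le hv hκ (fun z hz => (hk z hz).2) (ξ := fun i => x i ω)
    (fun i => hrun.mem i ω) (r := fun t => f q ω - f (x t ω) ω) hK0 (fun t ht => (hβ ht).le)
    (fun s t hs hst => betaFinite_le hfin hne hδ0 hs hst) (fun t => ?_) hT
  refine (h.instant_regret_le hv hκ hk hrun (hβ (by omega)) hq (hconf t q hq)
    (hconf t _ (hrun.mem t ω))).trans ?_
  exact mul_le_mul_of_nonneg_left (by gcongr)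
    (mul_nonneg (Real.sqrt_nonneg _) (Real.sqrt_nonneg _))

/-! ### Continuous domains -/

/-- A subset of `[0, r]^d` has a net of at most `M ^ d` points at scale `r / M`: one point in each
nonempty cell of a grid. -/
lemma exists_finset_net {r : ℝ} (hr : 0 < r) (hsub : ∀ x ∈ X, ∀ j, 0 ≤ x j ∧ x j ≤ r) {M : ℕ}
    (hM : 0 < M) :
    ∃ S : Finset (Fin d → ℝ), ↑S ⊆ X ∧ S.card ≤ M ^ d ∧ ∀ x ∈ X, ∃ q ∈ S, ‖x - q‖ ≤ r / M := by
  classical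
  have hM' : (0 : ℝ) < M := by exact_mod_cast hM
  -- The last cell in each direction contains its right end point.
  let cell : (Fin d → ℝ) → Fin d → Fin M := fun x j =>
    ⟨min ⌊x j * M / r⌋₊ (M - 1), by omega⟩
  have hcell : ∀ x ∈ X, ∀ j, (cell x j : ℝ) ≤ x j * M / r ∧ x j * M / r ≤ (cell x j : ℝ) + 1 := by
    intro x hx j
    have h0 : 0 ≤ x j * M / r := div_nonneg (mul_nonneg (hsub x hx j).1 hM'.le) hr.le
    have h1 : x j * M / r ≤ M := by
      rw [div_le_iff₀ hr, mul_comm]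
      exact mul_le_mul_of_nonneg_left (hsub x hx j).2 hM'.le
    refine ⟨le_trans (Nat.cast_le.2 (min_le_left _ _)) (Nat.floor_le h0), ?_⟩
    rcases le_total ⌊x j * M / r⌋₊ (M - 1) with hle | hle
    · have : (cell x j : ℕ) = ⌊x j * M / r⌋₊ := min_eq_left hle
      rw [this]
      exact (Nat.lt_floor_add_one _).le
    · have : (cell x j : ℕ) = M - 1 := min_eq_right hle
      rw [this, Nat.cast_sub hM]
      simpa using h1
  let S := (Finset.univ.filter fun c => ∃ x ∈ X, cell x = c).image (Function.invFunOn cell X)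
  refine ⟨S, ?_, ?_, fun x hx => ?_⟩
  · intro q hq
    obtain ⟨c, hc, rfl⟩ := Finset.mem_image.1 hq
    exact Function.invFunOn_mem (Finset.mem_filter.1 hc).2
  · refine Finset.card_image_le.trans ((Finset.card_filter_le _ _).trans_eq ?_)
    simp
  · have hex : ∃ x' ∈ X, cell x' = cell x := ⟨x, hx, rfl⟩
    refine ⟨Function.invFunOn cell X (cell x), Finset.mem_image_of_mem _
      (Finset.mem_filter.2 ⟨Finset.mem_univ _, hex⟩), ?_⟩
    have hq := Function.invFunOn_mem hex
    have heq := Function.invFunOn_eq hex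
    set q := Function.invFunOn cell X (cell x)
    refine (pi_norm_le_iff_of_nonneg (by positivity)).2 fun j => ?_
    have h1 := hcell x hx j
    have h2 := hcell q hq j
    rw [heq] at h2
    have h3 : x j - q j = (x j * M / r - q j * M / r) * (r / M) := by
      field_simp
    have h4 : |x j * M / r - q j * M / r| ≤ 1 := by
      rw [abs_le]
      constructor <;> linarith
    rw [Pi.sub_apply, Real.norm_eq_abs, h3, abs_mul, abs_of_pos (div_pos hr hM')]
    exact mul_le_of_le_one_left (by positivity) h4

/-- Bounded partial derivatives on a convex set make a function Lipschitz for the maximum norm. -/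
lemma abs_sub_le_of_gradient {φ : (Fin d → ℝ) → ℝ} {g : (Fin d → ℝ) → Fin d → ℝ} {L : ℝ}
    (hconv : Convex ℝ X)
    (hg : ∀ x ∈ X, HasFDerivWithinAt φ
      (∑ j, g x j • (ContinuousLinearMap.proj j : (Fin d → ℝ) →L[ℝ] ℝ)) X x)
    (hL : ∀ x ∈ X, ∀ j, |g x j| ≤ L) {p q : Fin d → ℝ} (hp : p ∈ X) (hq : q ∈ X) :
    |φ p - φ q| ≤ d * L * ‖p - q‖ := by
  refine hconv.norm_image_sub_le_of_norm_hasFDerivWithin_le hg (fun x hx => ?_) hq hp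
  refine (norm_sum_le _ _).trans ?_
  calc ∑ j, ‖g x j • (ContinuousLinearMap.proj j : (Fin d → ℝ) →L[ℝ] ℝ)‖ ≤ ∑ _j : Fin d, L := by
        refine Finset.sum_le_sum fun j _ => ?_
        have h1 : ‖(ContinuousLinearMap.proj j : (Fin d → ℝ) →L[ℝ] ℝ)‖ ≤ 1 :=
          ContinuousLinearMap.opNorm_le_bound _ zero_le_one fun z => by
            rw [one_mul]; exact norm_le_pi_norm z j
        rw [norm_smul, Real.norm_eq_abs]
        exact (mul_le_of_le_one_right (abs_nonneg _) h1).trans (hL x hx j)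
    _ = d * L := by simp

/-- The number of grid cells per direction at time `t`: the argument of the second logarithm in
`betaContinuous`. -/
noncomputable def gridSize (d : ℕ) (a b r δ : ℝ) (t : ℕ) : ℕ :=
  ⌈b * d * r * (t : ℝ) ^ 2 * √(Real.log (4 * a * d / δ))⌉₊ + 1

section Beta

variable {a b r : ℝ}

lemma log_four_mul_pos (hd : 0 < d) (ha : 1 ≤ a) (hδ0 : 0 < δ) (hδ1 : δ < 1) :
    0 < Real.log (4 * a * d / δ) := by
  have hd' : (1 : ℝ) ≤ d := by exact_mod_cast hd
  refine Real.log_pos ((one_lt_div hδ0).2 ?_)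
  nlinarith [mul_le_mul ha hd' zero_le_one (by linarith)]

lemma betaContinuous_eq (hr : 0 < r) (hb : 0 < b) (t : ℕ) :
    betaContinuous d a b r δ t = 2 * Real.log (Real.pi ^ 2 * (t : ℝ) ^ 2 / (3 * δ)) +
      2 * d * Real.log (gridSize d a b r δ t) := by
  rw [betaContinuous, gridSize, Nat.cast_add, Nat.cast_one, natCast_ceil_eq_intCast_ceil (by positivity)]

lemma gridSize_le (hr : 0 < r) (hb : 0 < b) {s t : ℕ} (hst : s ≤ t) :
    gridSize d a b r δ s ≤ gridSize d a b r δ t := by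
  rw [gridSize, gridSize]
  gcongr

lemma two_le_gridSize (hd : 0 < d) (ha : 1 ≤ a) (hr : 0 < r) (hb : 0 < b) (hδ0 : 0 < δ)
    (hδ1 : δ < 1) {t : ℕ} (ht : 1 ≤ t) : 2 ≤ gridSize d a b r δ t := by
  have h1 := log_four_mul_pos hd ha hδ0 hδ1
  have hd' : (0 : ℝ) < d := by exact_mod_cast hd
  have ht' : (0 : ℝ) < t := by exact_mod_cast ht
  have h2 := Nat.ceil_pos.2
    (show 0 < b * d * r * (t : ℝ) ^ 2 * √(Real.log (4 * a * d / δ)) by positivity)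
  rw [gridSize]
  omega

/-- The discretization error is at most `1 / t²` when all partial derivatives are bounded by
`b √(log (4 a d / δ))`. -/
lemma lipschitz_mul_div_gridSize_le {t : ℕ} (ht : 1 ≤ t) :
    d * (b * √(Real.log (4 * a * d / δ))) * (r / gridSize d a b r δ t) ≤ 1 / (t : ℝ) ^ 2 := by
  have ht' : (0 : ℝ) < t := by exact_mod_cast ht
  have hM : (0 : ℝ) < gridSize d a b r δ t := by rw [gridSize]; positivity
  rw [mul_div_assoc', div_le_div_iff₀ hM (by positivity), one_mul]
  have h1 := Nat.le_ceil (b * d * r * (t : ℝ) ^ 2 * √(Real.log (4 * a * d / δ)))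
  rw [gridSize, Nat.cast_add, Nat.cast_one]
  linarith

lemma one_le_betaContinuous (hr : 0 < r) (hb : 0 < b) (hδ0 : 0 < δ) (hδ1 : δ < 1) {t : ℕ}
    (ht : 1 ≤ t) : 1 ≤ betaContinuous d a b r δ t := by
  have ht' : (1 : ℝ) ≤ t := by exact_mod_cast ht
  have h1 : 0 ≤ Real.log (gridSize d a b r δ t) := Real.log_natCast_nonneg _
  have h2 : 1 ≤ Real.log (Real.pi ^ 2 * (t : ℝ) ^ 2 / (3 * δ)) := by
    rw [Real.le_log_iff_exp_le (by positivity), le_div_iff₀ (by positivity)]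
    have he := Real.exp_one_lt_d9
    have hpi : 9 ≤ Real.pi ^ 2 := by nlinarith [Real.pi_gt_three]
    calc Real.exp 1 * (3 * δ) ≤ 3 * (3 * 1) := by
          gcongr
          linarith
      _ = 9 * 1 := by norm_num
      _ ≤ Real.pi ^ 2 * (t : ℝ) ^ 2 := by
          gcongr
          exact one_le_pow₀ ht'
  rw [betaContinuous_eq hr hb]
  have h3 : 0 ≤ 2 * (d : ℝ) * Real.log (gridSize d a b r δ t) := by positivity
  linarith

lemma betaContinuous_le (hr : 0 < r) (hb : 0 < b) (hδ0 : 0 < δ) {s t : ℕ} (hs : 1 ≤ s)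
    (hst : s ≤ t) : betaContinuous d a b r δ s ≤ betaContinuous d a b r δ t := by
  have hs' : (1 : ℝ) ≤ s := by exact_mod_cast hs
  have hst' : (s : ℝ) ≤ t := by exact_mod_cast hst
  have hg : (gridSize d a b r δ s : ℝ) ≤ gridSize d a b r δ t := by
    exact_mod_cast gridSize_le hr hb hst
  have hg0 : (0 : ℝ) < gridSize d a b r δ s := by rw [gridSize]; positivity
  have := Real.pi_pos
  rw [betaContinuous_eq hr hb, betaContinuous_eq hr hb]
  gcongr

/-- The failure probabilities of the confidence bounds at the points of the net and at the query
add up to at most `3 δ / 4`: those of the net to `δ / 2`, and the query costs at most one half of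
this, as the net is counted with at least two cells per direction. -/
lemma gridSize_pow_add_one_mul_exp_le (hd : 0 < d) (ha : 1 ≤ a) (hr : 0 < r) (hb : 0 < b)
    (hδ0 : 0 < δ) (hδ1 : δ < 1) {t : ℕ} (ht : 1 ≤ t) :
    ((gridSize d a b r δ t : ℝ) ^ d + 1) * Real.exp (-betaContinuous d a b r δ t / 2) ≤
      3 * δ / 4 * (6 / (Real.pi ^ 2 * (t : ℝ) ^ 2)) := by
  have ht' : (0 : ℝ) < t := by exact_mod_cast ht
  have hpi := Real.pi_pos
  have hM : (2 : ℝ) ≤ gridSize d a b r δ t := by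
    exact_mod_cast two_le_gridSize hd ha hr hb hδ0 hδ1 ht
  have hMd : (2 : ℝ) ≤ (gridSize d a b r δ t : ℝ) ^ d :=
    hM.trans (le_self_pow₀ (by linarith) hd.ne')
  have hexp : Real.exp (-betaContinuous d a b r δ t / 2) =
      3 * δ / (Real.pi ^ 2 * (t : ℝ) ^ 2) * ((gridSize d a b r δ t : ℝ) ^ d)⁻¹ := by
    have h1 : -betaContinuous d a b r δ t / 2 =
        Real.log ((Real.pi ^ 2 * (t : ℝ) ^ 2 / (3 * δ))⁻¹) +
          Real.log (((gridSize d a b r δ t : ℝ) ^ d)⁻¹) := by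
      rw [betaContinuous_eq hr hb, Real.log_inv, Real.log_inv, Real.log_pow]
      ring
    rw [h1, Real.exp_add, Real.exp_log (by positivity), Real.exp_log (by positivity), inv_div]
  rw [hexp]
  have h2 : ((gridSize d a b r δ t : ℝ) ^ d + 1) * ((gridSize d a b r δ t : ℝ) ^ d)⁻¹ ≤ 3 / 2 := by
    rw [← div_eq_mul_inv, div_le_iff₀ (by positivity)]
    linarith
  calc ((gridSize d a b r δ t : ℝ) ^ d + 1) *
        (3 * δ / (Real.pi ^ 2 * (t : ℝ) ^ 2) * ((gridSize d a b r δ t : ℝ) ^ d)⁻¹)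
      = 3 * δ / (Real.pi ^ 2 * (t : ℝ) ^ 2) *
        (((gridSize d a b r δ t : ℝ) ^ d + 1) * ((gridSize d a b r δ t : ℝ) ^ d)⁻¹) := by ring
    _ ≤ 3 * δ / (Real.pi ^ 2 * (t : ℝ) ^ 2) * (3 / 2) := by gcongr
    _ = _ := by ring

end Beta

/-- In dimension zero the domain is a point and there is no regret. -/
lemma regretBound_of_subsingleton [Subsingleton (Fin d → ℝ)] {β : ℕ → ℝ} {C : ℝ} (hC : 0 ≤ C)
    (hδ0 : 0 ≤ δ) (hxX : ∀ t ω, x t ω ∈ X) : RegretBound P X f ε x β δ C := by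
  refine regretBound_of_measure_le (Bad := ∅) hδ0 (by simp) fun ω _ => ?_
  refine ⟨x 0 ω, hxX 0 ω, fun z _ => (congrArg (fun z => f z ω) (Subsingleton.elim z (x 0 ω))).le,
    fun T _ => ?_⟩
  have h1 : ∀ t, f (x 0 ω) ω - f (x t ω) ω = 0 := fun t => by
    rw [Subsingleton.elim (x t ω) (x 0 ω), sub_self]
  simp only [h1, Finset.sum_const_zero]
  positivity

/-- Regret bound on a continuous domain: at each time, the confidence bounds are needed at the query
and at the points of a net, one of which is close to the maximizer. The failure probabilities
are `δ / 4` for the bound on the derivatives and `3 δ / 4` for the confidence bounds. -/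
theorem regretBound_continuous (hv : 0 < v) (hκ : 0 < κ) (hne : X.Nonempty) (hδ0 : 0 < δ)
    (hδ1 : δ < 1) (hk : ∀ z ∈ X, κ ≤ k z z ∧ k z z ≤ 1) (h : IsBayesModel 𝒢 P X k v f ε)
    {r a b : ℝ} (hs : IsSmoothSetting P X f r a b)
    (hrun : IsEIRun 𝒢 X k v (betaContinuous d a b r δ) f ε x y) {K : ℝ}
    (hK : 1 + tau 0 / tau (-1) + (v + 1) / (κ * v) ≤ K) :
    RegretBound P X f ε x (betaContinuous d a b r δ) δ (regretConst v κ K) := by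
  have hv' : (0 : ℝ) < v := hv
  have hK0 : 0 < K := by
    have := tau_pos 0
    have := tau_pos (-1)
    exact lt_of_lt_of_le (by positivity) hK
  rcases Nat.eq_zero_or_pos d with rfl | hd
  · exact regretBound_of_subsingleton (regretConst_pos hv' hK0).le hδ0.le hrun.mem
  obtain ⟨G, hG, hGtail⟩ := hs.gradient
  have hr := hs.r_pos
  have ha := hs.one_le_a
  have hb := hs.b_pos
  have hd' : (0 : ℝ) < d := by exact_mod_cast hd
  set β := betaContinuous d a b r δ with hβdef
  have hβ1 : ∀ t, 1 ≤ t → 1 ≤ β t := fun t ht => one_le_betaContinuous hr hb hδ0 hδ1 ht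
  have hlog := log_four_mul_pos hd ha hδ0 hδ1
  set L := b * √(Real.log (4 * a * d / δ)) with hL
  have hL0 : 0 < L := by positivity
  have hcont : ∀ᵐ ω ∂P, ContinuousOn (fun z => f z ω) X := by
    filter_upwards [hG] with ω hω z hz
    exact (hω z hz).continuousWithinAt
  have hnet := fun t => exists_finset_net hr hs.subset_cube (M := gridSize d a b r δ (t + 1))
    (Nat.succ_pos _)
  choose S hSX hScard hS using hnet
  let Fail : ℕ → (Ω → Fin d → ℝ) → Set Ω := fun t ζ =>
    {ω | √(β (t + 1)) * runStd k v x t ω (ζ ω) < |f (ζ ω) ω - runMean k v x y t ω (ζ ω)|}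
  have hFail : ∀ t {ζ : Ω → Fin d → ℝ}, Measurable[history 𝒢 x y t] ζ → (∀ ω, ζ ω ∈ X) →
      P (Fail t ζ) ≤ ENNReal.ofReal (Real.exp (-β (t + 1) / 2)) := fun t ζ hζ hζX =>
    IsEIRun.measure_deviation_le h hv hs.compact.measurableSet hcont hrun
      (zero_le_one.trans (hβ1 _ (by omega))) hζ hζX
  let BadG : Set Ω := {ω | ¬ ∀ x ∈ X, HasFDerivWithinAt (fun z => f z ω)
      (∑ j, G ω x j • (ContinuousLinearMap.proj j : (Fin d → ℝ) →L[ℝ] ℝ)) X x}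
  let BadL : Set Ω := ⋃ j : Fin d, {ω | ENNReal.ofReal L < ⨆ x ∈ X, ‖G ω x j‖ₑ}
  let BadC : Set Ω := ⋃ t, ((⋃ z ∈ S t, Fail t fun _ => z) ∪ Fail t (x t))
  -- The threshold `L` makes each tail equal to `δ / (4 d)`.
  have hPL : P BadL ≤ ENNReal.ofReal (δ / 4) := by
    refine (measure_iUnion_le _).trans ?_
    rw [tsum_fintype]
    refine (Finset.sum_le_sum fun j _ => hGtail j L hL0).trans_eq ?_
    rw [Finset.sum_const, Finset.card_univ, Fintype.card_fin, nsmul_eq_mul,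
      ← ENNReal.ofReal_natCast, ← ENNReal.ofReal_mul (Nat.cast_nonneg _)]
    congr 1
    rw [hL, mul_div_cancel_left₀ _ hb.ne', Real.sq_sqrt hlog.le, ← Real.log_inv,
      Real.exp_log (by positivity)]
    field_simp
  have hPC : P BadC ≤ ENNReal.ofReal (3 * δ / 4) := by
    refine (measure_iUnion_le _).trans ?_
    rw [← tsum_ofReal_div_sq (by positivity : 0 ≤ 3 * δ / 4)]
    refine ENNReal.tsum_le_tsum fun t => ?_
    calc P ((⋃ z ∈ S t, Fail t fun _ => z) ∪ Fail t (x t))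
        ≤ ∑ z ∈ S t, P (Fail t fun _ => z) + P (Fail t (x t)) :=
          (measure_union_le _ _).trans (add_le_add_left (measure_biUnion_finset_le _ _) _)
      _ ≤ ∑ z ∈ S t, ENNReal.ofReal (Real.exp (-β (t + 1) / 2)) +
            ENNReal.ofReal (Real.exp (-β (t + 1) / 2)) :=
          add_le_add (Finset.sum_le_sum fun z hz => hFail t measurable_const fun _ => hSX t hz)
            (hFail t (hrun.nonanticipating t) (hrun.mem t))
      _ = ENNReal.ofReal (((S t).card + 1) * Real.exp (-β (t + 1) / 2)) := by
          rw [Finset.sum_const, nsmul_eq_mul, ← ENNReal.ofReal_natCast,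
            ← ENNReal.ofReal_mul (Nat.cast_nonneg _),
            ← ENNReal.ofReal_add (by positivity) (by positivity)]
          ring_nf
      _ ≤ ENNReal.ofReal (3 * δ / 4 * (6 / (Real.pi ^ 2 * (t + 1 : ℝ) ^ 2))) := by
          refine ENNReal.ofReal_le_ofReal ?_
          have h1 : ((S t).card : ℝ) ≤ (gridSize d a b r δ (t + 1) : ℝ) ^ d := by
            exact_mod_cast hScard t
          have h2 := gridSize_pow_add_one_mul_exp_le hd ha hr hb hδ0 hδ1
            (show 1 ≤ t + 1 by omega)
          push_cast at h2
          refine le_trans ?_ h2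
          gcongr
  have hBad : P (BadG ∪ BadL ∪ BadC) ≤ ENNReal.ofReal δ := by
    have hPG : P BadG = 0 := ae_iff.1 hG
    calc P (BadG ∪ BadL ∪ BadC) ≤ P BadG + P BadL + P BadC :=
          (measure_union_le _ _).trans (add_le_add_left (measure_union_le _ _) _)
      _ ≤ 0 + ENNReal.ofReal (δ / 4) + ENNReal.ofReal (3 * δ / 4) :=
          add_le_add (add_le_add hPG.le hPL) hPC
      _ = ENNReal.ofReal δ := by
          rw [zero_add, ← ENNReal.ofReal_add (by positivity) (by positivity)]
          congr 1
          ring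
  refine regretBound_of_measure_le hδ0.le hBad fun ω hω => ?_
  simp only [Set.mem_union, not_or] at hω
  obtain ⟨⟨hωG, hωL⟩, hωC⟩ := hω
  have hgrad : ∀ x ∈ X, HasFDerivWithinAt (fun z => f z ω)
      (∑ j, G ω x j • (ContinuousLinearMap.proj j : (Fin d → ℝ) →L[ℝ] ℝ)) X x :=
    not_not.1 hωG
  have hbound : ∀ x ∈ X, ∀ j, |G ω x j| ≤ L := by
    intro z hz j
    by_contra hlt
    refine hωL (Set.mem_iUnion.2 ⟨j, ?_⟩)
    have h1 : ENNReal.ofReal L < ‖G ω z j‖ₑ := by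
      rw [Real.enorm_eq_ofReal_abs]
      exact (ENNReal.ofReal_lt_ofReal_iff_of_nonneg hL0.le).2 (not_le.1 hlt)
    exact h1.trans_le (le_iSup₂ (f := fun x (_ : x ∈ X) => ‖G ω x j‖ₑ) z hz)
  have hconfS : ∀ t, ∀ z ∈ S t, |f z ω - runMean k v x y t ω z| ≤
      √(β (t + 1)) * runStd k v x t ω z := by
    intro t z hz
    by_contra hlt
    exact hωC (Set.mem_iUnion.2 ⟨t, Or.inl (Set.mem_iUnion₂.2 ⟨z, hz, not_le.1 hlt⟩)⟩)
  have hconfx : ∀ t, |f (x t ω) ω - runMean k v x y t ω (x t ω)| ≤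
      √(β (t + 1)) * runStd k v x t ω (x t ω) := by
    intro t
    by_contra hlt
    exact hωC (Set.mem_iUnion.2 ⟨t, Or.inr (not_le.1 hlt)⟩)
  obtain ⟨xs, hxs, hmax⟩ := hs.compact.exists_isMaxOn hne
    (fun z hz => (hgrad z hz).continuousWithinAt : ContinuousOn (fun z => f z ω) X)
  refine ⟨xs, hxs, hmax, fun T hT => ?_⟩
  refine h.sum_regret_le hv hκ (fun z hz => (hk z hz).2) (ξ := fun i => x i ω)
    (fun i => hrun.mem i ω) (r := fun t => f xs ω - f (x t ω) ω) hK0.le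
    (fun t ht => zero_le_one.trans (hβ1 t ht))
    (fun s t hs hst => betaContinuous_le hr hb hδ0 hs hst) (fun t => ?_) hT
  obtain ⟨q, hq, hdist⟩ := hS t xs hxs
  have hqX := hSX t hq
  have hβt := hβ1 (t + 1) (by omega)
  have h1 := h.instant_regret_le hv hκ hk hrun (lt_of_lt_of_le one_pos hβt) hqX (hconfS t q hq)
    (hconfx t)
  -- The discretization error is absorbed, since `σ ≥ κ v / (v + t)` and `β ≥ 1`.
  have h2 : f xs ω - f q ω ≤ 1 / ((t + 1 : ℕ) : ℝ) ^ 2 := by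
    refine (le_abs_self _).trans ((abs_sub_le_of_gradient hs.convex hgrad hbound hxs hqX).trans ?_)
    exact (mul_le_mul_of_nonneg_left hdist (by positivity)).trans
      (lipschitz_mul_div_gridSize_le (by omega))
  have hσ : κ * v / (v + t) ≤ runStd k v x t ω (x t ω) :=
    h.le_posteriorStd hv hk (fun i => hrun.mem i ω) (hrun.mem t ω)
  have ht0 : (0 : ℝ) ≤ t := t.cast_nonneg
  have h3 : 1 / ((t + 1 : ℕ) : ℝ) ^ 2 ≤
      √(β (t + 1)) * runStd k v x t ω (x t ω) * ((v + 1) / (κ * v)) := by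
    calc 1 / ((t + 1 : ℕ) : ℝ) ^ 2 ≤ 1 * (κ * v / (v + t)) * ((v + 1) / (κ * v)) := by
          have hcancel : κ * v / (v + t) * ((v + 1) / (κ * v)) = (v + 1) / (v + t) := by
            field_simp
          rw [one_mul, hcancel, div_le_div_iff₀ (by positivity)
            (by positivity)]
          push_cast
          nlinarith [mul_nonneg hv'.le ht0, mul_nonneg (mul_nonneg hv'.le ht0) ht0]
      _ ≤ _ := by
          gcongr
          exact Real.one_le_sqrt.2 hβt
  have hnn : 0 ≤ √(β (t + 1)) * runStd k v x t ω (x t ω) :=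
    mul_nonneg (Real.sqrt_nonneg _) (Real.sqrt_nonneg _)
  calc f xs ω - f (x t ω) ω = (f xs ω - f q ω) + (f q ω - f (x t ω) ω) := by ring
    _ ≤ √(β (t + 1)) * runStd k v x t ω (x t ω) * ((1 + tau 0 / tau (-1) + (v + 1) / (κ * v)) +
          √(2 * Real.log (1 / (κ * v / (v + t))))) := by
        linarith
    _ ≤ _ := mul_le_mul_of_nonneg_left (by gcongr) hnn

end Settings

end GPEI

theorem mainTheorem7 (v : ℝ≥0) (hv : 0 < v) (κ : ℝ) (hκ : 0 < κ) :
    ∃ C : ℝ, 0 < C ∧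
      ∀ (d : ℕ) (X : Set (Fin d → ℝ)) (k : (Fin d → ℝ) → (Fin d → ℝ) → ℝ)
        (δ : ℝ) (Ω : Type*) (𝒢 : MeasurableSpace Ω) [MeasurableSpace Ω]
        (P : Measure Ω) [IsProbabilityMeasure P] (f : (Fin d → ℝ) → Ω → ℝ) (ε : ℕ → Ω → ℝ)
        (x : ℕ → Ω → Fin d → ℝ) (y : ℕ → Ω → ℝ),
        X.Nonempty → 0 < δ → δ < 1 →
        (∀ z ∈ X, κ ≤ k z z ∧ k z z ≤ 1) →
        GPEI.IsBayesModel 𝒢 P X k v f ε →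
        (X.Finite →
          GPEI.IsEIRun 𝒢 X k v (GPEI.betaFinite X δ) f ε x y →
          GPEI.RegretBound P X f ε x (GPEI.betaFinite X δ) δ C) ∧
        (∀ r a b : ℝ, GPEI.IsSmoothSetting P X f r a b →
          GPEI.IsEIRun 𝒢 X k v (GPEI.betaContinuous d a b r δ) f ε x y →
          GPEI.RegretBound P X f ε x (GPEI.betaContinuous d a b r δ) δ C) := by
  have hv' : (0 : ℝ) < v := hv
  have h0 := GPEI.tau_pos 0
  have h1 := GPEI.tau_pos (-1)
  have hA : 0 < (v + 1) / (κ * v) := by positivity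
  -- The summand `(v + 1) / (κ v)` absorbs the discretization error of continuous domains.
  refine ⟨GPEI.regretConst v κ (1 + GPEI.tau 0 / GPEI.tau (-1) + (v + 1) / (κ * v)),
    GPEI.regretConst_pos hv' (by positivity), ?_⟩
  intro d X k δ Ω 𝒢 _ P _ f ε x y hne hδ0 hδ1 hk h
  exact ⟨fun hfin hrun => GPEI.regretBound_finite hv hκ hne hδ0 hδ1 hk h hfin hrun (by linarith),
    fun r a b hs hrun => GPEI.regretBound_continuous hv hκ hne hδ0 hδ1 hk h hs hrun le_rfl⟩
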